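/- Let $k$ be an algebraically closed field of characteristic $p>0$, let $\mathcal O$ be a discrete valuation ring that is a finite extension of the ring of Witt vectors $W(k)$, and let $F=\mathcal O[1/p]$ with its absolute value normalized by $|p|=p^{-1}$, $v_p=-\log_p|\cdot|$. Let $\Omega^{\mathrm{imm}}_{\mathrm{an}}$ be the ring (under the usual addition and multiplication of series) of series $x=\sum_{i\in\mathbb Q,\ i\ge 0}x_it^i$ with $x_i\in F$ such that for each real $\rho>0$ the set $\{i:|x_i|>\rho\}$ is well-ordered and, for each $r>0$, $w_r(x)=\sup_i|x_i|p^{-ri}$ is finite. Let $\Omega_{\mathrm{an}}$ be the subring of the series supported on integers $i\ge0$. Let $\Gamma^{\mathrm{imm}}[1/p]$ be the ring of series $\sum_{i\in\mathbb Q}x_it^i$ with bounded coefficients $x_i\in F$ such that for each $\rho>0$ the set $\{i:|x_i|>\rho\}$ is well-ordered, let $\Gamma[1/p]$ be its subfield of series supported on $\mathbb Z$, and let $\Gamma^{\mathrm{alg}}[1/p]$ be the $p$-adic closure (i.e. closure for $\sup_i|x_i|$) in $\Gamma^{\mathrm{imm}}[1/p]$ of the set of elements algebraic over $\Gamma[1/p]$.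 Let $\Omega^{\mathrm{alg}}_{\mathrm{an}}$ be the subring of those $x\in\Omega^{\mathrm{imm}}_{\mathrm{an}}$ such that for each $j$ there is $y=\sum_{i\ge 0}y_it^i\in\Gamma^{\mathrm{alg}}[1/p]$ with $y_i=x_i$ for all $i<j$. Let $R$ be one of $\Omega_{\mathrm{an}}$, $\Omega^{\mathrm{alg}}_{\mathrm{an}}$, $\Omega^{\mathrm{imm}}_{\mathrm{an}}$, with the Fréchet topology defined by the norms $w_r$, $r>0$. The Newton polygon of a nonzero $x=\sum x_it^i\in R$ is the lower boundary of the convex hull of the points $(i,v_p(x_i))$ with $x_i\ne0$; a real number $s>0$ is a slope of $x$ if this polygon contains a segment of slope $-s$. The element $x$ is pure of slope $s$ if $x_0\neq0$ and $s$ is its only slope. A slope factorization of a nonzero $x\in R$ is an expression $x=c\,t^j\prod_{i=1}^Ny_i$ in $R$, where $c$ is a unit of $R$ (possibly $1$), $j\ge 0$, $N$ is a nonnegative integer or $\infty$, each $y_i\in R$ is pure of some slope $s_i$, the sequence $s_1,s_2,\dots$ is strictly decreasing, and, if $N=\infty$, $s_i\to0$ and the product converges in the Fréchet topology. **Proposition.**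 The slope factorization of a nonzero $x\in R$ is unique up to units: if $x=c\,t^j\prod_{i=1}^Ny_i=c'\,t^{j'}\prod_{i=1}^{N'}z_i$ are two slope factorizations, then $j=j'$, $N=N'$, and for every $i$ there is a unit $u_i$ of $R$ with $z_i=u_iy_i$. -/

import Mathlib

namespace AnRing


/-- The Cauchy product of two generalized power series `∑ x_i t^i`, `∑ y_i t^i` with rational
exponents, a series being identified with its coefficient function `ℚ → F`. The coefficient sums
are infinite; they converge unconditionally in all the rings considered below. -/
noncomputable def conv {F : Type*} [NormedField F] (x y : ℚ → F) : ℚ → F :=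
  fun n => ∑' i : ℚ, x i * y (n - i)

/-- The monomial `a t^j`. -/
def mono {F : Type*} [NormedField F] (j : ℚ) (a : F) : ℚ → F := fun i => if i = j then a else 0

/-- For each `r > 0` the set of exponents `i` with `|x_i| > r` is well-ordered. -/
def WOLevels {F : Type*} [NormedField F] (x : ℚ → F) : Prop :=
  ∀ r : ℝ, 0 < r → {i : ℚ | r < ‖x i‖}.IsWF

/-- The coefficients are bounded. -/
def Bdd {F : Type*} [NormedField F] (x : ℚ → F) : Prop := ∃ C : ℝ, ∀ i, ‖x i‖ ≤ C

section conv

variable {F : Type*} [NormedField F] [IsUltrametricDist F] [CompleteSpace F]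

theorem Bdd.exists_pos {F : Type*} [NormedField F] {x : ℚ → F} (h : Bdd x) :
    ∃ C : ℝ, 0 < C ∧ ∀ i, ‖x i‖ ≤ C := by
  obtain ⟨C, hC⟩ := h
  exact ⟨max C 1, by positivity, fun i => (hC i).trans (le_max_left _ _)⟩

theorem WOLevels.add {x y : ℚ → F} (hx : WOLevels x) (hy : WOLevels y) : WOLevels (x + y) := by
  intro r hr
  have := ((hx r hr).isPWO.union (hy r hr).isPWO).isWF
  refine this.mono fun i hi => ?_
  simp only [Set.mem_ofPred_eq, Pi.add_apply, Set.mem_union] at hi ⊢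
  have := IsUltrametricDist.norm_add_le_max (x i) (y i)
  rcases le_max_iff.1 this with h | h
  · left; linarith
  · right; linarith

theorem Bdd.add {x y : ℚ → F} (hx : Bdd x) (hy : Bdd y) : Bdd (x + y) := by
  obtain ⟨C, hC⟩ := hx
  obtain ⟨D, hD⟩ := hy
  exact ⟨C + D, fun i => (norm_add_le _ _).trans (add_le_add (hC i) (hD i))⟩

theorem wo_mono (j : ℚ) (a : F) : WOLevels (mono j a) := by
  intro r hr
  refine (Set.finite_singleton j).isWF.mono fun i hi => ?_
  by_contra h
  simp only [Set.mem_singleton_iff] at h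
  simp [mono, h] at hi
  linarith

theorem bdd_mono (j : ℚ) (a : F) : Bdd (mono j a) := by
  refine ⟨‖a‖, fun i => ?_⟩
  unfold mono
  split_ifs <;> simp

/-- The family of products `x_i y_j z_k`, `i + j + k = n`, is summable. -/
theorem summable_triple {x y z : ℚ → F} (hx : WOLevels x) (bx : Bdd x) (hy : WOLevels y)
    (yb : Bdd y) (hz : WOLevels z) (bz : Bdd z) (n : ℚ) :
    Summable (fun q : ℚ × ℚ => x q.1 * y q.2 * z (n - q.1 - q.2)) := by
  apply NonarchimedeanAddGroup.summable_of_tendsto_cofinite_zero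
  obtain ⟨A, hA, bx⟩ := bx.exists_pos
  obtain ⟨B, hB, yb⟩ := yb.exists_pos
  obtain ⟨C, hC, bz⟩ := bz.exists_pos
  rw [Metric.tendsto_nhds]
  intro ε hε
  rw [Filter.eventually_cofinite]
  set X := {i : ℚ | ε / (2 * B * C) < ‖x i‖}
  set Y := {i : ℚ | ε / (2 * A * C) < ‖y i‖}
  set Z := {i : ℚ | ε / (2 * A * B) < ‖z i‖}
  have hX : X.IsPWO := (hx _ (by positivity)).isPWO
  have hY : Y.IsPWO := (hy _ (by positivity)).isPWO
  have hZ : Z.IsPWO := (hz _ (by positivity)).isPWO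
  have f1 := Set.AddAntidiagonal.finite_of_isPWO hX (hY.add hZ) n
  have f2 : ∀ i, (Set.antidiagonal Y Z (n - i)).Finite :=
    fun i => Set.AddAntidiagonal.finite_of_isPWO hY hZ (n - i)
  refine ((f1.image Prod.fst).biUnion fun i _ =>
    ((f2 i).image Prod.fst).image (fun j => (i, j))).subset ?_
  rintro ⟨i, j⟩ hq
  simp only [Set.mem_ofPred_eq, dist_zero_right, norm_mul, not_lt] at hq
  have b1 := bx i
  have b2 := yb j
  have b3 := bz (n - i - j)
  have hi : i ∈ X := by
    by_contra h
    simp only [X, Set.mem_ofPred_eq, not_lt] at h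
    have : ‖x i‖ * ‖y j‖ * ‖z (n - i - j)‖ ≤ ε / (2 * B * C) * B * C := by gcongr
    have h2 : ε / (2 * B * C) * B * C = ε / 2 := by field_simp
    linarith
  have hj : j ∈ Y := by
    by_contra h
    simp only [Y, Set.mem_ofPred_eq, not_lt] at h
    have : ‖x i‖ * ‖y j‖ * ‖z (n - i - j)‖ ≤ A * (ε / (2 * A * C)) * C := by gcongr
    have h2 : A * (ε / (2 * A * C)) * C = ε / 2 := by field_simp
    linarith
  have hk : n - i - j ∈ Z := by
    by_contra h
    simp only [Z, Set.mem_ofPred_eq, not_lt] at h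
    have : ‖x i‖ * ‖y j‖ * ‖z (n - i - j)‖ ≤ A * B * (ε / (2 * A * B)) := by gcongr
    have h2 : A * B * (ε / (2 * A * B)) = ε / 2 := by field_simp
    linarith
  simp only [Set.mem_iUnion, Set.mem_image]
  refine ⟨i, ⟨(i, n - i), ?_, rfl⟩, j, ⟨(j, n - i - j), ?_, rfl⟩, rfl⟩
  · exact ⟨hi, Set.mem_add.2 ⟨j, hj, n - i - j, hk, by ring⟩, by ring⟩
  · exact ⟨hj, hk, by ring⟩

theorem summable_conv {x y : ℚ → F} (hx : WOLevels x) (bx : Bdd x) (hy : WOLevels y)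
    (yb : Bdd y) (n : ℚ) : Summable (fun i : ℚ => x i * y (n - i)) := by
  have h := summable_triple hx bx (wo_mono 0 (1 : F)) (bdd_mono 0 1) hy yb n
  have := h.prod_symm.prod_factor 0
  simpa [mono] using this

theorem conv_comm (x y : ℚ → F) : conv x y = conv y x := by
  funext n
  unfold conv
  rw [← (Equiv.subLeft n).tsum_eq]
  simp [mul_comm]

theorem conv_add {x y z : ℚ → F} (hx : WOLevels x) (bx : Bdd x) (hy : WOLevels y)
    (yb : Bdd y) (hz : WOLevels z) (bz : Bdd z) :
    conv x (y + z) = conv x y + conv x z := by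
  funext n
  simp only [conv, Pi.add_apply, mul_add]
  exact (summable_conv hx bx hy yb n).tsum_add (summable_conv hx bx hz bz n)

theorem conv_mono (x : ℚ → F) : conv (mono 0 1) x = x := by
  funext n
  simp only [conv, mono]
  rw [tsum_eq_single 0]
  · simp
  · intro i hi; simp [hi]

theorem conv_assoc {x y z : ℚ → F} (hx : WOLevels x) (bx : Bdd x) (hy : WOLevels y)
    (yb : Bdd y) (hz : WOLevels z) (bz : Bdd z) :
    conv (conv x y) z = conv x (conv y z) := by
  funext n
  have S := summable_triple hx bx hy yb hz bz n
  have e1 : conv x (conv y z) n =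
      ∑' i, ∑' j, x i * y j * z (n - i - j) := by
    simp only [conv]
    refine tsum_congr fun i => ?_
    rw [← tsum_mul_left]
    simp [mul_assoc]
  let e : ℚ × ℚ ≃ ℚ × ℚ :=
    ⟨fun q => (q.1, q.2 - q.1), fun q => (q.1, q.2 + q.1), fun q => by simp, fun q => by simp⟩
  have S' := (e.summable_iff).2 S
  have e2 : conv (conv x y) z n = ∑' m, ∑' i, x i * y (m - i) * z (n - m) := by
    simp only [conv]
    refine tsum_congr fun m => ?_
    rw [← tsum_mul_right]
  rw [e1, e2]
  have S'' : Summable (Function.uncurry fun i m => x i * y (m - i) * z (n - m)) := by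
    refine S'.congr fun q => ?_
    simp [e, Function.uncurry]
  rw [S''.tsum_comm]
  refine tsum_congr fun i => ?_
  rw [← (Equiv.addRight i).tsum_eq]
  simp [sub_sub, add_comm]

theorem norm_conv_le {x y : ℚ → F} {n : ℚ} {C : ℝ} (h : ∀ i, ‖x i‖ * ‖y (n - i)‖ ≤ C) :
    ‖conv x y n‖ ≤ C :=
  IsUltrametricDist.norm_tsum_le_of_forall_le fun i => by simpa using h i

theorem wo_conv {x y : ℚ → F} (hx : WOLevels x) (bx : Bdd x) (hy : WOLevels y)
    (yb : Bdd y) : WOLevels (conv x y) := by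
  intro r hr
  obtain ⟨A, hA, bx⟩ := bx.exists_pos
  obtain ⟨B, hB, yb⟩ := yb.exists_pos
  refine ((hx (r / B) (by positivity)).isPWO.add (hy (r / A) (by positivity)).isPWO).isWF.mono ?_
  intro n hn
  by_contra h
  refine absurd hn (not_lt.2 (norm_conv_le fun i => ?_))
  by_cases h1 : r / B < ‖x i‖
  · have h2 : ‖y (n - i)‖ ≤ r / A := by
      by_contra h2
      exact h (Set.mem_add.2 ⟨i, h1, n - i, not_le.1 h2, by ring⟩)
    calc _ ≤ A * (r / A) := by gcongr; exact bx i
      _ = r := by field_simp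
  · calc _ ≤ r / B * B := by gcongr; exact not_lt.1 h1; exact yb _
      _ = r := by field_simp

theorem bdd_conv {x y : ℚ → F} (bx : Bdd x) (yb : Bdd y) : Bdd (conv x y) := by
  obtain ⟨A, hA, bx⟩ := bx.exists_pos
  obtain ⟨B, hB, yb⟩ := yb.exists_pos
  exact ⟨A * B, fun n => norm_conv_le fun i => by gcongr; exacts [bx i, yb _]⟩

end conv

/- ### The ring `Γ^imm[1/p]` and its subrings -/

/-- The additive group of `Γ^imm[1/p]`: series `∑ x_i t^i` over `i ∈ ℚ`, with bounded coefficients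
in `F = 𝒪[1/p]`, such that for each `r > 0` the set of `i` with `|x_i| > r` is well-ordered. The
ring `Γ^imm` itself is the subset where all coefficients lie in `𝒪`. -/
def gammaImmAddSubgroup (F : Type*) [NormedField F] [IsUltrametricDist F] [CompleteSpace F] :
    AddSubgroup (ℚ → F) where
  carrier := {x | WOLevels x ∧ Bdd x}
  zero_mem' := ⟨fun r hr => by simp [hr.not_gt], ⟨0, fun i => by simp⟩⟩
  add_mem' hx hy := ⟨hx.1.add hy.1, hx.2.add hy.2⟩
  neg_mem' {x} hx := ⟨fun r hr => by simpa using hx.1 r hr, by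
    obtain ⟨C, hC⟩ := hx.2
    exact ⟨C, fun i => by simpa using hC i⟩⟩

/-- `Γ^imm[1/p]`. -/
def GammaImm (F : Type*) [NormedField F] [IsUltrametricDist F] [CompleteSpace F] : Type _ :=
  gammaImmAddSubgroup F

section
variable {F : Type*} [NormedField F] [IsUltrametricDist F] [CompleteSpace F]

/-- The coefficient function of an element of `Γ^imm[1/p]`. -/
def GammaImm.coeff (x : GammaImm F) : ℚ → F := x.1

theorem GammaImm.ext {x y : GammaImm F} (h : x.coeff = y.coeff) : x = y := Subtype.ext h

noncomputable instance : AddCommGroup (GammaImm F) :=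
  inferInstanceAs (AddCommGroup (gammaImmAddSubgroup F))

noncomputable instance : CommRing (GammaImm F) where
  mul x y := ⟨conv x.1 y.1, wo_conv x.2.1 x.2.2 y.2.1 y.2.2, bdd_conv x.2.2 y.2.2⟩
  one := ⟨mono 0 1, wo_mono 0 1, bdd_mono 0 1⟩
  mul_assoc x y z := Subtype.ext (conv_assoc x.2.1 x.2.2 y.2.1 y.2.2 z.2.1 z.2.2)
  mul_comm x y := Subtype.ext (conv_comm _ _)
  one_mul x := Subtype.ext (conv_mono _)
  mul_one x := Subtype.ext ((conv_comm _ _).trans (conv_mono _))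
  zero_mul x := Subtype.ext (funext fun n => by
    change conv (0 : ℚ → F) x.1 n = 0
    simp [conv])
  mul_zero x := Subtype.ext (funext fun n => by
    change conv x.1 (0 : ℚ → F) n = 0
    simp [conv])
  left_distrib x y z := Subtype.ext (conv_add x.2.1 x.2.2 y.2.1 y.2.2 z.2.1 z.2.2)
  right_distrib x y z := Subtype.ext (by
    change conv (x.1 + y.1) z.1 = conv x.1 z.1 + conv y.1 z.1
    rw [conv_comm, conv_add z.2.1 z.2.2 x.2.1 x.2.2 y.2.1 y.2.2, conv_comm z.1, conv_comm z.1])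
  __ := (inferInstance : AddCommGroup (GammaImm F))


theorem conv_ne_zero {x y : ℚ → F} {n : ℚ} (h : conv x y n ≠ 0) :
    ∃ i, x i ≠ 0 ∧ y (n - i) ≠ 0 := by
  by_contra! H
  apply h
  have : ∀ i, x i * y (n - i) = 0 := fun i => by
    by_cases hi : x i = 0
    · simp [hi]
    · simp [H i hi]
  simp [conv, this]

/-- `Γ[1/p]` inside `Γ^imm[1/p]`: the series supported on the integers. Here `Γ` is the `p`-adic
completion of `𝒪[[t]][1/t]`, that is, the ring of series `∑ x_n t^n` over `n ∈ ℤ` with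
coefficients in `𝒪` and `x_n → 0` as `n → -∞`. -/
def Gamma (F : Type*) [NormedField F] [IsUltrametricDist F] [CompleteSpace F] :
    Subring (GammaImm F) where
  carrier := {x | ∀ i, x.coeff i ≠ 0 → ∃ n : ℤ, (n : ℚ) = i}
  zero_mem' i hi := absurd rfl hi
  one_mem' i hi := by
    change mono 0 (1 : F) i ≠ 0 at hi
    by_cases h : i = 0
    · exact ⟨0, by simp [h]⟩
    · simp [mono, h] at hi
  add_mem' {x y} hx hy i hi := by
    change x.coeff i + y.coeff i ≠ 0 at hi
    by_cases h : x.coeff i = 0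
    · rw [h, zero_add] at hi
      exact hy i hi
    · exact hx i h
  neg_mem' {x} hx i hi := hx i (by
    change -x.coeff i ≠ 0 at hi
    simpa using hi)
  mul_mem' {x y} hx hy n hn := by
    obtain ⟨i, h1, h2⟩ := conv_ne_zero (F := F) hn
    obtain ⟨a, ha⟩ := hx i h1
    obtain ⟨b, hb⟩ := hy _ h2
    exact ⟨a + b, by push_cast; rw [ha, hb]; ring⟩

/-- `Γ^alg[1/p]` inside `Γ^imm[1/p]`: the closure, for the `p`-adic topology, of the relative
integral closure of the field `Γ[1/p]`. Its unit ball `Γ^alg` is the `p`-adically complete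
extension of `Γ` inside `Γ^imm` whose residue field is the algebraic closure of `k((t))` in the
residue field `k((t^ℚ))` of `Γ^imm`. -/
def GammaAlg (F : Type*) [NormedField F] [IsUltrametricDist F] [CompleteSpace F] :
    Subring (GammaImm F) where
  carrier := {y | ∀ ε : ℝ, 0 < ε →
    ∃ z ∈ integralClosure (Gamma F) (GammaImm F), ∀ i, ‖y.coeff i - z.coeff i‖ ≤ ε}
  zero_mem' ε hε := ⟨0, zero_mem _, fun i => by simpa using hε.le⟩
  one_mem' ε hε := ⟨1, one_mem _, fun i => by simpa using hε.le⟩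
  add_mem' {x y} hx hy ε hε := by
    obtain ⟨a, ha, hxa⟩ := hx ε hε
    obtain ⟨b, hb, hyb⟩ := hy ε hε
    refine ⟨a + b, add_mem ha hb, fun i => ?_⟩
    change ‖x.coeff i + y.coeff i - (a.coeff i + b.coeff i)‖ ≤ ε
    rw [add_sub_add_comm]
    exact (IsUltrametricDist.norm_add_le_max _ _).trans (max_le (hxa i) (hyb i))
  neg_mem' {x} hx ε hε := by
    obtain ⟨a, ha, hxa⟩ := hx ε hε
    refine ⟨-a, neg_mem ha, fun i => ?_⟩
    change ‖-x.coeff i - -a.coeff i‖ ≤ ε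
    rw [neg_sub_neg, norm_sub_rev]
    exact hxa i
  mul_mem' {x y} hx hy ε hε := by
    obtain ⟨A, hA, bx⟩ := Bdd.exists_pos x.2.2
    obtain ⟨b, hb, hyb⟩ := hy (ε / A) (by positivity)
    obtain ⟨B, hB, yb⟩ := Bdd.exists_pos b.2.2
    obtain ⟨a, ha, hxa⟩ := hx (ε / B) (by positivity)
    refine ⟨a * b, mul_mem ha hb, fun n => ?_⟩
    have e : x * y - a * b = x * (y - b) + (x - a) * b := by ring
    change ‖(x * y - a * b).coeff n‖ ≤ ε
    rw [e]
    refine (IsUltrametricDist.norm_add_le_max _ _).trans (max_le ?_ ?_)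
    · refine norm_conv_le (F := F) fun i => ?_
      calc _ ≤ A * (ε / A) := by gcongr; exacts [bx i, hyb _]
        _ = ε := by field_simp
    · refine norm_conv_le (F := F) fun i => ?_
      calc _ ≤ (ε / B) * B := by gcongr; exacts [hxa i, yb _]
        _ = ε := by field_simp

end

/- ### The rings `Ω^imm_an`, `Ω_an` and `Ω^alg_an` -/

/-- `w_d(x) = max_i |x_i| p^{-d i}` is finite for each `d > 0`, that is, for each `d > 0` there is
a bound `|x_i| ≤ C p^{d i}`. -/
def Growth (p : ℕ) {F : Type*} [NormedField F] (x : ℚ → F) : Prop :=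
  ∀ d : ℝ, 0 < d → ∃ C : ℝ, ∀ i : ℚ, ‖x i‖ ≤ C * (p : ℝ) ^ (d * i)

section
variable {p : ℕ} [hp : Fact p.Prime] {F : Type*} [NormedField F] [IsUltrametricDist F]
  [CompleteSpace F]

theorem Growth.exists_pos {x : ℚ → F} (h : Growth p x) {d : ℝ} (hd : 0 < d) :
    ∃ C : ℝ, 0 < C ∧ ∀ i : ℚ, ‖x i‖ ≤ C * (p : ℝ) ^ (d * i) := by
  obtain ⟨C, hC⟩ := h d hd
  refine ⟨max C 1, by positivity, fun i => (hC i).trans ?_⟩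
  gcongr
  exact le_max_left _ _

/-- The truncation `∑_{i ≤ n} x_i t^i`. -/
def trunc (n : ℚ) (x : ℚ → F) : ℚ → F := fun i => if i ≤ n then x i else 0

theorem wo_trunc (n : ℚ) {x : ℚ → F} (h : WOLevels x) : WOLevels (trunc n x) := fun r hr =>
  (h r hr).mono fun i hi => by
    by_cases hin : i ≤ n
    · simpa [trunc, hin] using hi
    · simp [trunc, hin] at hi
      linarith

theorem bdd_trunc (n : ℚ) {x : ℚ → F} (h : Growth p x) : Bdd (trunc n x) := by
  obtain ⟨C, hC, h⟩ := h.exists_pos one_pos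
  refine ⟨C * (p : ℝ) ^ ((1 : ℝ) * n), fun i => ?_⟩
  have hp1 : (1 : ℝ) ≤ p := by exact_mod_cast hp.out.one_lt.le
  by_cases hin : i ≤ n
  · simp only [trunc, hin, if_true]
    refine (h i).trans ?_
    gcongr
  · simp only [trunc, hin, if_false, norm_zero]
    positivity

theorem conv_trunc {x y : ℚ → F} (hx : ∀ i < 0, x i = 0) (hy : ∀ i < 0, y i = 0) {m n : ℚ}
    (hmn : m ≤ n) : conv (trunc n x) (trunc n y) m = conv x y m := by
  unfold conv
  refine tsum_congr fun i => ?_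
  by_cases h1 : i < 0
  · simp [trunc, hx i h1]
  by_cases h2 : m - i < 0
  · simp [trunc, hy _ h2]
  have : i ≤ n := by linarith
  have : m - i ≤ n := by linarith
  simp [trunc, *]

theorem conv_supp {x y : ℚ → F} (hx : ∀ i < 0, x i = 0) (hy : ∀ i < 0, y i = 0) :
    ∀ i < 0, conv x y i = 0 := by
  intro n hn
  by_contra h
  obtain ⟨i, h1, h2⟩ := conv_ne_zero h
  have h3 : 0 ≤ i := not_lt.1 fun h => h1 (hx i h)
  have h4 : 0 ≤ n - i := not_lt.1 fun h => h2 (hy _ h)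
  linarith

theorem wo_of_trunc {x : ℚ → F} (h : ∀ n, WOLevels (trunc n x)) : WOLevels x := by
  intro r hr
  rw [Set.isWF_iff_no_descending_seq]
  intro f hf hfs
  refine Set.isWF_iff_no_descending_seq.1 (h (f 0) r hr) f hf fun n => ?_
  have h1 : f n ≤ f 0 := hf.antitone (Nat.zero_le n)
  have h2 : r < ‖x (f n)‖ := hfs n
  simpa [trunc, h1] using h2

theorem trunc_conv {x y : ℚ → F} (hx : ∀ i < 0, x i = 0) (hy : ∀ i < 0, y i = 0) (n : ℚ) :
    trunc n (conv x y) = trunc n (conv (trunc n x) (trunc n y)) := by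
  funext m
  by_cases h : m ≤ n
  · simp [trunc, h, ← conv_trunc hx hy h]
  · simp [trunc, h]

theorem growth_conv {x y : ℚ → F} (hx : Growth p x) (hy : Growth p y) :
    Growth p (conv x y) := by
  intro d hd
  have hp0 : (0 : ℝ) < p := by exact_mod_cast hp.out.pos
  obtain ⟨A, hA, bx⟩ := hx.exists_pos hd
  obtain ⟨B, hB, yb⟩ := hy.exists_pos hd
  refine ⟨A * B, fun n => norm_conv_le fun i => ?_⟩
  calc _ ≤ (A * (p : ℝ) ^ (d * i)) * (B * (p : ℝ) ^ (d * (n - i : ℚ))) := by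
        gcongr; exacts [bx i, yb _]
    _ = A * B * ((p : ℝ) ^ (d * i) * (p : ℝ) ^ (d * (n - i : ℚ))) := by ring
    _ = _ := by
        rw [← Real.rpow_add hp0]
        congr 2
        push_cast
        ring

end

/-- The additive group of `Ω^imm_an`: series `∑ x_i t^i` over rational `i ≥ 0` with coefficients in
`F = 𝒪[1/p]`, such that for each `r > 0` the set of `i` with `|x_i| > r` is well-ordered, and
`w_d(x)` is finite for each `d > 0`. -/
def omegaImmAnAddSubgroup (p : ℕ) [Fact p.Prime] (F : Type*) [NormedField F]
    [IsUltrametricDist F] [CompleteSpace F] : AddSubgroup (ℚ → F) where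
  carrier := {x | (∀ i < 0, x i = 0) ∧ WOLevels x ∧ Growth p x}
  zero_mem' := ⟨fun _ _ => rfl, fun r hr => by simp [hr.not_gt], fun d hd => ⟨0, fun i => by simp⟩⟩
  add_mem' {x y} hx hy := ⟨fun i hi => by simp [hx.1 i hi, hy.1 i hi], hx.2.1.add hy.2.1, by
    intro d hd
    obtain ⟨C, hC⟩ := hx.2.2 d hd
    obtain ⟨D, hD⟩ := hy.2.2 d hd
    refine ⟨C + D, fun i => (norm_add_le _ _).trans ?_⟩
    rw [add_mul]
    exact add_le_add (hC i) (hD i)⟩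
  neg_mem' {x} hx := ⟨fun i hi => by simp [hx.1 i hi], fun r hr => by simpa using hx.2.1 r hr, by
    intro d hd
    obtain ⟨C, hC⟩ := hx.2.2 d hd
    exact ⟨C, fun i => by simpa using hC i⟩⟩

/-- The ring `Ω^imm_an`. -/
def OmegaImmAn (p : ℕ) [Fact p.Prime] (F : Type*) [NormedField F] [IsUltrametricDist F]
    [CompleteSpace F] : Type _ :=
  omegaImmAnAddSubgroup p F

section
variable {p : ℕ} [hp : Fact p.Prime] {F : Type*} [NormedField F] [IsUltrametricDist F]
  [CompleteSpace F]

/-- The coefficient function of an element of `Ω^imm_an`. -/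
def OmegaImmAn.coeff (x : OmegaImmAn p F) : ℚ → F := x.1

theorem mono_mem {j : ℚ} (hj : 0 ≤ j) (a : F) : mono j a ∈ omegaImmAnAddSubgroup p F := by
  refine ⟨fun i hi => ?_, wo_mono j a, fun d hd => ?_⟩
  · have : i ≠ j := by rintro rfl; linarith
    simp [mono, this]
  · have hp0 : (0 : ℝ) < p := by exact_mod_cast hp.out.pos
    refine ⟨‖a‖ * ((p : ℝ) ^ (d * j))⁻¹, fun i => ?_⟩
    by_cases h : i = j
    · subst h
      have : (p : ℝ) ^ (d * i) ≠ 0 := by positivity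
      simp [mono, this]
    · simp only [mono, h, if_false, norm_zero]
      positivity

noncomputable instance : AddCommGroup (OmegaImmAn p F) :=
  inferInstanceAs (AddCommGroup (omegaImmAnAddSubgroup p F))

theorem conv_mem {x y : ℚ → F} (hx : x ∈ omegaImmAnAddSubgroup p F)
    (hy : y ∈ omegaImmAnAddSubgroup p F) : conv x y ∈ omegaImmAnAddSubgroup p F := by
  refine ⟨conv_supp hx.1 hy.1, wo_of_trunc fun n => ?_, growth_conv hx.2.2 hy.2.2⟩
  rw [trunc_conv hx.1 hy.1]
  exact wo_trunc n (wo_conv (wo_trunc n hx.2.1) (bdd_trunc n hx.2.2) (wo_trunc n hy.2.1)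
    (bdd_trunc n hy.2.2))

theorem conv_trunc_left {x y : ℚ → F} (hy : ∀ i < 0, y i = 0) (n : ℚ) :
    conv (trunc n x) y n = conv x y n := by
  unfold conv
  refine tsum_congr fun i => ?_
  by_cases h : i ≤ n
  · simp [trunc, h]
  · simp [hy (n - i) (by linarith)]

theorem conv_assoc_an {x y z : ℚ → F} (hx : x ∈ omegaImmAnAddSubgroup p F)
    (hy : y ∈ omegaImmAnAddSubgroup p F) (hz : z ∈ omegaImmAnAddSubgroup p F) :
    conv (conv x y) z = conv x (conv y z) := by
  have key : ∀ {x y z : ℚ → F}, x ∈ omegaImmAnAddSubgroup p F →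
      y ∈ omegaImmAnAddSubgroup p F → z ∈ omegaImmAnAddSubgroup p F → ∀ n,
      conv (conv x y) z n = conv (conv (trunc n x) (trunc n y)) (trunc n z) n := by
    intro x y z hx hy hz n
    have tz : ∀ i < 0, trunc n z i = 0 := fun i hi => by simp [trunc, hz.1 i hi]
    rw [← conv_trunc_left tz (x := conv (trunc n x) (trunc n y)), ← trunc_conv hx.1 hy.1,
      conv_trunc (conv_supp hx.1 hy.1) hz.1 le_rfl]
  have B := fun (n : ℚ) {x : ℚ → F} (hx : x ∈ omegaImmAnAddSubgroup p F) => bdd_trunc n hx.2.2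
  have W := fun (n : ℚ) {x : ℚ → F} (hx : x ∈ omegaImmAnAddSubgroup p F) => wo_trunc n hx.2.1
  funext n
  rw [key hx hy hz, conv_comm x, key hy hz hx, conv_comm _ (trunc n x),
    conv_assoc (W n hx) (B n hx) (W n hy) (B n hy) (W n hz) (B n hz)]

theorem conv_add_an {x y z : ℚ → F} (hx : x ∈ omegaImmAnAddSubgroup p F)
    (hy : y ∈ omegaImmAnAddSubgroup p F) (hz : z ∈ omegaImmAnAddSubgroup p F) :
    conv x (y + z) = conv x y + conv x z := by
  funext n
  have e : trunc n (y + z) = trunc n y + trunc n z := by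
    funext i
    by_cases h : i ≤ n <;> simp [trunc, h]
  rw [Pi.add_apply, ← conv_trunc hx.1 hy.1 le_rfl, ← conv_trunc hx.1 hz.1 le_rfl,
    ← conv_trunc hx.1 (add_mem hy hz).1 le_rfl, e,
    conv_add (wo_trunc n hx.2.1) (bdd_trunc n hx.2.2) (wo_trunc n hy.2.1) (bdd_trunc n hy.2.2)
      (wo_trunc n hz.2.1) (bdd_trunc n hz.2.2), Pi.add_apply]

noncomputable instance : CommRing (OmegaImmAn p F) where
  mul x y := ⟨conv x.1 y.1, conv_mem x.2 y.2⟩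
  one := ⟨mono 0 1, mono_mem le_rfl 1⟩
  mul_assoc x y z := Subtype.ext (conv_assoc_an x.2 y.2 z.2)
  mul_comm x y := Subtype.ext (conv_comm _ _)
  one_mul x := Subtype.ext (conv_mono _)
  mul_one x := Subtype.ext ((conv_comm _ _).trans (conv_mono _))
  zero_mul x := Subtype.ext (funext fun n => by
    change conv (0 : ℚ → F) x.1 n = 0
    simp [conv])
  mul_zero x := Subtype.ext (funext fun n => by
    change conv x.1 (0 : ℚ → F) n = 0
    simp [conv])
  left_distrib x y z := Subtype.ext (conv_add_an x.2 y.2 z.2)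
  right_distrib x y z := Subtype.ext (by
    change conv (x.1 + y.1) z.1 = conv x.1 z.1 + conv y.1 z.1
    rw [conv_comm, conv_add_an z.2 x.2 y.2, conv_comm z.1, conv_comm z.1])
  __ := (inferInstance : AddCommGroup (OmegaImmAn p F))

end

/-- `Ω_an` inside `Ω^imm_an`: the power series `∑_{n ≥ 0} x_n t^n` with integer exponents. -/
def OmegaAn (p : ℕ) [Fact p.Prime] (F : Type*) [NormedField F] [IsUltrametricDist F]
    [CompleteSpace F] : Subring (OmegaImmAn p F) where
  carrier := {x | ∀ i, x.coeff i ≠ 0 → ∃ n : ℕ, (n : ℚ) = i}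
  zero_mem' i hi := absurd rfl hi
  one_mem' i hi := by
    change mono 0 (1 : F) i ≠ 0 at hi
    by_cases h : i = 0
    · exact ⟨0, by simp [h]⟩
    · simp [mono, h] at hi
  add_mem' {x y} hx hy i hi := by
    change x.coeff i + y.coeff i ≠ 0 at hi
    by_cases h : x.coeff i = 0
    · rw [h, zero_add] at hi
      exact hy i hi
    · exact hx i h
  neg_mem' {x} hx i hi := hx i (by
    change -x.coeff i ≠ 0 at hi
    simpa using hi)
  mul_mem' {x y} hx hy n hn := by
    obtain ⟨i, h1, h2⟩ := conv_ne_zero (F := F) hn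
    obtain ⟨a, ha⟩ := hx i h1
    obtain ⟨b, hb⟩ := hy _ h2
    exact ⟨a + b, by push_cast; rw [ha, hb]; ring⟩

/-- `Ω^alg_an` inside `Ω^imm_an`: the series `x` which below each exponent `j` agree with an
element `y` of `Ω^alg[1/p]`, that is, an element of `Γ^alg[1/p]` with no negative exponents. -/
def OmegaAlgAn (p : ℕ) [Fact p.Prime] (F : Type*) [NormedField F] [IsUltrametricDist F]
    [CompleteSpace F] : Subring (OmegaImmAn p F) where
  carrier := {x | ∀ j : ℚ, ∃ y ∈ GammaAlg F,
    (∀ i < 0, y.coeff i = 0) ∧ ∀ i < j, y.coeff i = x.coeff i}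
  zero_mem' j := ⟨0, zero_mem _, fun _ _ => rfl, fun _ _ => rfl⟩
  one_mem' j := ⟨1, one_mem _, (mono_mem (p := p) le_rfl (1 : F)).1, fun _ _ => rfl⟩
  add_mem' {x y} hx hy j := by
    obtain ⟨a, ha, ha0, hxa⟩ := hx j
    obtain ⟨b, hb, hb0, hyb⟩ := hy j
    refine ⟨a + b, add_mem ha hb, fun i hi => ?_, fun i hi => ?_⟩
    · change a.coeff i + b.coeff i = 0
      rw [ha0 i hi, hb0 i hi, add_zero]
    · change a.coeff i + b.coeff i = x.coeff i + y.coeff i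
      rw [hxa i hi, hyb i hi]
  neg_mem' {x} hx j := by
    obtain ⟨a, ha, ha0, hxa⟩ := hx j
    refine ⟨-a, neg_mem ha, fun i hi => ?_, fun i hi => ?_⟩
    · change -a.coeff i = 0
      rw [ha0 i hi, neg_zero]
    · change -a.coeff i = -x.coeff i
      rw [hxa i hi]
  mul_mem' {x y} hx hy j := by
    obtain ⟨a, ha, ha0, hxa⟩ := hx j
    obtain ⟨b, hb, hb0, hyb⟩ := hy j
    refine ⟨a * b, mul_mem ha hb, conv_supp ha0 hb0, fun n hn => ?_⟩
    change conv a.coeff b.coeff n = conv x.coeff y.coeff n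
    rw [← conv_trunc ha0 hb0 le_rfl,
      ← conv_trunc (x := x.coeff) (y := y.coeff) x.2.1 y.2.1 le_rfl]
    have e1 : trunc n a.coeff = trunc n x.coeff := funext fun i => by
      by_cases h : i ≤ n
      · simp [trunc, h, hxa i (h.trans_lt hn)]
      · simp [trunc, h]
    have e2 : trunc n b.coeff = trunc n y.coeff := funext fun i => by
      by_cases h : i ≤ n
      · simp [trunc, h, hyb i (h.trans_lt hn)]
      · simp [trunc, h]
    rw [e1, e2]

/- ### Newton polygons and slope factorizations -/

section
variable {p : ℕ} [hp : Fact p.Prime] {F : Type*} [NormedField F] [IsUltrametricDist F]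
  [CompleteSpace F]

/-- The monomial `t^j` for rational `j ≥ 0`. -/
def tPow (p : ℕ) [Fact p.Prime] (F : Type*) [NormedField F] [IsUltrametricDist F]
    [CompleteSpace F] (j : ℚ≥0) : OmegaImmAn p F :=
  ⟨mono j 1, mono_mem j.2 1⟩

/-- The norm `w_r(x) = max_i |x_i| p^{-r i}`, for `r > 0`. -/
noncomputable def w (r : ℝ) (x : OmegaImmAn p F) : ℝ :=
  ⨆ i : ℚ, ‖x.coeff i‖ * (p : ℝ) ^ (-(r * i))

/-- Convergence of a sequence in the Fréchet topology defined by the norms `w_r`, `r > 0`. -/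
def FrechetTendsto (u : ℕ → OmegaImmAn p F) (x : OmegaImmAn p F) : Prop :=
  ∀ r : ℝ, 0 < r → Filter.Tendsto (fun n => w r (u n - x)) Filter.atTop (nhds 0)

/-- The valuation `v_p` on `F ∖ {0}`, with `|a| = p^{-v_p(a)}`. -/
noncomputable def vp (p : ℕ) (a : F) : ℝ := -Real.logb p ‖a‖

/-- The convex hull of the points `(i, v_p(x_i))` with `x_i ≠ 0`. Its lower boundary is the Newton
polygon of `x`. -/
def newtonHull (x : OmegaImmAn p F) : Set (ℝ × ℝ) :=
  convexHull ℝ {P | ∃ i : ℚ, x.coeff i ≠ 0 ∧ P = ((i : ℝ), vp p (x.coeff i))}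

/-- The real number `s > 0` is a slope of `x`: the Newton polygon of `x` contains a nondegenerate
segment `PQ` of slope `-s`. (A line segment in the convex hull lies on its lower boundary exactly
when no point of the hull lies below the line through it. Only the part of the polygon where it
descends is considered.) -/
def IsSlope (x : OmegaImmAn p F) (s : ℝ) : Prop :=
  0 < s ∧ ∃ P ∈ newtonHull x, ∃ Q ∈ newtonHull x, P.1 < Q.1 ∧ P.2 + s * P.1 = Q.2 + s * Q.1 ∧
    ∀ S ∈ newtonHull x, P.2 + s * P.1 ≤ S.2 + s * S.1

/-- `x` is pure of slope `s`: its constant coefficient is nonzero, and `s` is its only slope. -/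
def IsPure (x : OmegaImmAn p F) (s : ℝ) : Prop :=
  x.coeff 0 ≠ 0 ∧ IsSlope x s ∧ ∀ s', IsSlope x s' → s' = s

/-- A slope factorization `x = c t^j ∏_{i < N} y_i` in `R`, where `N ≤ ∞`, `c` is a unit of `R`,
`y_i` is pure of slope `s_i`, the slopes are strictly decreasing, and, if `N = ∞`, they tend to `0`
and the product converges in the Fréchet topology. The factors are indexed from `0`, and `y_i` and `s_i`
are irrelevant for `i ≥ N`. -/
structure SlopeFactorization (R : Subring (OmegaImmAn p F)) (x : R) where
  /-- the unit `c` -/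
  c : Rˣ
  /-- the exponent `j` of `t` -/
  j : ℚ≥0
  tPow_mem : tPow p F j ∈ R
  /-- the number of factors -/
  N : ℕ∞
  /-- the factors -/
  y : ℕ → R
  /-- the slopes -/
  s : ℕ → ℝ
  isPure : ∀ i : ℕ, (i : ℕ∞) < N → IsPure (y i : OmegaImmAn p F) (s i)
  strictAnti : ∀ i i' : ℕ, i < i' → (i' : ℕ∞) < N → s i' < s i
  tendsto_zero : N = ⊤ → Filter.Tendsto s Filter.atTop (nhds 0)
  /-- the value of the product of the factors -/
  prod : R
  prod_finite : ∀ n : ℕ, N = n → prod = ∏ i ∈ Finset.range n, y i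
  prod_infinite : N = ⊤ →
    FrechetTendsto (fun n => ((∏ i ∈ Finset.range n, y i : R) : OmegaImmAn p F)) prod
  eq : x = (c : R) * ⟨tPow p F j, tPow_mem⟩ * prod

end

end AnRing

/-!
Since `F` is discretely valued and the exponents are suitably well-ordered, the supremum defining
`w_r(x)` is attained at finitely many indices. Their extreme ones behave like degrees: they add up
under products, so `w_r` is multiplicative, and the slopes of `x` are the `r` at which they differ.
A factor of slope `s` is therefore dominated by its constant term exactly at the radii `r > s`.
Letting `r → ∞` determines `j`, and the radius at which a tail `∏_{i ≥ k} y_i` stops being dominated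
by its constant term determines `s_k`, whence the slopes of two factorizations agree.

Suppose now that `y A' = z B'` up to a unit, with `y` and `z` pure of slope `s` and with tails `A'`
and `B'` of smaller slopes. At a radius `r < s` close to `s` the tail `B'` is still dominated by its
constant term, so `z` is the `w_r`-limit of `y v_n`, where `v_n` is `A'` times a partial sum of the
geometric series of `1 / B'`. At all radii below `s` a single term of `y` dominates, and this
bounds `v_n` well enough for its limit to lie in `Ω^imm_an`. Thus `y ∣ z` there, and by symmetry the
two are associated.

It remains to see that the units found in `Ω^imm_an` lie in `R`. If `y(0) ≠ 0` then `u` is the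
`w_r`-limit of `(u y) y(0)⁻¹ ∑_{k < n} (1 - y(0)⁻¹ y)^k` for `r` large, so it suffices that `R` is
closed under uniform approximation of the coefficients below each exponent. For `Ω^alg_an` this
asks that an element of `Γ^alg` which is small below an exponent be close to an element of `Γ^alg`
that vanishes there. Modulo the maximal ideal, `Γ^alg` consists of the algebraic Hahn series over
the residue field, which is perfect; the required element is the Teichmüller lift of the reduction.
-/

namespace AnRing

open Filter Topology
open scoped NormedField Valued

/-! ### Weights of series -/

section Ultrametric

variable {E : Type*} [SeminormedAddCommGroup E] [IsUltrametricDist E]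

theorem norm_sub_le_max (a b : E) : ‖a - b‖ ≤ max ‖a‖ ‖b‖ := by
  simpa [sub_eq_add_neg] using IsUltrametricDist.norm_add_le_max a (-b)

theorem norm_sub_le_of_antitone {a : ℕ → E} {ε : ℕ → ℝ} (hε : Antitone ε)
    (h : ∀ n, ‖a n - a (n + 1)‖ ≤ ε n) {m n : ℕ} (hmn : m ≤ n) : ‖a m - a n‖ ≤ ε m := by
  induction n, hmn using Nat.le_induction with
  | base => simpa using (norm_nonneg _).trans (h m)
  | succ n hmn ih =>
    rw [← sub_add_sub_cancel (a m) (a n)]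
    exact (IsUltrametricDist.norm_add_le_max _ _).trans (max_le ih ((h n).trans (hε hmn)))

end Ultrametric

section DiscreteNorm

variable {F : Type*} [NormedField F] [IsUltrametricDist F]

theorem norm_unit_integer (u : 𝒪[F]ˣ) : ‖((u : 𝒪[F]) : F)‖ = 1 := by
  have h := (Valuation.integer.integers (Valued.v : Valuation F NNReal)).valuation_unit u
  exact congrArg NNReal.toReal h

theorem norm_irreducible_pos {ϖ : 𝒪[F]} (hϖ : Irreducible ϖ) : 0 < ‖(ϖ : F)‖ :=
  Valuation.integer.v_irreducible_pos (v := (Valued.v : Valuation F NNReal)) hϖ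

theorem norm_irreducible_lt_one {ϖ : 𝒪[F]} (hϖ : Irreducible ϖ) : ‖(ϖ : F)‖ < 1 :=
  Valuation.integer.v_irreducible_lt_one (v := (Valued.v : Valuation F NNReal)) hϖ

theorem tendsto_norm_irreducible_pow {ϖ : 𝒪[F]} (hϖ : Irreducible ϖ) :
    Tendsto (fun n : ℕ => ‖(ϖ : F)‖ ^ n) atTop (𝓝 0) :=
  tendsto_pow_atTop_nhds_zero_of_lt_one (norm_nonneg _) (norm_irreducible_lt_one hϖ)

theorem eq_zero_of_forall_norm_le_pow {ϖ : 𝒪[F]} (hϖ : Irreducible ϖ) {a : F}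
    (h : ∀ n : ℕ, ‖a‖ ≤ ‖(ϖ : F)‖ ^ n) : a = 0 :=
  norm_le_zero_iff.1 (ge_of_tendsto' (tendsto_norm_irreducible_pow hϖ) h)

variable [IsDiscreteValuationRing 𝒪[F]]

theorem exists_norm_eq_pow {ϖ : 𝒪[F]} (hϖ : Irreducible ϖ) {a : F} (ha : a ≠ 0) (ha1 : ‖a‖ ≤ 1) :
    ∃ n : ℕ, ‖a‖ = ‖(ϖ : F)‖ ^ n := by
  obtain ⟨n, u, hu⟩ := IsDiscreteValuationRing.associated_pow_irreducible
    (x := (⟨a, ha1⟩ : 𝒪[F])) (fun h => ha (congrArg Subtype.val h)) hϖ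
  have hau : a * (u : 𝒪[F]) = (ϖ : F) ^ n := congrArg Subtype.val hu
  exact ⟨n, by rw [← norm_pow, ← hau, norm_mul, norm_unit_integer, mul_one]⟩

theorem norm_le_norm_irreducible {ϖ : 𝒪[F]} (hϖ : Irreducible ϖ) {a : F} (ha : ‖a‖ < 1) :
    ‖a‖ ≤ ‖(ϖ : F)‖ := by
  rcases eq_or_ne a 0 with rfl | ha0
  · rw [norm_zero]; exact norm_nonneg _
  obtain ⟨n, hn⟩ := exists_norm_eq_pow hϖ ha0 ha.le
  have hn0 : n ≠ 0 := fun h => ha.ne (by rw [hn, h, pow_zero])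
  rw [hn]
  exact pow_le_of_le_one (norm_nonneg _) (norm_irreducible_lt_one hϖ).le hn0

theorem exists_norm_eq_zpow {ϖ : 𝒪[F]} (hϖ : Irreducible ϖ) {a : F} (ha : a ≠ 0) :
    ∃ n : ℤ, ‖a‖ = ‖(ϖ : F)‖ ^ n := by
  rcases le_total ‖a‖ 1 with h | h
  · obtain ⟨n, hn⟩ := exists_norm_eq_pow hϖ ha h
    exact ⟨n, by rw [hn, zpow_natCast]⟩
  · obtain ⟨n, hn⟩ := exists_norm_eq_pow hϖ (inv_ne_zero ha)
      (by rw [norm_inv]; exact inv_le_one_of_one_le₀ h)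
    exact ⟨-n, by rw [zpow_neg, zpow_natCast, ← hn, norm_inv, inv_inv]⟩

theorem finite_norm_mem_Icc {ρ : ℝ} (hρ : 0 < ρ) (C : ℝ) :
    (Set.range (norm : F → ℝ) ∩ Set.Icc ρ C).Finite := by
  obtain ⟨ϖ, hϖ⟩ := IsDiscreteValuationRing.exists_irreducible 𝒪[F]
  have h0 := norm_irreducible_pos hϖ
  have h1 := norm_irreducible_lt_one hϖ
  obtain ⟨N, hN⟩ := exists_pow_lt_of_lt_one hρ h1
  obtain ⟨M, hM⟩ := pow_unbounded_of_one_lt C (one_lt_inv_iff₀.2 ⟨h0, h1⟩)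
  refine ((Set.finite_Icc (-(M : ℤ)) N).image fun n => ‖(ϖ : F)‖ ^ n).subset ?_
  rintro _ ⟨⟨a, rfl⟩, hρa, haC⟩
  obtain ⟨n, hn⟩ := exists_norm_eq_zpow hϖ (norm_pos_iff.1 (hρ.trans_le hρa))
  refine ⟨n, ⟨?_, ?_⟩, hn.symm⟩
  · rw [inv_pow, ← zpow_natCast, ← zpow_neg] at hM
    exact ((zpow_lt_zpow_iff_right_of_lt_one₀ h0 h1).1 (hn ▸ haC.trans_lt hM)).le
  · rw [← zpow_natCast] at hN
    exact ((zpow_lt_zpow_iff_right_of_lt_one₀ h0 h1).1 (hn ▸ hN.trans_le hρa)).le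

end DiscreteNorm

theorem one_lt_prime_cast (p : ℕ) [hp : Fact p.Prime] : (1 : ℝ) < p := by
  exact_mod_cast hp.out.one_lt

theorem prime_cast_pos (p : ℕ) [Fact p.Prime] : (0 : ℝ) < p := one_pos.trans (one_lt_prime_cast p)

theorem prime_rpow_pos (p : ℕ) [Fact p.Prime] (a : ℝ) : 0 < (p : ℝ) ^ a :=
  Real.rpow_pos_of_pos (prime_cast_pos p) a

theorem tendsto_const_mul_prime_rpow_neg (p : ℕ) [Fact p.Prime] {b : ℝ} (hb : 0 < b) (C : ℝ) :
    Tendsto (fun t : ℝ => C * (p : ℝ) ^ (-(b * t))) atTop (𝓝 0) := by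
  rw [← mul_zero C]
  exact ((tendsto_rpow_atBot_of_base_gt_one _ (one_lt_prime_cast p)).comp
    (tendsto_neg_atTop_atBot.comp (tendsto_id.const_mul_atTop hb))).const_mul C

namespace OmegaImmAn

variable {p : ℕ} [Fact p.Prime] {F : Type*} [NormedField F] [IsUltrametricDist F]
  [CompleteSpace F]

section Coefficients

variable {x y : OmegaImmAn p F}

theorem ext (h : ∀ i, x.coeff i = y.coeff i) : x = y := Subtype.ext (funext h)

theorem exists_coeff_ne_zero (hx : x ≠ 0) : ∃ i, x.coeff i ≠ 0 := by
  by_contra! h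
  exact hx (ext h)

theorem coeff_of_neg (x : OmegaImmAn p F) {i : ℚ} (hi : i < 0) : x.coeff i = 0 := x.2.1 i hi

theorem coeff_zero (i : ℚ) : (0 : OmegaImmAn p F).coeff i = 0 := rfl

theorem coeff_one : (1 : OmegaImmAn p F).coeff = mono 0 1 := rfl

theorem coeff_one_zero : (1 : OmegaImmAn p F).coeff 0 = 1 := by simp [coeff_one, mono]

theorem coeff_tPow (j : ℚ≥0) : (tPow p F j).coeff = mono j 1 := rfl

theorem coeff_add (x y : OmegaImmAn p F) (i : ℚ) : (x + y).coeff i = x.coeff i + y.coeff i := rfl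

theorem coeff_neg (x : OmegaImmAn p F) (i : ℚ) : (-x).coeff i = -x.coeff i := rfl

theorem coeff_sub (x y : OmegaImmAn p F) (i : ℚ) : (x - y).coeff i = x.coeff i - y.coeff i := by
  rw [sub_eq_add_neg, coeff_add, coeff_neg, sub_eq_add_neg]

theorem coeff_mul (x y : OmegaImmAn p F) (n : ℚ) :
    (x * y).coeff n = ∑' i, x.coeff i * y.coeff (n - i) := rfl

theorem summable_coeff_mul (x y : OmegaImmAn p F) (n : ℚ) :
    Summable fun i => x.coeff i * y.coeff (n - i) := by
  refine (summable_conv (wo_trunc n x.2.2.1) (bdd_trunc n x.2.2.2) (wo_trunc n y.2.2.1)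
    (bdd_trunc n y.2.2.2) n).congr fun i => ?_
  change trunc n x.coeff i * trunc n y.coeff (n - i) = _
  by_cases hi : i < 0
  · simp [trunc, coeff_of_neg _ hi]
  by_cases hni : n - i < 0
  · simp [trunc, coeff_of_neg _ hni]
  simp [trunc, show i ≤ n by linarith, show n - i ≤ n by linarith]

/-- The constant series `a`. -/
def const (a : F) : OmegaImmAn p F := ⟨mono 0 a, mono_mem le_rfl a⟩

theorem coeff_const_mul (a : F) (x : OmegaImmAn p F) (i : ℚ) :
    (const a * x).coeff i = a * x.coeff i := by
  change ∑' k, mono 0 a k * x.coeff (i - k) = _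
  rw [tsum_eq_single 0 fun k hk => by simp [mono, hk]]
  simp [mono]

end Coefficients

section Weights

/-- The weighted absolute value `|x_i| p^{-ri}`, whose supremum over `i` is `w_r(x)`. -/
noncomputable def weight (r : ℝ) (x : OmegaImmAn p F) (i : ℚ) : ℝ :=
  ‖x.coeff i‖ * (p : ℝ) ^ (-(r * i))

variable {r r' C : ℝ} {x y : OmegaImmAn p F} {i n : ℚ}

theorem weight_nonneg (r : ℝ) (x : OmegaImmAn p F) (i : ℚ) : 0 ≤ weight r x i :=
  mul_nonneg (norm_nonneg _) (prime_rpow_pos p _).le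

theorem weight_pos : 0 < weight r x i ↔ x.coeff i ≠ 0 := by
  rw [weight, mul_pos_iff_of_pos_right (prime_rpow_pos p _), norm_pos_iff]

theorem weight_of_coeff_eq_zero (h : x.coeff i = 0) : weight r x i = 0 := by simp [weight, h]

theorem weight_zero_index (r : ℝ) (x : OmegaImmAn p F) : weight r x 0 = ‖x.coeff 0‖ := by
  simp [weight]

theorem norm_coeff_eq (r : ℝ) (x : OmegaImmAn p F) (i : ℚ) :
    ‖x.coeff i‖ = weight r x i * (p : ℝ) ^ (r * i) := by
  rw [weight, mul_assoc, ← Real.rpow_add (prime_cast_pos p), neg_add_cancel, Real.rpow_zero,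
    mul_one]

theorem weight_le_iff : weight r x i ≤ C ↔ ‖x.coeff i‖ ≤ C * (p : ℝ) ^ (r * i) := by
  rw [norm_coeff_eq r, mul_le_mul_iff_left₀ (prime_rpow_pos p _)]

theorem weight_eq_weight_mul (r r' : ℝ) (x : OmegaImmAn p F) (i : ℚ) :
    weight r' x i = weight r x i * (p : ℝ) ^ ((r - r') * i) := by
  rw [weight, weight, mul_assoc, ← Real.rpow_add (prime_cast_pos p)]
  congr 2; ring

theorem weight_antitone (h : r ≤ r') (x : OmegaImmAn p F) (i : ℚ) :
    weight r' x i ≤ weight r x i := by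
  rcases lt_or_ge i 0 with hi | hi
  · simp [weight_of_coeff_eq_zero (coeff_of_neg x hi)]
  · have hi' : (0 : ℝ) ≤ i := by exact_mod_cast hi
    rw [weight_eq_weight_mul r]
    exact mul_le_of_le_one_right (weight_nonneg _ _ _) (Real.rpow_le_one_of_one_le_of_nonpos
      (one_lt_prime_cast p).le (mul_nonpos_of_nonpos_of_nonneg (by linarith) hi'))

theorem weight_add_le_max (r : ℝ) (x y : OmegaImmAn p F) (i : ℚ) :
    weight r (x + y) i ≤ max (weight r x i) (weight r y i) := by
  rw [weight, weight, weight, ← max_mul_of_nonneg _ _ (prime_rpow_pos p _).le]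
  exact mul_le_mul_of_nonneg_right (IsUltrametricDist.norm_add_le_max _ _) (prime_rpow_pos p _).le

theorem weight_neg (r : ℝ) (x : OmegaImmAn p F) (i : ℚ) : weight r (-x) i = weight r x i := by
  rw [weight, coeff_neg, norm_neg, weight]

theorem weight_mul_weight_sub (r : ℝ) (x y : OmegaImmAn p F) (i n : ℚ) :
    weight r x i * weight r y (n - i) =
      ‖x.coeff i * y.coeff (n - i)‖ * (p : ℝ) ^ (-(r * n)) := by
  have h : (p : ℝ) ^ (-(r * n)) = (p : ℝ) ^ (-(r * i)) * (p : ℝ) ^ (-(r * (n - i : ℚ))) := by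
    rw [← Real.rpow_add (prime_cast_pos p)]
    congr 1; push_cast; ring
  rw [weight, weight, h, norm_mul]; ring

theorem weight_mul_le (h : ∀ i, weight r x i * weight r y (n - i) ≤ C) :
    weight r (x * y) n ≤ C := by
  rw [weight, ← le_div_iff₀ (prime_rpow_pos p _), coeff_mul]
  refine IsUltrametricDist.norm_tsum_le_of_forall_le fun i => ?_
  rw [le_div_iff₀ (prime_rpow_pos p _), ← weight_mul_weight_sub]
  exact h i

theorem weight_mul_eq_of_lt {i₀ : ℚ}
    (h : ∀ i, i ≠ i₀ → weight r x i * weight r y (n - i) ≤ C)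
    (hC : C < weight r x i₀ * weight r y (n - i₀)) :
    weight r (x * y) n = weight r x i₀ * weight r y (n - i₀) := by
  have hpos := prime_rpow_pos p (-(r * n))
  have hC0 : 0 ≤ C := (mul_nonneg (weight_nonneg _ _ _) (weight_nonneg _ _ _)).trans
    (h (i₀ + 1) (by simp))
  have hrest : ‖(x * y).coeff n - x.coeff i₀ * y.coeff (n - i₀)‖ ≤ C / (p : ℝ) ^ (-(r * n)) := by
    rw [coeff_mul, (summable_coeff_mul x y n).tsum_eq_add_tsum_ite i₀, add_sub_cancel_left]
    refine IsUltrametricDist.norm_tsum_le_of_forall_le_of_nonneg (by positivity) fun i => ?_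
    split_ifs with hi
    · simpa using div_nonneg hC0 hpos.le
    · rw [le_div_iff₀ hpos, ← weight_mul_weight_sub]
      exact h i hi
  have hlt : ‖(x * y).coeff n - x.coeff i₀ * y.coeff (n - i₀)‖ <
      ‖x.coeff i₀ * y.coeff (n - i₀)‖ :=
    hrest.trans_lt (by rwa [div_lt_iff₀ hpos, ← weight_mul_weight_sub])
  have heq := IsUltrametricDist.norm_add_eq_max_of_norm_ne_norm hlt.ne
  rw [sub_add_cancel, max_eq_right hlt.le] at heq
  rw [weight, heq, weight_mul_weight_sub]

theorem bddAbove_weight (hr : 0 < r) (x : OmegaImmAn p F) : BddAbove (Set.range (weight r x)) := by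
  obtain ⟨C, hC⟩ := x.2.2.2 r hr
  exact ⟨C, Set.forall_mem_range.2 fun i => weight_le_iff.2 (hC i)⟩

theorem weight_le_w (hr : 0 < r) (x : OmegaImmAn p F) (i : ℚ) : weight r x i ≤ w r x :=
  le_ciSup (bddAbove_weight hr x) i

theorem w_le (h : ∀ i, weight r x i ≤ C) : w r x ≤ C := ciSup_le h

theorem w_nonneg (r : ℝ) (x : OmegaImmAn p F) : 0 ≤ w r x :=
  Real.iSup_nonneg fun i => weight_nonneg r x i

theorem w_pos (hr : 0 < r) (hx : x ≠ 0) : 0 < w r x := by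
  obtain ⟨i, hi⟩ := exists_coeff_ne_zero hx
  exact (weight_pos.2 hi).trans_le (weight_le_w hr x i)

theorem w_zero (r : ℝ) : w r (0 : OmegaImmAn p F) = 0 :=
  (w_le fun i => (weight_of_coeff_eq_zero (coeff_zero i)).le).antisymm (w_nonneg _ _)

theorem w_neg (r : ℝ) (x : OmegaImmAn p F) : w r (-x) = w r x :=
  congrArg iSup (funext (weight_neg r x))

theorem w_add_le_max (hr : 0 < r) (x y : OmegaImmAn p F) : w r (x + y) ≤ max (w r x) (w r y) :=
  w_le fun i => (weight_add_le_max r x y i).trans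
    (max_le_max (weight_le_w hr x i) (weight_le_w hr y i))

end Weights

end OmegaImmAn

/-! ### Dominant indices -/

namespace OmegaImmAn

variable {p : ℕ} [Fact p.Prime] {F : Type*} [NormedField F] [IsUltrametricDist F]
  [CompleteSpace F]

section Dominance

/-- `a` is the largest index at which the supremum defining `w_r(x)` is attained. -/
structure IsTopIndex (r : ℝ) (x : OmegaImmAn p F) (a : ℚ) : Prop where
  weight_eq : weight r x a = w r x
  weight_lt : ∀ k, a < k → weight r x k < w r x

/-- `d` is the only index at which the supremum defining `w_r(x)` is attained; the Newton polygon of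
`x` then has a vertex at `d` whose supporting line has slope `-r`. -/
structure IsDominant (r : ℝ) (x : OmegaImmAn p F) (d : ℚ) : Prop where
  weight_eq : weight r x d = w r x
  weight_lt : ∀ k, k ≠ d → weight r x k < w r x

variable {r : ℝ} {x y : OmegaImmAn p F} {a b d : ℚ}

theorem IsDominant.isTopIndex (h : IsDominant r x d) : IsTopIndex r x d :=
  ⟨h.weight_eq, fun k hk => h.weight_lt k hk.ne'⟩

theorem IsTopIndex.w_pos (h : IsTopIndex r x a) : 0 < w r x :=
  (weight_nonneg r x _).trans_lt (h.weight_lt (a + 1) (by simp))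

theorem IsTopIndex.ne_zero (h : IsTopIndex r x a) : x ≠ 0 := by
  rintro rfl
  exact h.w_pos.ne' (w_zero r)

theorem IsTopIndex.coeff_ne_zero (h : IsTopIndex r x a) : x.coeff a ≠ 0 :=
  weight_pos.1 (h.weight_eq ▸ h.w_pos)

theorem IsTopIndex.nonneg (h : IsTopIndex r x a) : 0 ≤ a :=
  not_lt.1 fun ha => h.coeff_ne_zero (coeff_of_neg x ha)

theorem IsTopIndex.unique (ha : IsTopIndex r x a) (hb : IsTopIndex r x b) : a = b := by
  rcases lt_trichotomy a b with h | h | h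
  · exact absurd hb.weight_eq (ha.weight_lt b h).ne
  · exact h
  · exact absurd ha.weight_eq (hb.weight_lt a h).ne

theorem IsTopIndex.isDominant_zero (h : IsTopIndex r x 0) : IsDominant r x 0 := by
  refine ⟨h.weight_eq, fun k hk => ?_⟩
  rcases lt_or_gt_of_ne hk with hk | hk
  · rw [weight_of_coeff_eq_zero (coeff_of_neg x hk)]
    exact h.w_pos
  · exact h.weight_lt k hk

theorem IsDominant.of_weight_lt (h : ∀ k, k ≠ d → weight r x k < weight r x d) :
    IsDominant r x d := by
  have hle : ∀ k, weight r x k ≤ weight r x d := fun k => by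
    rcases eq_or_ne k d with rfl | hk
    · exact le_rfl
    · exact (h k hk).le
  have hw : weight r x d = w r x :=
    (le_ciSup (f := weight r x) ⟨_, Set.forall_mem_range.2 hle⟩ d).antisymm (w_le hle)
  exact ⟨hw, hw ▸ h⟩

theorem isDominant_one (r : ℝ) : IsDominant r (1 : OmegaImmAn p F) 0 :=
  .of_weight_lt fun k hk => by simp [weight, coeff_one, mono, hk]

theorem exists_min_index_of_norm_coeff {T : Set ℚ} {v : ℝ} (hv : 0 < v) (x : OmegaImmAn p F)
    (h : ∃ k ∈ T, ‖x.coeff k‖ = v) :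
    ∃ m ∈ T, ‖x.coeff m‖ = v ∧ ∀ k ∈ T, ‖x.coeff k‖ = v → m ≤ k := by
  have hwf : {k | k ∈ T ∧ ‖x.coeff k‖ = v}.IsWF :=
    (x.2.2.1 _ (half_pos hv)).mono
      fun k hk => show v / 2 < ‖x.coeff k‖ by rw [hk.2]; exact half_lt_self hv
  exact ⟨hwf.min h, (hwf.min_mem h).1, (hwf.min_mem h).2, fun k hkT hk => hwf.min_le h ⟨hkT, hk⟩⟩

theorem weight_mul_le_w_mul_w (hr : 0 < r) (x y : OmegaImmAn p F) (n : ℚ) :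
    weight r (x * y) n ≤ w r x * w r y :=
  weight_mul_le fun i => mul_le_mul (weight_le_w hr x i) (weight_le_w hr y _)
    (weight_nonneg _ _ _) (w_nonneg _ _)

variable [IsDiscreteValuationRing 𝒪[F]]

theorem finite_norm_coeff_of_le_weight (hr : 0 < r) {ρ : ℝ} (hρ : 0 < ρ) (x : OmegaImmAn p F) :
    ((fun i => ‖x.coeff i‖) '' {i | ρ ≤ weight r x i}).Finite := by
  set C := w (r / 2) x
  refine (finite_norm_mem_Icc (F := F) hρ (C * (C / ρ))).subset ?_
  rintro _ ⟨i, hi : ρ ≤ weight r x i, rfl⟩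
  refine ⟨⟨_, rfl⟩, ?_, ?_⟩
  · calc ρ ≤ weight r x i := hi
      _ ≤ weight 0 x i := weight_antitone hr.le x i
      _ = ‖x.coeff i‖ := by simp [weight]
  · have hC : ∀ k, weight (r / 2) x k ≤ C := weight_le_w (half_pos hr) x
    have hpow : (p : ℝ) ^ (r / 2 * i) ≤ C / ρ := by
      have hpos := prime_rpow_pos p (r / 2 * i)
      rw [le_div_iff₀ hρ, mul_comm]
      calc ρ * (p : ℝ) ^ (r / 2 * i) ≤ weight r x i * (p : ℝ) ^ ((r - r / 2) * i) := by
            rw [sub_half]; gcongr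
        _ = weight (r / 2) x i := (weight_eq_weight_mul r (r / 2) x i).symm
        _ ≤ C := hC i
    change ‖x.coeff i‖ ≤ _
    rw [norm_coeff_eq (r / 2)]
    exact mul_le_mul (hC i) hpow (prime_rpow_pos p _).le (w_nonneg _ _)

theorem exists_isMaxOn_weight (hr : 0 < r) (x : OmegaImmAn p F) {T : Set ℚ} (hT : T.Nonempty) :
    ∃ a ∈ T, IsMaxOn (weight r x) T a := by
  by_cases hzero : ∀ k ∈ T, weight r x k = 0
  · obtain ⟨a, ha⟩ := hT
    exact ⟨a, ha, fun k hk => by simp [hzero k hk, hzero a ha]⟩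
  obtain ⟨k₀, hk₀T, hk₀⟩ : ∃ k ∈ T, weight r x k ≠ 0 := by push Not at hzero; exact hzero
  have hρ : 0 < weight r x k₀ := (weight_nonneg r x k₀).lt_of_ne' hk₀
  set S := {k ∈ T | weight r x k₀ ≤ weight r x k}
  have hmin : ∀ v ∈ (fun i => ‖x.coeff i‖) '' S,
      ∃ m ∈ S, ‖x.coeff m‖ = v ∧ ∀ k ∈ S, ‖x.coeff k‖ = v → m ≤ k := by
    rintro _ ⟨k, hk, rfl⟩
    exact exists_min_index_of_norm_coeff
      (norm_pos_iff.2 (weight_pos.1 (hρ.trans_le hk.2))) x ⟨k, hk, rfl⟩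
  choose! m hmS hmv hmle using hmin
  obtain ⟨v, hv, hmax⟩ := Set.exists_max_image _ (fun v => weight r x (m v))
    ((finite_norm_coeff_of_le_weight hr hρ x).subset (Set.image_mono fun k (hk : k ∈ S) => hk.2))
    (Set.Nonempty.image _ ⟨k₀, hk₀T, le_rfl⟩)
  refine ⟨m v, (hmS v hv).1, fun k hk => ?_⟩
  by_cases hkS : weight r x k₀ ≤ weight r x k
  · -- among the indices with a given absolute value, the smallest one has the largest weight
    have hkV : ‖x.coeff k‖ ∈ (fun i => ‖x.coeff i‖) '' S := ⟨k, ⟨hk, hkS⟩, rfl⟩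
    have hle : ((m ‖x.coeff k‖ : ℚ) : ℝ) ≤ k := by exact_mod_cast hmle _ hkV k ⟨hk, hkS⟩ rfl
    refine le_trans ?_ (hmax _ hkV)
    have := (one_lt_prime_cast p).le
    rw [weight, weight, hmv _ hkV]
    gcongr
  · exact (not_le.1 hkS).le.trans (hmS v hv).2

theorem exists_weight_le_mul (hr : 0 < r) (x : OmegaImmAn p F) {T : Set ℚ} {C : ℝ} (hC : 0 < C)
    (hT : ∀ k ∈ T, weight r x k < C) :
    ∃ l, 0 ≤ l ∧ l < 1 ∧ ∀ k ∈ T, weight r x k ≤ l * C := by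
  rcases T.eq_empty_or_nonempty with rfl | hne
  · exact ⟨0, le_rfl, one_pos, by simp⟩
  obtain ⟨a, ha, hmax⟩ := exists_isMaxOn_weight hr x hne
  refine ⟨weight r x a / C, div_nonneg (weight_nonneg _ _ _) hC.le, (div_lt_one hC).2 (hT a ha),
    fun k hk => ?_⟩
  rw [div_mul_cancel₀ _ hC.ne']
  exact hmax hk

theorem exists_isTopIndex (hr : 0 < r) (hx : x ≠ 0) : ∃ a, IsTopIndex r x a := by
  obtain ⟨a, -, ha⟩ := exists_isMaxOn_weight hr x Set.univ_nonempty
  have hwa : weight r x a = w r x :=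
    (weight_le_w hr x a).antisymm (w_le fun k => ha (Set.mem_univ k))
  obtain ⟨_, ⟨b, hb, rfl⟩, hmax⟩ := Set.exists_max_image _ id
    (finite_norm_coeff_of_le_weight hr (w_pos hr hx) x) ⟨_, a, hwa.ge, rfl⟩
  have hwb : weight r x b = w r x := (weight_le_w hr x b).antisymm hb
  refine ⟨b, hwb, fun k hbk => (weight_le_w hr x k).lt_of_ne fun hk => ?_⟩
  -- of two indices with the same weight, the larger one has the larger coefficient
  have hle : ‖x.coeff k‖ ≤ ‖x.coeff b‖ := hmax _ ⟨k, hk.ge, rfl⟩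
  rw [norm_coeff_eq r, norm_coeff_eq r x b, hk, hwb, mul_le_mul_iff_right₀ (w_pos hr hx),
    Real.rpow_le_rpow_left_iff (one_lt_prime_cast p), mul_le_mul_iff_right₀ hr] at hle
  exact hbk.not_ge (by exact_mod_cast hle)

theorem IsTopIndex.weight_mul_weight_le (hr : 0 < r) (ha : IsTopIndex r x a)
    (hb : IsTopIndex r y b) :
    ∃ c < w r x * w r y, ∀ i j, a < i ∨ b < j → weight r x i * weight r y j ≤ c := by
  have hX := ha.w_pos
  have hY := hb.w_pos
  obtain ⟨l, -, hl1, hl⟩ := exists_weight_le_mul hr x (T := Set.Ioi a) hX ha.weight_lt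
  obtain ⟨m, -, hm1, hm⟩ := exists_weight_le_mul hr y (T := Set.Ioi b) hY hb.weight_lt
  refine ⟨max (l * w r x * w r y) (w r x * (m * w r y)), max_lt ?_ ?_, ?_⟩
  · exact mul_lt_mul_of_pos_right (mul_lt_of_lt_one_left hX hl1) hY
  · exact mul_lt_mul_of_pos_left (mul_lt_of_lt_one_left hY hm1) hX
  · rintro i j (h | h)
    · exact le_max_of_le_left (mul_le_mul (hl i h) (weight_le_w hr y j) (weight_nonneg _ _ _)
        ((weight_nonneg _ _ _).trans (hl i h)))
    · exact le_max_of_le_right (mul_le_mul (weight_le_w hr x i) (hm j h) (weight_nonneg _ _ _)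
        hX.le)

theorem IsTopIndex.weight_mul (hr : 0 < r) (ha : IsTopIndex r x a) (hb : IsTopIndex r y b) :
    weight r (x * y) (a + b) = w r x * w r y := by
  obtain ⟨c, hc, h⟩ := ha.weight_mul_weight_le hr hb
  rw [weight_mul_eq_of_lt (i₀ := a) (C := c), add_sub_cancel_left, ha.weight_eq, hb.weight_eq]
  · intro i hi
    rcases lt_or_gt_of_ne hi with hi | hi
    · exact h _ _ (Or.inr (by linarith))
    · exact h _ _ (Or.inl hi)
  · rwa [add_sub_cancel_left, ha.weight_eq, hb.weight_eq]

theorem w_mul (hr : 0 < r) (x y : OmegaImmAn p F) : w r (x * y) = w r x * w r y := by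
  rcases eq_or_ne x 0 with rfl | hx
  · rw [zero_mul, w_zero, zero_mul]
  rcases eq_or_ne y 0 with rfl | hy
  · rw [mul_zero, w_zero, mul_zero]
  obtain ⟨a, ha⟩ := exists_isTopIndex hr hx
  obtain ⟨b, hb⟩ := exists_isTopIndex hr hy
  exact (w_le (weight_mul_le_w_mul_w hr x y)).antisymm
    (ha.weight_mul hr hb ▸ weight_le_w hr (x * y) _)

theorem IsTopIndex.mul (hr : 0 < r) (ha : IsTopIndex r x a) (hb : IsTopIndex r y b) :
    IsTopIndex r (x * y) (a + b) := by
  refine ⟨by rw [ha.weight_mul hr hb, w_mul hr], fun k hk => ?_⟩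
  obtain ⟨c, hc, h⟩ := ha.weight_mul_weight_le hr hb
  rw [w_mul hr]
  refine (weight_mul_le fun i => h i (k - i) ?_).trans_lt hc
  by_contra! hi
  linarith [hi.1, hi.2]

instance : IsDomain (OmegaImmAn p F) := by
  have : Nontrivial (OmegaImmAn p F) := ⟨1, 0, (isDominant_one 1).isTopIndex.ne_zero⟩
  have : NoZeroDivisors (OmegaImmAn p F) := ⟨fun {x y} hxy => by
    have h := w_mul one_pos x y
    rw [hxy, w_zero, zero_eq_mul] at h
    exact h.imp (fun hx => not_not.1 fun h0 => (w_pos one_pos h0).ne' hx)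
      (fun hy => not_not.1 fun h0 => (w_pos one_pos h0).ne' hy)⟩
  exact NoZeroDivisors.to_isDomain _

theorem w_pow (hr : 0 < r) (x : OmegaImmAn p F) (n : ℕ) : w r (x ^ n) = w r x ^ n := by
  induction n with
  | zero => rw [pow_zero, pow_zero, ← (isDominant_one r).weight_eq, weight_zero_index,
      coeff_one_zero, norm_one]
  | succ n ih => rw [pow_succ, w_mul hr, ih, pow_succ]

theorem isDominant_zero_mul_iff (hr : 0 < r) :
    IsDominant r (x * y) 0 ↔ IsDominant r x 0 ∧ IsDominant r y 0 := by
  constructor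
  · intro h
    obtain ⟨a, ha⟩ := exists_isTopIndex hr (left_ne_zero_of_mul h.isTopIndex.ne_zero)
    obtain ⟨b, hb⟩ := exists_isTopIndex hr (right_ne_zero_of_mul h.isTopIndex.ne_zero)
    have hab : a + b = 0 := (ha.mul hr hb).unique h.isTopIndex
    obtain rfl : a = 0 := by linarith [ha.nonneg, hb.nonneg]
    obtain rfl : b = 0 := by linarith
    exact ⟨ha.isDominant_zero, hb.isDominant_zero⟩
  · rintro ⟨hx, hy⟩
    have htop : IsTopIndex r (x * y) 0 := by simpa using hx.isTopIndex.mul hr hy.isTopIndex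
    exact htop.isDominant_zero

theorem isDominant_zero_of_isUnit (hr : 0 < r) (hx : IsUnit x) : IsDominant r x 0 := by
  obtain ⟨y, hy⟩ := hx.exists_right_inv
  exact ((isDominant_zero_mul_iff hr).1 (hy ▸ isDominant_one r)).1

theorem isDominant_zero_prod (hr : 0 < r) {ι : Type*} (s : Finset ι) (y : ι → OmegaImmAn p F)
    (h : ∀ i ∈ s, IsDominant r (y i) 0) : IsDominant r (∏ i ∈ s, y i) 0 :=
  Finset.prod_induction y (IsDominant r · 0)
    (fun _ _ ha hb => (isDominant_zero_mul_iff hr).2 ⟨ha, hb⟩) (isDominant_one r) h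

theorem IsDominant.exists_gap (hr : 0 < r) (h : IsDominant r x d) :
    ∃ l, 0 ≤ l ∧ l < 1 ∧ ∀ k, k ≠ d → weight r x k ≤ l * w r x :=
  exists_weight_le_mul hr x (T := {k | k ≠ d}) h.isTopIndex.w_pos h.weight_lt

end Dominance

end OmegaImmAn

/-! ### Slopes of the Newton polygon -/

namespace OmegaImmAn

variable {p : ℕ} [Fact p.Prime] {F : Type*} [NormedField F] [IsUltrametricDist F]
  [CompleteSpace F]

section Slopes

variable {r s : ℝ} {x : OmegaImmAn p F} {i j d : ℚ}

theorem weight_le_weight_mul_rpow (r r' : ℝ) (x : OmegaImmAn p F) {K : ℝ} (hi : i ≤ K) :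
    weight r' x i ≤ weight r x i * (p : ℝ) ^ (|r - r'| * K) := by
  rcases lt_or_ge i 0 with hi0 | hi0
  · simp [weight_of_coeff_eq_zero (coeff_of_neg x hi0)]
  have hi0' : (0 : ℝ) ≤ i := by exact_mod_cast hi0
  rw [weight_eq_weight_mul r]
  refine mul_le_mul_of_nonneg_left (Real.rpow_le_rpow_of_exponent_le (one_lt_prime_cast p).le ?_)
    (weight_nonneg _ _ _)
  exact mul_le_mul (le_abs_self _) hi hi0' (abs_nonneg _)

theorem exists_forall_weight_lt (hr : 0 < r) {ε : ℝ} (hε : 0 < ε) (x : OmegaImmAn p F) :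
    ∃ K : ℝ, ∀ i : ℚ, K ≤ i → ∀ r', r ≤ r' → weight r' x i < ε := by
  obtain ⟨K, hK⟩ := eventually_atTop.1 ((tendsto_const_mul_prime_rpow_neg p (half_pos hr)
    (w (r / 2) x)).eventually (gt_mem_nhds hε))
  refine ⟨K, fun i hi r' hr' => ?_⟩
  calc weight r' x i ≤ weight r x i := weight_antitone hr' x i
    _ = weight (r / 2) x i * (p : ℝ) ^ (-(r / 2 * i)) := by
        rw [weight_eq_weight_mul (r / 2)]; congr 2; ring
    _ ≤ w (r / 2) x * (p : ℝ) ^ (-(r / 2 * i)) :=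
        mul_le_mul_of_nonneg_right (weight_le_w (half_pos hr) x i) (prime_rpow_pos p _).le
    _ < ε := hK i hi

theorem exists_pos_forall_le_index (h0 : x.coeff 0 ≠ 0) :
    ∃ m : ℚ, 0 < m ∧ ∀ k, 0 < k → ‖x.coeff 0‖ ≤ ‖x.coeff k‖ → m ≤ k := by
  have hn : 0 < ‖x.coeff 0‖ := norm_pos_iff.2 h0
  have hwf : {k | 0 < k ∧ ‖x.coeff 0‖ ≤ ‖x.coeff k‖}.IsWF :=
    (x.2.2.1 _ (half_pos hn)).mono fun k hk => (half_lt_self hn).trans_le hk.2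
  by_cases hne : {k | 0 < k ∧ ‖x.coeff 0‖ ≤ ‖x.coeff k‖}.Nonempty
  · exact ⟨hwf.min hne, (hwf.min_mem hne).1, fun k hk hxk => hwf.min_le hne ⟨hk, hxk⟩⟩
  · exact ⟨1, one_pos, fun k hk hxk => absurd ⟨k, hk, hxk⟩ hne⟩

theorem eventually_isDominant_zero (h0 : x.coeff 0 ≠ 0) : ∀ᶠ r in atTop, IsDominant r x 0 := by
  obtain ⟨m, hm, hmk⟩ := exists_pos_forall_le_index h0
  have hm' : (0 : ℝ) < m := by exact_mod_cast hm
  have hlim := (tendsto_const_mul_prime_rpow_neg p hm' (w 1 x * (p : ℝ) ^ (m : ℝ))).eventually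
    (gt_mem_nhds (norm_pos_iff.2 h0))
  filter_upwards [hlim, eventually_ge_atTop 1] with r hr hr1
  refine .of_weight_lt fun k hk => ?_
  rw [weight_zero_index]
  rcases lt_or_gt_of_ne hk with hk | hk
  · rwa [weight_of_coeff_eq_zero (coeff_of_neg x hk), norm_pos_iff]
  rcases lt_or_ge ‖x.coeff k‖ ‖x.coeff 0‖ with hlt | hge
  · calc weight r x k ≤ weight 0 x k := weight_antitone (by linarith) x k
      _ = ‖x.coeff k‖ := by simp [weight]
      _ < ‖x.coeff 0‖ := hlt
  · have hmk' : (m : ℝ) ≤ k := by exact_mod_cast hmk k hk hge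
    calc weight r x k = weight 1 x k * (p : ℝ) ^ ((1 - r) * k) := weight_eq_weight_mul _ _ _ _
      _ ≤ w 1 x * (p : ℝ) ^ ((1 - r) * m) := mul_le_mul (weight_le_w one_pos x k)
          (Real.rpow_le_rpow_of_exponent_le (one_lt_prime_cast p).le
            (mul_le_mul_of_nonpos_left hmk' (by linarith))) (prime_rpow_pos p _).le (w_nonneg _ _)
      _ = w 1 x * (p : ℝ) ^ (m : ℝ) * (p : ℝ) ^ (-(m * r)) := by
          rw [mul_assoc, ← Real.rpow_add (prime_cast_pos p)]; congr 2; ring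
      _ < ‖x.coeff 0‖ := hr

theorem vp_add_eq_neg_logb_weight (hi : x.coeff i ≠ 0) :
    vp p (x.coeff i) + s * i = -Real.logb p (weight s x i) := by
  rw [vp, weight, Real.logb_mul (norm_ne_zero_iff.2 hi) (prime_rpow_pos p _).ne',
    Real.logb_rpow (prime_cast_pos p) (one_lt_prime_cast p).ne']
  ring

theorem vp_add_le_vp_add_iff (hi : x.coeff i ≠ 0) (hj : x.coeff j ≠ 0) :
    vp p (x.coeff i) + s * i ≤ vp p (x.coeff j) + s * j ↔ weight s x j ≤ weight s x i := by
  rw [vp_add_eq_neg_logb_weight hi, vp_add_eq_neg_logb_weight hj, neg_le_neg_iff,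
    Real.logb_le_logb (one_lt_prime_cast p) (weight_pos.2 hj) (weight_pos.2 hi)]

theorem mem_newtonHull (hi : x.coeff i ≠ 0) : ((i : ℝ), vp p (x.coeff i)) ∈ newtonHull x :=
  subset_convexHull _ _ ⟨i, hi, rfl⟩

theorem isLinearMap_snd_add_mul_fst (s : ℝ) : IsLinearMap ℝ fun S : ℝ × ℝ => S.2 + s * S.1 :=
  ⟨fun _ _ => by simp only [Prod.fst_add, Prod.snd_add]; ring,
    fun _ _ => by simp only [Prod.smul_fst, Prod.smul_snd, smul_eq_mul]; ring⟩

theorem convex_insert_setOf_lt {E : Type*} [AddCommGroup E] [Module ℝ E] {f : E → ℝ}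
    (hf : IsLinearMap ℝ f) (P : E) : Convex ℝ (insert P {S | f P < f S}) := by
  rw [convex_iff_forall_pos]
  rintro S hS T hT a b ha hb hab
  have hfP : f P = a * f P + b * f P := by rw [← add_mul, hab, one_mul]
  have hfST : f (a • S + b • T) = a * f S + b * f T := by
    rw [hf.map_add, hf.map_smul, hf.map_smul, smul_eq_mul, smul_eq_mul]
  simp only [Set.mem_insert_iff, Set.mem_ofPred_eq, hfST] at hS hT ⊢
  rcases hS with rfl | hS <;> rcases hT with rfl | hT
  · left; rw [← add_smul, hab, one_smul]
  all_goals right; nlinarith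

theorem IsDominant.not_isSlope (h : IsDominant s x d) : ¬ IsSlope x s := by
  rintro ⟨-, P, hP, Q, hQ, hlt, heq, hmin⟩
  set V : ℝ × ℝ := ((d : ℝ), vp p (x.coeff d))
  have hd := h.isTopIndex.coeff_ne_zero
  have hsub : newtonHull x ⊆ insert V {S | V.2 + s * V.1 < S.2 + s * S.1} := by
    refine convexHull_min ?_ (convex_insert_setOf_lt (isLinearMap_snd_add_mul_fst s) V)
    rintro _ ⟨i, hi, rfl⟩
    rcases eq_or_ne i d with rfl | hid
    · exact Set.mem_insert _ _
    · refine Set.mem_insert_of_mem _ (Set.mem_ofPred_eq ▸ lt_of_not_ge fun hge => ?_)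
      exact ((vp_add_le_vp_add_iff hi hd).1 hge).not_gt (h.weight_eq ▸ h.weight_lt i hid)
  have hV := mem_newtonHull hd
  have hPV : P = V := (hsub hP).resolve_right fun h => (hmin V hV).not_gt h
  have hQV : Q = V := (hsub hQ).resolve_right fun h => (heq ▸ hmin V hV).not_gt h
  exact hlt.ne (by rw [hPV, hQV])

variable [IsDiscreteValuationRing 𝒪[F]]

theorem exists_isDominant_of_not_isSlope (hs : 0 < s) (hx : x ≠ 0) (h : ¬ IsSlope x s) :
    ∃ d, IsDominant s x d := by
  obtain ⟨a, ha⟩ := exists_isTopIndex hs hx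
  refine ⟨a, ha.weight_eq, fun k hk => (weight_le_w hs x k).lt_of_ne fun hkw => h ?_⟩
  have hk0 : x.coeff k ≠ 0 := weight_pos.1 (hkw ▸ ha.w_pos)
  have hka : k < a := lt_of_le_of_ne (not_lt.1 fun hak => (ha.weight_lt k hak).ne hkw) hk
  have hle : ∀ i, weight s x i ≤ weight s x k := fun i => hkw ▸ weight_le_w hs x i
  refine ⟨hs, _, mem_newtonHull hk0, _, mem_newtonHull ha.coeff_ne_zero, Rat.cast_lt.2 hka,
    le_antisymm ((vp_add_le_vp_add_iff hk0 ha.coeff_ne_zero).2 (hle a))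
      ((vp_add_le_vp_add_iff ha.coeff_ne_zero hk0).2 (hkw.trans ha.weight_eq.symm).le),
    fun S hS => ?_⟩
  refine convexHull_min ?_ (convex_halfSpace_ge (isLinearMap_snd_add_mul_fst s) _) hS
  rintro _ ⟨i, hi, rfl⟩
  exact (vp_add_le_vp_add_iff hk0 hi).2 (hle i)

theorem IsDominant.eventually (hr : 0 < r) (h : IsDominant r x d) :
    ∀ᶠ r' in 𝓝 r, IsDominant r' x d := by
  obtain ⟨l, -, hl1, hl⟩ := h.exists_gap hr
  have hW := h.isTopIndex.w_pos
  obtain ⟨K, hK⟩ := exists_forall_weight_lt (half_pos hr) (half_pos hW) x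
  have hp := (prime_cast_pos p).ne'
  have hright : ContinuousAt (fun r' => w r x * (p : ℝ) ^ ((r - r') * d)) r :=
    continuousAt_const.mul (.rpow continuousAt_const (by fun_prop) (.inl hp))
  have hleft : ContinuousAt (fun r' => l * w r x * (p : ℝ) ^ (|r - r'| * K)) r :=
    continuousAt_const.mul (.rpow continuousAt_const (by fun_prop) (.inl hp))
  have hsmall : ∀ᶠ r' in 𝓝 r,
      l * w r x * (p : ℝ) ^ (|r - r'| * K) < w r x * (p : ℝ) ^ ((r - r') * d) :=
    hleft.eventually_lt hright (by simpa using mul_lt_of_lt_one_left hW hl1)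
  have hlarge : ∀ᶠ r' in 𝓝 r, w r x / 2 < w r x * (p : ℝ) ^ ((r - r') * d) :=
    continuousAt_const.eventually_lt hright (by simpa using hW)
  filter_upwards [hsmall, hlarge, lt_mem_nhds (half_lt_self hr)] with r' hsmall hlarge hr'
  refine .of_weight_lt fun k hk => ?_
  rw [weight_eq_weight_mul r r' x d, h.weight_eq]
  rcases le_total (k : ℝ) K with hkK | hkK
  · exact ((weight_le_weight_mul_rpow r r' x hkK).trans
      (mul_le_mul_of_nonneg_right (hl k hk) (prime_rpow_pos p _).le)).trans_lt hsmall
  · exact (hK k hkK r' hr'.le).trans hlarge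

theorem IsDominant.of_isPreconnected {I : Set ℝ} (hI : IsPreconnected I) (hpos : ∀ r ∈ I, 0 < r)
    (hslope : ∀ r ∈ I, ¬ IsSlope x r) (hr : r ∈ I) (h : IsDominant r x d) :
    ∀ r' ∈ I, IsDominant r' x d := by
  have hdom : ∀ r ∈ I, ∃ d, IsDominant r x d := fun r hr =>
    exists_isDominant_of_not_isSlope (hpos r hr) h.isTopIndex.ne_zero (hslope r hr)
  choose! e he using hdom
  intro r' hr'
  have hconst : e r = e r' := by
    refine hI.induction₂ (fun a b => e a = e b) (fun a ha => ?_)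
      (fun a b c _ _ _ => Eq.trans) (fun a b _ _ => Eq.symm) hr hr'
    filter_upwards [mem_nhdsWithin_of_mem_nhds ((he a ha).eventually (hpos a ha)),
      self_mem_nhdsWithin] with b hb hbI
    exact hb.isTopIndex.unique (he b hbI).isTopIndex
  rw [h.isTopIndex.unique (he r hr).isTopIndex, hconst]
  exact he r' hr'

end Slopes

end OmegaImmAn

namespace IsPure

variable {p : ℕ} [Fact p.Prime] {F : Type*} [NormedField F] [IsUltrametricDist F]
  [CompleteSpace F] {x : OmegaImmAn p F} {r s : ℝ} {d : ℚ}

theorem coeff_zero_ne_zero (h : IsPure x s) : x.coeff 0 ≠ 0 := h.1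

theorem slope_pos (h : IsPure x s) : 0 < s := h.2.1.1

theorem ne_zero (h : IsPure x s) : x ≠ 0 := by
  rintro rfl
  exact h.coeff_zero_ne_zero rfl

theorem not_isDominant (h : IsPure x s) : ¬ OmegaImmAn.IsDominant s x d :=
  fun hd => hd.not_isSlope h.2.1

variable [IsDiscreteValuationRing 𝒪[F]]

theorem isDominant_zero (h : IsPure x s) (hr : s < r) : OmegaImmAn.IsDominant r x 0 := by
  obtain ⟨r₀, hr₀, hs⟩ := ((OmegaImmAn.eventually_isDominant_zero h.coeff_zero_ne_zero).and
    (eventually_gt_atTop s)).exists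
  exact hr₀.of_isPreconnected isPreconnected_Ioi (fun t ht => h.slope_pos.trans ht)
    (fun t ht hslope => (h.2.2 t hslope).not_gt ht) hs r hr

theorem exists_isDominant (h : IsPure x s) :
    ∃ d, ∀ r ∈ Set.Ioo 0 s, OmegaImmAn.IsDominant r x d := by
  have hslope : ∀ t ∈ Set.Ioo 0 s, ¬ IsSlope x t := fun t ht hxt => ht.2.ne (h.2.2 t hxt)
  have hmem : s / 2 ∈ Set.Ioo 0 s := ⟨half_pos h.slope_pos, half_lt_self h.slope_pos⟩
  obtain ⟨d, hd⟩ := OmegaImmAn.exists_isDominant_of_not_isSlope hmem.1 h.ne_zero (hslope _ hmem)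
  exact ⟨d, hd.of_isPreconnected isPreconnected_Ioo (fun t ht => ht.1) hslope hmem⟩

end IsPure

/-! ### Convergence and division -/

theorem mul_sum_one_sub_pow_sub {R : Type*} [CommRing R] {a b y z : R} (h : y * a = z * b)
    (n : ℕ) :
    y * (a * ∑ k ∈ Finset.range n, (1 - b) ^ k) - z = -z * (1 - b) ^ n := by
  have hgeom := mul_neg_geom_sum (1 - b) n
  rw [sub_sub_cancel] at hgeom
  rw [← mul_assoc, h, mul_assoc, hgeom]
  ring

theorem woLevels_of_forall_exists_norm_sub_le {F : Type*} [NormedField F] [IsUltrametricDist F]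
    [CompleteSpace F] {x : ℚ → F}
    (h : ∀ ρ : ℝ, 0 < ρ → ∀ n : ℚ, ∃ y, WOLevels y ∧ ∀ i ≤ n, ‖y i - x i‖ ≤ ρ) :
    WOLevels x := by
  refine wo_of_trunc fun n ρ hρ => ?_
  obtain ⟨y, hy, hyx⟩ := h ρ hρ n
  refine (hy ρ hρ).mono fun i (hi : ρ < ‖trunc n x i‖) => ?_
  by_cases hin : i ≤ n
  · rw [trunc, if_pos hin] at hi
    by_contra hy'
    have hle := IsUltrametricDist.norm_add_le_max (x i - y i) (y i)
    rw [sub_add_cancel, norm_sub_rev] at hle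
    exact (hle.trans (max_le (hyx i hin) (not_lt.1 hy'))).not_gt hi
  · rw [trunc, if_neg hin, norm_zero] at hi
    exact absurd hi hρ.not_gt

namespace OmegaImmAn

variable {p : ℕ} [Fact p.Prime] {F : Type*} [NormedField F] [IsUltrametricDist F]
  [CompleteSpace F]

section Limits

variable {r r' C : ℝ} {u : ℕ → OmegaImmAn p F} {x y : OmegaImmAn p F} {d : ℚ}

theorem w_sub_le_max (hr : 0 < r) (x y : OmegaImmAn p F) : w r (x - y) ≤ max (w r x) (w r y) := by
  rw [sub_eq_add_neg, ← w_neg r y]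
  exact w_add_le_max hr x (-y)

theorem w_sub_comm (r : ℝ) (x y : OmegaImmAn p F) : w r (x - y) = w r (y - x) := by
  rw [← w_neg, neg_sub]

theorem w_sub_le_of_forall_w_succ_sub_le (hr : 0 < r) {n : ℕ}
    (h : ∀ m, n ≤ m → w r (u (m + 1) - u m) ≤ C) {m : ℕ} (hm : n ≤ m) : w r (u m - u n) ≤ C := by
  induction m, hm using Nat.le_induction with
  | base =>
    rw [sub_self, w_zero]
    exact (w_nonneg _ _).trans (h n le_rfl)
  | succ m hm ih =>
    rw [← sub_add_sub_cancel]
    exact (w_add_le_max hr _ _).trans (max_le (h m hm) ih)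

theorem cauchySeq_coeff (hr : 0 < r) (h : Tendsto (fun n => w r (u (n + 1) - u n)) atTop (𝓝 0))
    (i : ℚ) : CauchySeq fun n => (u n).coeff i := by
  refine NonarchimedeanAddGroup.cauchySeq_of_tendsto_sub_nhds_zero
    (squeeze_zero_norm (fun n => ?_) ((h.mul_const ((p : ℝ) ^ (r * i))).trans (by simp)))
  rw [← coeff_sub]
  exact weight_le_iff.1 (weight_le_w hr _ i)

theorem norm_coeff_sub_le_of_tendsto (hr : 0 < r) {n : ℕ}
    (h : ∀ m, n ≤ m → w r (u (m + 1) - u m) ≤ C) {i : ℚ} {a : F}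
    (ha : Tendsto (fun n => (u n).coeff i) atTop (𝓝 a)) :
    ‖(u n).coeff i - a‖ ≤ C * (p : ℝ) ^ (r * i) := by
  refine le_of_tendsto ((tendsto_const_nhds.sub ha).norm)
    ((eventually_ge_atTop n).mono fun m hm => ?_)
  rw [← coeff_sub, ← weight_le_iff]
  refine (weight_le_w hr _ i).trans ?_
  rw [w_sub_comm]
  exact w_sub_le_of_forall_w_succ_sub_le hr h hm

theorem exists_limit (hr : 0 < r) (hu : Tendsto (fun n => w r (u (n + 1) - u n)) atTop (𝓝 0))
    (hbdd : ∀ t, 0 < t → ∃ C, ∀ i, ∀ᶠ n in atTop, weight t (u n) i ≤ C) :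
    ∃ x : OmegaImmAn p F, ∀ t, 0 < t → Tendsto (fun n => w t (u (n + 1) - u n)) atTop (𝓝 0) →
      Tendsto (fun n => w t (u n - x)) atTop (𝓝 0) := by
  choose x hx using fun i => cauchySeq_tendsto_of_complete (cauchySeq_coeff hr hu i)
  have happrox : ∀ {t ε : ℝ}, 0 < t → 0 < ε →
      Tendsto (fun n => w t (u (n + 1) - u n)) atTop (𝓝 0) →
      ∃ N, ∀ n, N ≤ n → ∀ i, ‖(u n).coeff i - x i‖ ≤ ε * (p : ℝ) ^ (t * i) := by
    intro t ε ht hε htu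
    obtain ⟨N, hN⟩ := eventually_atTop.1 (htu.eventually_le_const hε)
    exact ⟨N, fun n hn i =>
      norm_coeff_sub_le_of_tendsto ht (fun m hm => hN m (hn.trans hm)) (hx i)⟩
  have hmem : x ∈ omegaImmAnAddSubgroup p F := by
    refine ⟨fun i hi => tendsto_nhds_unique (hx i) ?_, ?_, fun t ht => ?_⟩
    · simp only [coeff_of_neg _ hi, tendsto_const_nhds]
    · refine woLevels_of_forall_exists_norm_sub_le fun ρ hρ n => ?_
      obtain ⟨N, hN⟩ := happrox hr (div_pos hρ (prime_rpow_pos p (r * n))) hu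
      refine ⟨(u N).coeff, (u N).2.2.1, fun i hi => (hN N le_rfl i).trans ?_⟩
      rw [div_mul_eq_mul_div, div_le_iff₀ (prime_rpow_pos p _)]
      have hi' : (i : ℝ) ≤ n := by exact_mod_cast hi
      exact mul_le_mul_of_nonneg_left (Real.rpow_le_rpow_of_exponent_le (one_lt_prime_cast p).le
        (mul_le_mul_of_nonneg_left hi' hr.le)) hρ.le
    · obtain ⟨C, hC⟩ := hbdd t ht
      exact ⟨C, fun i => le_of_tendsto (hx i).norm ((hC i).mono fun n hn => weight_le_iff.1 hn)⟩
  let X : OmegaImmAn p F := ⟨x, hmem⟩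
  refine ⟨X, fun t ht htu => tendsto_order.2
    ⟨fun a ha => .of_forall fun n => ha.trans_le (w_nonneg _ _), fun a ha => ?_⟩⟩
  obtain ⟨N, hN⟩ := happrox ht (half_pos ha) htu
  refine (eventually_ge_atTop N).mono fun n hn => lt_of_le_of_lt (w_le fun i => ?_)
    (half_lt_self ha)
  rw [weight_le_iff, coeff_sub]
  exact hN n hn i

theorem eq_of_tendsto_w_sub (hr : 0 < r) (hx : Tendsto (fun n => w r (u n - x)) atTop (𝓝 0))
    (hy : Tendsto (fun n => w r (u n - y)) atTop (𝓝 0)) : x = y := by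
  by_contra hxy
  refine (w_pos hr (sub_ne_zero.2 hxy)).not_ge
    (ge_of_tendsto' (by simpa using hy.max hx) fun n => ?_)
  rw [← sub_sub_sub_cancel_left y x (u n)]
  exact w_sub_le_max hr _ _

theorem tendsto_w_mul_sub [IsDiscreteValuationRing 𝒪[F]] (hr : 0 < r)
    (h : Tendsto (fun n => w r (u n - x)) atTop (𝓝 0)) (y : OmegaImmAn p F) :
    Tendsto (fun n => w r (y * u n - y * x)) atTop (𝓝 0) := by
  simp only [← mul_sub, w_mul hr]
  simpa using h.const_mul (w r y)

theorem tendsto_w_succ_sub (hr : 0 < r) (h : Tendsto (fun n => w r (u n - x)) atTop (𝓝 0)) :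
    Tendsto (fun n => w r (u (n + 1) - u n)) atTop (𝓝 0) := by
  refine squeeze_zero (fun n => w_nonneg _ _) (fun n => ?_)
    (by simpa using ((tendsto_add_atTop_iff_nat 1).2 h).max h)
  rw [← sub_sub_sub_cancel_right _ _ x]
  exact w_sub_le_max hr _ _

theorem IsDominant.of_w_sub_lt (hr : 0 < r) (h : IsDominant r y d) (hyx : w r (y - x) < w r x) :
    IsDominant r x d := by
  have hlt : w r (y - x) < w r y := by
    have hle := w_sub_le_max hr y (y - x)
    rw [sub_sub_cancel] at hle
    exact hyx.trans_le ((le_max_iff.1 hle).resolve_right hyx.not_ge)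
  have hd : w r y ≤ weight r x d := by
    have hle := weight_add_le_max r x (y - x) d
    rw [add_sub_cancel, h.weight_eq] at hle
    exact (le_max_iff.1 hle).resolve_right ((weight_le_w hr _ _).trans_lt hlt).not_ge
  refine .of_weight_lt fun k hk => lt_of_lt_of_le ?_ hd
  have hle := weight_add_le_max r y (-(y - x)) k
  rw [← sub_eq_add_neg, sub_sub_cancel, weight_neg] at hle
  exact hle.trans_lt (max_lt (h.weight_lt k hk) ((weight_le_w hr _ _).trans_lt hlt))

end Limits

section Divisibility

variable {r r' s C κ : ℝ} {x y z a b v : OmegaImmAn p F} {d : ℚ}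

theorem weight_const_mul (r : ℝ) (a : F) (x : OmegaImmAn p F) (i : ℚ) :
    weight r (const a * x) i = ‖a‖ * weight r x i := by
  rw [weight, coeff_const_mul, norm_mul, mul_assoc, weight]

theorem IsDominant.const_mul {a : F} (ha : a ≠ 0) (h : IsDominant r x d) :
    IsDominant r (const a * x) d := by
  refine .of_weight_lt fun k hk => ?_
  rw [weight_const_mul, weight_const_mul, h.weight_eq]
  exact mul_lt_mul_of_pos_left (h.weight_lt k hk) (norm_pos_iff.2 ha)

theorem coeff_zero_const_inv_mul (h : x.coeff 0 ≠ 0) :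
    (const (x.coeff 0)⁻¹ * x).coeff 0 = 1 := by
  rw [coeff_const_mul, inv_mul_cancel₀ h]

theorem min_one_rpow_mul_max_le (hC : 0 ≤ C) (hκ : 0 ≤ κ) (δ m n : ℝ) :
    min 1 ((p : ℝ) ^ (δ * (n - m))) * max C (κ * (p : ℝ) ^ (δ * m)) ≤
      max C (κ * (p : ℝ) ^ (δ * n)) := by
  have hm := prime_rpow_pos p (δ * m)
  rw [mul_max_of_nonneg _ _ (le_min zero_le_one (prime_rpow_pos p _).le)]
  refine max_le_max (mul_le_of_le_one_left hC (min_le_left _ _)) ?_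
  calc min 1 ((p : ℝ) ^ (δ * (n - m))) * (κ * (p : ℝ) ^ (δ * m))
      ≤ (p : ℝ) ^ (δ * (n - m)) * (κ * (p : ℝ) ^ (δ * m)) :=
        mul_le_mul_of_nonneg_right (min_le_right _ _) (by positivity)
    _ = κ * (p : ℝ) ^ (δ * n) := by
        rw [mul_left_comm, ← Real.rpow_add (prime_cast_pos p)]; congr 2; ring

variable [IsDiscreteValuationRing 𝒪[F]]

theorem IsDominant.exists_gap_min (hr : 0 < r) (hr' : 0 < r') (h : IsDominant r y d)
    (h' : IsDominant r' y d) :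
    ∃ l, 0 ≤ l ∧ l < 1 ∧ ∀ k, k ≠ d →
      weight r y k ≤ l * w r y * min 1 ((p : ℝ) ^ ((r' - r) * (k - d))) := by
  obtain ⟨l, hl0, hl1, hl⟩ := h.exists_gap hr
  obtain ⟨m, -, hm1, hm⟩ := h'.exists_gap hr'
  have hw := w_nonneg r y
  refine ⟨max l m, le_max_of_le_left hl0, max_lt hl1 hm1, fun k hk => ?_⟩
  rw [mul_min_of_nonneg _ _ (mul_nonneg (le_max_of_le_left hl0) hw), mul_one]
  refine le_min ((hl k hk).trans (mul_le_mul_of_nonneg_right (le_max_left _ _) hw)) ?_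
  calc weight r y k = weight r' y k * (p : ℝ) ^ ((r' - r) * k) := weight_eq_weight_mul r' r y k
    _ ≤ max l m * w r' y * (p : ℝ) ^ ((r' - r) * k) :=
        mul_le_mul_of_nonneg_right ((hm k hk).trans
          (mul_le_mul_of_nonneg_right (le_max_right _ _) (w_nonneg _ _))) (prime_rpow_pos p _).le
    _ = max l m * w r y * (p : ℝ) ^ ((r' - r) * (k - d)) := by
        rw [← h.weight_eq, ← h'.weight_eq, weight_eq_weight_mul r r', mul_assoc, mul_assoc,
          mul_assoc, ← Real.rpow_add (prime_cast_pos p)]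
        congr 3; ring

theorem IsDominant.w_mul_weight_le (hr : 0 < r) (hr' : 0 < r') (hy : IsDominant r y d)
    (hy' : IsDominant r' y d) (hC : 0 < C) (hκ : 0 ≤ κ)
    (h : ∀ n, weight r (y * v) (n + d) ≤ max C (κ * (p : ℝ) ^ ((r' - r) * n))) (n : ℚ) :
    w r y * weight r v n ≤ max C (κ * (p : ℝ) ^ ((r' - r) * n)) := by
  obtain ⟨l, hl0, hl1, hl⟩ := hy.exists_gap_min hr hr' hy'
  set E : ℚ → ℝ := fun n => max C (κ * (p : ℝ) ^ ((r' - r) * n))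
  have hE : ∀ n, 0 < E n := fun n => lt_max_of_lt_left hC
  -- the supremum `S` of these quotients satisfies `S ≤ max 1 (l S)`, hence `S ≤ 1`
  set S := ⨆ n, w r y * weight r v n / E n
  have hbdd : BddAbove (Set.range fun n => w r y * weight r v n / E n) :=
    ⟨w r y * w r v / C, Set.forall_mem_range.2 fun n => div_le_div₀
      (mul_nonneg (w_nonneg _ _) (w_nonneg _ _))
      (mul_le_mul_of_nonneg_left (weight_le_w hr v n) (w_nonneg _ _)) hC (le_max_left _ _)⟩
  have hS : ∀ n, w r y * weight r v n ≤ S * E n := fun n => (div_le_iff₀ (hE n)).1 (le_ciSup hbdd n)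
  have hS0 : 0 ≤ S := Real.iSup_nonneg fun n =>
    div_nonneg (mul_nonneg (w_nonneg _ _) (weight_nonneg _ _ _)) (hE n).le
  have hother : ∀ n k, k ≠ d → weight r y k * weight r v (n + d - k) ≤ l * S * E n := by
    intro n k hk
    set μ := min 1 ((p : ℝ) ^ ((r' - r) * (k - d)))
    have hμ : 0 ≤ μ := le_min zero_le_one (prime_rpow_pos p _).le
    have hμE : μ * E (n + d - k) ≤ E n := by
      have := min_one_rpow_mul_max_le (p := p) hC.le hκ (r' - r) (n + d - k : ℚ) n
      rwa [show (n - (n + d - k : ℚ) : ℝ) = k - d by push_cast; ring] at this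
    calc weight r y k * weight r v (n + d - k) ≤ l * w r y * μ * weight r v (n + d - k) :=
          mul_le_mul_of_nonneg_right (hl k hk) (weight_nonneg _ _ _)
      _ = l * μ * (w r y * weight r v (n + d - k)) := by ring
      _ ≤ l * μ * (S * E (n + d - k)) := mul_le_mul_of_nonneg_left (hS _) (mul_nonneg hl0 hμ)
      _ = l * S * (μ * E (n + d - k)) := by ring
      _ ≤ l * S * E n := mul_le_mul_of_nonneg_left hμE (mul_nonneg hl0 hS0)
  have hstep : ∀ n, w r y * weight r v n ≤ max 1 (l * S) * E n := by
    intro n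
    by_contra! hlt
    rw [max_mul_of_nonneg _ _ (hE n).le, max_lt_iff, one_mul, ← hy.weight_eq] at hlt
    obtain ⟨hE_lt, hlS⟩ := hlt
    have heq := weight_mul_eq_of_lt (n := n + d) (hother n) (by rwa [add_sub_cancel_right])
    rw [add_sub_cancel_right] at heq
    exact (h n).not_gt (heq ▸ hE_lt)
  have hSle : S ≤ max 1 (l * S) := ciSup_le fun n => (div_le_iff₀ (hE n)).2 (hstep n)
  have hS1 : S ≤ 1 := by
    by_contra! hS1
    rcases le_max_iff.1 hSle with h1 | h1 <;> nlinarith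
  exact (hS n).trans (mul_le_of_le_one_left (hE n).le hS1)

theorem IsDominant.w_one_sub_lt_one (hr : 0 < r) (h : IsDominant r b 0) (hb : b.coeff 0 = 1) :
    w r (1 - b) < 1 := by
  obtain ⟨l, hl0, hl1, hl⟩ := h.exists_gap hr
  have hw : w r b = 1 := by rw [← h.weight_eq, weight_zero_index, hb, norm_one]
  refine (w_le fun k => ?_).trans_lt hl1
  rcases eq_or_ne k 0 with rfl | hk
  · rw [weight_zero_index, coeff_sub, coeff_one_zero, hb, sub_self, norm_zero]
    exact hl0
  · have hone : (1 : OmegaImmAn p F).coeff k = 0 := by simp [coeff_one, mono, hk]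
    rw [weight, coeff_sub, hone, zero_sub, norm_neg, ← weight]
    simpa [hw] using hl k hk

theorem IsDominant.tendsto_w_mul_one_sub_pow (hr : 0 < r) (h : IsDominant r b 0)
    (hb : b.coeff 0 = 1) (x : OmegaImmAn p F) :
    Tendsto (fun n => w r (x * (1 - b) ^ n)) atTop (𝓝 0) := by
  simp only [w_mul hr, w_pow hr]
  simpa using (tendsto_pow_atTop_nhds_zero_of_lt_one (w_nonneg _ _)
    (h.w_one_sub_lt_one hr hb)).const_mul (w r x)

theorem IsDominant.eventually_weight_le (hr : 0 < r) (hr' : 0 < r') (hy : IsDominant r y d)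
    (hy' : IsDominant r' y d) {v : ℕ → OmegaImmAn p F}
    (hv : Tendsto (fun n => w r' (y * v n - z)) atTop (𝓝 0)) :
    ∃ C, ∀ i, ∀ᶠ n in atTop, weight r (v n) i ≤ C := by
  have hw := hy.isTopIndex.w_pos
  set C := max (w r z) 1
  have hC : 0 < C := lt_max_of_lt_right one_pos
  have hbound : ∀ n i, w r y * weight r (v n) i ≤
      max C (w r' (y * v n - z) * (p : ℝ) ^ ((r' - r) * d) * (p : ℝ) ^ ((r' - r) * i)) := by
    intro n i
    refine hy.w_mul_weight_le hr hr' hy' hC (mul_nonneg (w_nonneg _ _) (prime_rpow_pos p _).le)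
      (fun k => ?_) i
    have hsplit := weight_add_le_max r z (y * v n - z) (k + d)
    rw [add_sub_cancel] at hsplit
    refine hsplit.trans (max_le_max (le_max_of_le_left (weight_le_w hr z _)) ?_)
    rw [weight_eq_weight_mul r', mul_assoc, ← Real.rpow_add (prime_cast_pos p),
      show (r' - r) * d + (r' - r) * k = (r' - r) * (k + d : ℚ) by push_cast; ring]
    exact mul_le_mul_of_nonneg_right (weight_le_w hr' _ _) (prime_rpow_pos p _).le
  refine ⟨C / w r y, fun i => ?_⟩
  have hlim : Tendsto (fun n => w r' (y * v n - z) * (p : ℝ) ^ ((r' - r) * d) *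
      (p : ℝ) ^ ((r' - r) * i)) atTop (𝓝 0) := by
    simpa using (hv.mul_const ((p : ℝ) ^ ((r' - r) * d))).mul_const ((p : ℝ) ^ ((r' - r) * i))
  filter_upwards [hlim.eventually_le_const hC] with n hn
  rw [le_div_iff₀ hw, mul_comm]
  exact (hbound n i).trans (max_le le_rfl hn)

end Divisibility

end OmegaImmAn

namespace IsPure

open OmegaImmAn

variable {p : ℕ} [Fact p.Prime] {F : Type*} [NormedField F] [IsUltrametricDist F]
  [CompleteSpace F] [IsDiscreteValuationRing 𝒪[F]] {s : ℝ} {a b y z : OmegaImmAn p F}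

theorem dvd_of_mul_eq_mul_of_coeff_zero (hy : IsPure y s) (hb : IsDominant s b 0)
    (hb1 : b.coeff 0 = 1) (h : y * a = z * b) : y ∣ z := by
  obtain ⟨r, ⟨hr0, hrs⟩, hbr⟩ := (Filter.Eventually.and (Ioo_mem_nhdsLT hy.slope_pos)
    ((hb.eventually hy.slope_pos).filter_mono nhdsWithin_le_nhds)).exists
  obtain ⟨d, hd⟩ := hy.exists_isDominant
  let v : ℕ → OmegaImmAn p F := fun n => a * ∑ k ∈ Finset.range n, (1 - b) ^ k
  have hyv : Tendsto (fun n => w r (y * v n - z)) atTop (𝓝 0) := by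
    simp only [v, mul_sum_one_sub_pow_sub h]
    exact hbr.tendsto_w_mul_one_sub_pow hr0 hb1 (-z)
  have hv : Tendsto (fun n => w r (v (n + 1) - v n)) atTop (𝓝 0) := by
    simp only [v, Finset.sum_range_succ, mul_add, add_sub_cancel_left]
    exact hbr.tendsto_w_mul_one_sub_pow hr0 hb1 a
  have hbdd : ∀ t, 0 < t → ∃ C, ∀ i, ∀ᶠ n in atTop, weight t (v n) i ≤ C := by
    intro t ht
    have hmin : min t r ∈ Set.Ioo 0 s := ⟨lt_min ht hr0, (min_le_right _ _).trans_lt hrs⟩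
    obtain ⟨C, hC⟩ := (hd _ hmin).eventually_weight_le hmin.1 hr0 (hd r ⟨hr0, hrs⟩) hyv
    exact ⟨C, fun i => (hC i).mono fun n hn =>
      (weight_antitone (min_le_left t r) (v n) i).trans hn⟩
  obtain ⟨Z, hZ⟩ := exists_limit hr0 hv hbdd
  exact ⟨Z, eq_of_tendsto_w_sub hr0 hyv (tendsto_w_mul_sub hr0 (hZ r hr0 hv) y)⟩

theorem dvd_of_mul_eq_mul (hy : IsPure y s) (hb : IsDominant s b 0)
    (h : y * a = z * b) : y ∣ z := by
  have hb0 := hb.isTopIndex.coeff_ne_zero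
  refine hy.dvd_of_mul_eq_mul_of_coeff_zero (hb.const_mul (inv_ne_zero hb0))
    (coeff_zero_const_inv_mul hb0) (a := const (b.coeff 0)⁻¹ * a) ?_
  rw [mul_left_comm, h, mul_left_comm]

end IsPure

/-! ### Uniqueness of slope factorizations -/

section Uniqueness

variable {p : ℕ} [Fact p.Prime] {F : Type*} [NormedField F] [IsUltrametricDist F]
  [CompleteSpace F]

namespace OmegaImmAn

theorem isDominant_tPow (r : ℝ) (j : ℚ≥0) : IsDominant r (tPow p F j) j :=
  .of_weight_lt fun k hk => by
    rw [weight_of_coeff_eq_zero (by simp [coeff_tPow, mono, hk])]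
    exact weight_pos.2 (by simp [coeff_tPow, mono])

theorem isDominant_of_tendsto {r : ℝ} {d : ℚ} {u : ℕ → OmegaImmAn p F} {x : OmegaImmAn p F}
    (hr : 0 < r) (hx : x ≠ 0) (hu : ∀ n, IsDominant r (u n) d)
    (h : Tendsto (fun n => w r (u n - x)) atTop (𝓝 0)) : IsDominant r x d := by
  obtain ⟨n, hn⟩ := (h.eventually_lt_const (w_pos hr hx)).exists
  exact (hu n).of_w_sub_lt hr hn

variable [IsDiscreteValuationRing 𝒪[F]]

theorem exists_frechetTendsto_of_mul {u : ℕ → OmegaImmAn p F} {x y : OmegaImmAn p F} (hy : y ≠ 0)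
    (h : FrechetTendsto (fun n => y * u n) x) : ∃ a, x = y * a ∧ FrechetTendsto u a := by
  have hu : ∀ r, 0 < r → Tendsto (fun n => w r (u (n + 1) - u n)) atTop (𝓝 0) := by
    intro r hr
    have hlim := (tendsto_w_succ_sub hr (h r hr)).const_mul (w r y)⁻¹
    simp only [← mul_sub, w_mul hr, mul_zero] at hlim
    simpa only [inv_mul_cancel_left₀ (w_pos hr hy).ne'] using hlim
  have hbdd : ∀ r, 0 < r → ∃ C, ∀ i, ∀ᶠ n in atTop, weight r (u n) i ≤ C := by
    intro r hr
    refine ⟨max 1 (w r x) / w r y, fun i => ?_⟩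
    filter_upwards [(h r hr).eventually_le_const one_pos] with n hn
    refine (weight_le_w hr _ i).trans ((le_div_iff₀ (w_pos hr hy)).2 ?_)
    rw [mul_comm, ← w_mul hr, ← sub_add_cancel (y * u n) x]
    exact (w_add_le_max hr _ _).trans (max_le_max_right _ hn)
  obtain ⟨a, ha⟩ := exists_limit one_pos (hu 1 one_pos) hbdd
  refine ⟨a, ?_, fun r hr => ha r hr (hu r hr)⟩
  exact eq_of_tendsto_w_sub one_pos (h 1 one_pos)
    (tendsto_w_mul_sub one_pos (ha 1 one_pos (hu 1 one_pos)) y)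

end OmegaImmAn

namespace SlopeFactorization

open OmegaImmAn

variable {R : Subring (OmegaImmAn p F)} {x : R} {f g : SlopeFactorization R x} {k i : ℕ}
  {A B : OmegaImmAn p F}

theorem slope_le (hki : k ≤ i) (hi : (i : ℕ∞) < f.N) : f.s i ≤ f.s k := by
  rcases hki.eq_or_lt with rfl | h
  exacts [le_rfl, (f.strictAnti k i h hi).le]

theorem y_ne_zero (hi : (i : ℕ∞) < f.N) : (f.y i : OmegaImmAn p F) ≠ 0 :=
  (f.isPure i hi).ne_zero

/-- `A` is the product of the factors `y_i` with `i ≥ k`, which converges when `N = ∞`. Its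
dominant exponent above all the remaining slopes is part of the notion, so that the two cases
`N < ∞` and `N = ∞` need not be distinguished later. -/
structure IsTail (f : SlopeFactorization R x) (k : ℕ) (A : OmegaImmAn p F) : Prop where
  prod_eq : (f.prod : OmegaImmAn p F) = (∏ i ∈ Finset.range k, (f.y i : OmegaImmAn p F)) * A
  isDominant : ∀ r, 0 < r → (∀ i : ℕ, k ≤ i → (i : ℕ∞) < f.N → f.s i < r) → IsDominant r A 0
  eq_one : f.N = k → A = 1

variable [IsDiscreteValuationRing 𝒪[F]]

theorem prod_range_ne_zero (hk : (k : ℕ∞) ≤ f.N) :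
    ∏ i ∈ Finset.range k, (f.y i : OmegaImmAn p F) ≠ 0 :=
  Finset.prod_ne_zero_iff.2 fun i hi =>
    y_ne_zero (lt_of_lt_of_le (by exact_mod_cast Finset.mem_range.1 hi) hk)

theorem isTail_of_N_eq {n : ℕ} (hn : f.N = n) (hkn : k ≤ n) :
    f.IsTail k (∏ i ∈ Finset.Ico k n, (f.y i : OmegaImmAn p F)) where
  prod_eq := by
    rw [Finset.prod_range_mul_prod_Ico _ hkn, f.prod_finite n hn, SubmonoidClass.coe_finsetProd]
  isDominant r hr hs := isDominant_zero_prod hr _ _ fun i hi => by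
    obtain ⟨hki, hin⟩ := Finset.mem_Ico.1 hi
    have hiN : (i : ℕ∞) < f.N := by rw [hn]; exact_mod_cast hin
    exact (f.isPure i hiN).isDominant_zero (hs i hki hiN)
  eq_one h := by
    have hnk : n = k := by exact_mod_cast hn.symm.trans h
    rw [hnk, Finset.Ico_self, Finset.prod_empty]

theorem exists_isTail_of_N_eq_top (hx : x ≠ 0) (hN : f.N = ⊤) (k : ℕ) : ∃ A, f.IsTail k A := by
  have hlt : ∀ i : ℕ, (i : ℕ∞) < f.N := fun i => hN ▸ ENat.natCast_lt_top i
  have hlim := f.prod_infinite hN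
  simp only [SubmonoidClass.coe_finsetProd] at hlim
  have hshift : FrechetTendsto (fun n => (∏ i ∈ Finset.range k, (f.y i : OmegaImmAn p F)) *
      ∏ i ∈ Finset.range n, (f.y (k + i) : OmegaImmAn p F)) f.prod := fun r hr => by
    simpa only [add_comm _ k, Finset.prod_range_add] using
      (tendsto_add_atTop_iff_nat k).2 (hlim r hr)
  obtain ⟨A, hA, hAlim⟩ := exists_frechetTendsto_of_mul (prod_range_ne_zero (hlt k).le) hshift
  have hA0 : A ≠ 0 := by
    rintro rfl
    refine hx (Subtype.ext ?_)
    rw [f.eq, Subring.coe_mul, hA, mul_zero, mul_zero, Subring.coe_zero]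
  refine ⟨A, hA, fun r hr hs => ?_, fun h => absurd (hN.symm.trans h) (ENat.natCast_ne_top k).symm⟩
  exact isDominant_of_tendsto hr hA0 (fun n => isDominant_zero_prod hr _ _ fun i _ =>
    (f.isPure _ (hlt _)).isDominant_zero (hs _ (Nat.le_add_right k i) (hlt _))) (hAlim r hr)

theorem exists_isTail (hx : x ≠ 0) (hk : (k : ℕ∞) ≤ f.N) : ∃ A, f.IsTail k A := by
  rcases eq_or_ne f.N ⊤ with hN | hN
  · exact exists_isTail_of_N_eq_top hx hN k
  · obtain ⟨n, hn⟩ := ENat.ne_top_iff_exists.1 hN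
    exact ⟨_, isTail_of_N_eq hn.symm (by exact_mod_cast hn ▸ hk)⟩

theorem IsTail.exists_eq_mul (hx : x ≠ 0) (hk : (k : ℕ∞) < f.N) (hA : f.IsTail k A) :
    ∃ B, f.IsTail (k + 1) B ∧ A = f.y k * B := by
  obtain ⟨B, hB⟩ := exists_isTail (k := k + 1) hx (by exact_mod_cast Order.add_one_le_of_lt hk)
  refine ⟨B, hB, mul_left_cancel₀ (prod_range_ne_zero hk.le) ?_⟩
  rw [← hA.prod_eq, hB.prod_eq, Finset.prod_range_succ, mul_assoc]

theorem isTail_zero (hx : x ≠ 0) (f : SlopeFactorization R x) : f.IsTail 0 f.prod := by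
  obtain ⟨A, hA⟩ := exists_isTail (f := f) (k := 0) hx (by simp)
  have hprod : (f.prod : OmegaImmAn p F) = A := by rw [hA.prod_eq, Finset.prod_range_zero, one_mul]
  exact hprod ▸ hA

theorem eventually_isTopIndex (hx : x ≠ 0) (f : SlopeFactorization R x) :
    ∀ᶠ r in atTop, IsTopIndex r (x : OmegaImmAn p F) f.j := by
  filter_upwards [eventually_gt_atTop 0, eventually_gt_atTop (f.s 0)] with r hr hs
  have hprod := (f.isTail_zero hx).isDominant r hr fun i _ hi =>
    (slope_le (Nat.zero_le i) hi).trans_lt hs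
  have hc := isDominant_zero_of_isUnit hr (f.c.isUnit.map R.subtype)
  have htop := (hc.isTopIndex.mul hr (isDominant_tPow r f.j).isTopIndex).mul hr hprod.isTopIndex
  rw [zero_add, add_zero] at htop
  exact congrArg Subtype.val f.eq ▸ htop

theorem j_eq (hx : x ≠ 0) (f g : SlopeFactorization R x) : f.j = g.j := by
  obtain ⟨r, hf, hg⟩ := ((f.eventually_isTopIndex hx).and (g.eventually_isTopIndex hx)).exists
  exact_mod_cast hf.unique hg

theorem associated_prod (hx : x ≠ 0) (f g : SlopeFactorization R x) :
    Associated f.prod g.prod := by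
  have hfg : ((f.c : R) * f.prod) = (g.c : R) * g.prod := by
    have hj : (⟨tPow p F f.j, f.tPow_mem⟩ : R) = ⟨tPow p F g.j, g.tPow_mem⟩ :=
      Subtype.ext (congrArg (tPow p F) (j_eq hx f g))
    have ht : (⟨tPow p F g.j, g.tPow_mem⟩ : R) ≠ 0 := fun h =>
      (isDominant_tPow (F := F) 1 g.j).isTopIndex.ne_zero (congrArg Subtype.val h)
    refine mul_left_cancel₀ ht ?_
    rw [mul_left_comm, ← mul_assoc, mul_left_comm, ← mul_assoc, ← g.eq, ← hj, ← f.eq]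
  exact (associated_unit_mul_left _ _ f.c.isUnit).symm.trans
    (hfg ▸ associated_unit_mul_left _ _ g.c.isUnit)

theorem IsTail.lt_N_and_slope_le (hx : x ≠ 0) (hf : (k : ℕ∞) < f.N) (hg : (k : ℕ∞) ≤ g.N)
    (hA : f.IsTail k A) (hB : g.IsTail k B) (hAB : Associated A B) :
    (k : ℕ∞) < g.N ∧ f.s k ≤ g.s k := by
  have hs := (f.isPure k hf).slope_pos
  obtain ⟨A', -, rfl⟩ := hA.exists_eq_mul hx hf
  obtain ⟨v, rfl⟩ := hAB
  have hnot : ¬ IsDominant (f.s k) (f.y k * A' * v : OmegaImmAn p F) 0 := fun h =>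
    (f.isPure k hf).not_isDominant
      ((isDominant_zero_mul_iff hs).1 ((isDominant_zero_mul_iff hs).1 h).1).1
  refine ⟨hg.lt_of_ne fun h => hnot ?_, not_lt.1 fun hlt => hnot ?_⟩
  · rw [hB.eq_one h.symm]
    exact isDominant_one _
  · exact hB.isDominant _ hs fun i hki hi => (slope_le hki hi).trans_lt hlt

theorem IsTail.dvd_of_associated_mul (hf : (k : ℕ∞) < f.N) (hs : f.s k = g.s k)
    (hB : g.IsTail (k + 1) B) (hAB : Associated ((f.y k : OmegaImmAn p F) * A) (g.y k * B)) :
    (f.y k : OmegaImmAn p F) ∣ g.y k := by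
  obtain ⟨v, hv⟩ := hAB
  refine (f.isPure k hf).dvd_of_mul_eq_mul (a := A * (v : OmegaImmAn p F)) (b := B) ?_
    (by rw [← hv, mul_assoc])
  refine hB.isDominant _ (f.isPure k hf).slope_pos fun i hi hiN => ?_
  rw [hs]
  exact g.strictAnti k i hi hiN

theorem exists_associated_isTail (hx : x ≠ 0) (f g : SlopeFactorization R x) (k : ℕ)
    (hk : (k : ℕ∞) ≤ f.N) : (k : ℕ∞) ≤ g.N ∧
      (∀ i < k, Associated (f.y i : OmegaImmAn p F) (g.y i)) ∧
      ∃ A B, f.IsTail k A ∧ g.IsTail k B ∧ Associated A B := by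
  induction k with
  | zero =>
    exact ⟨by simp, by simp, f.prod, g.prod, f.isTail_zero hx, g.isTail_zero hx,
      (associated_prod hx f g).map R.subtype⟩
  | succ k ih =>
    have hf : (k : ℕ∞) < f.N := lt_of_lt_of_le (by exact_mod_cast Nat.lt_succ_self k) hk
    obtain ⟨hg, hi, A, B, hA, hB, hAB⟩ := ih hf.le
    obtain ⟨hg, hle⟩ := hA.lt_N_and_slope_le hx hf hg hB hAB
    have hs := hle.antisymm (hB.lt_N_and_slope_le hx hg hf.le hA hAB.symm).2
    obtain ⟨A', hA', rfl⟩ := hA.exists_eq_mul hx hf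
    obtain ⟨B', hB', rfl⟩ := hB.exists_eq_mul hx hg
    have hy : Associated (f.y k : OmegaImmAn p F) (g.y k) := associated_of_dvd_dvd
      (hB'.dvd_of_associated_mul hf hs hAB) (hA'.dvd_of_associated_mul hg hs.symm hAB.symm)
    refine ⟨by exact_mod_cast Order.add_one_le_of_lt hg, fun i hik => ?_, A', B', hA', hB',
      hAB.of_mul_left hy (y_ne_zero hf)⟩
    rcases (Nat.lt_succ_iff.1 hik).eq_or_lt with rfl | h
    exacts [hy, hi i h]

theorem N_le (hx : x ≠ 0) (f g : SlopeFactorization R x) : f.N ≤ g.N :=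
  ENat.forall_natCast_le_iff_le.1 fun k hk => (exists_associated_isTail hx f g k hk).1

theorem unique_of_quotient_mem (hR : ∀ y ∈ R, ∀ u, y.coeff 0 ≠ 0 → u * y ∈ R → u ∈ R)
    (hx : x ≠ 0) (f g : SlopeFactorization R x) :
    f.j = g.j ∧ f.N = g.N ∧ ∀ i : ℕ, (i : ℕ∞) < f.N → Associated (f.y i) (g.y i) := by
  have hN : f.N = g.N := (N_le hx f g).antisymm (N_le hx g f)
  refine ⟨j_eq hx f g, hN, fun i hi => ?_⟩
  obtain ⟨v, hv⟩ := (exists_associated_isTail hx f g (i + 1)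
    (by exact_mod_cast Order.add_one_le_of_lt hi)).2.1 i (Nat.lt_succ_self i)
  have hvR : (v : OmegaImmAn p F) ∈ R := hR _ (f.y i).2 _ (f.isPure i hi).1 <| by
    rw [mul_comm, hv]
    exact (g.y i).2
  have hvR' : (↑v⁻¹ : OmegaImmAn p F) ∈ R := hR _ (g.y i).2 _ (g.isPure i (hN ▸ hi)).1 <| by
    rw [← hv, mul_comm, Units.mul_inv_cancel_right]
    exact (f.y i).2
  exact ⟨⟨⟨v, hvR⟩, ⟨_, hvR'⟩, Subtype.ext v.mul_inv, Subtype.ext v.inv_mul⟩, Subtype.ext hv⟩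

end SlopeFactorization

namespace OmegaImmAn

variable [IsDiscreteValuationRing 𝒪[F]]

theorem quotient_mem_of_forall_exists_norm_sub_le {R : Subring (OmegaImmAn p F)}
    (hconst : ∀ a : F, const a ∈ R)
    (hclosed : ∀ u : OmegaImmAn p F, (∀ j : ℚ, ∀ δ : ℝ, 0 < δ →
      ∃ v ∈ R, ∀ i < j, ‖u.coeff i - v.coeff i‖ ≤ δ) → u ∈ R)
    {y u : OmegaImmAn p F} (hy : y ∈ R) (hy0 : y.coeff 0 ≠ 0) (huy : u * y ∈ R) : u ∈ R := by
  obtain ⟨r, hr, hdom⟩ := ((eventually_gt_atTop 0).and (eventually_isDominant_zero hy0)).exists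
  set c := const (p := p) (y.coeff 0)⁻¹
  have hsub : ∀ n, c * (u * y) * ∑ k ∈ Finset.range n, (1 - c * y) ^ k - u =
      -u * (1 - c * y) ^ n := fun n => by
    rw [← mul_sum_one_sub_pow_sub (one_mul (u * (c * y))), one_mul, mul_left_comm]
  refine hclosed u fun j δ hδ => ?_
  have hP := prime_rpow_pos p (r * j)
  obtain ⟨n, hn⟩ := (((hdom.const_mul (inv_ne_zero hy0)).tendsto_w_mul_one_sub_pow hr
    (coeff_zero_const_inv_mul hy0) (-u)).eventually_le_const (div_pos hδ hP)).exists
  refine ⟨c * (u * y) * ∑ k ∈ Finset.range n, (1 - c * y) ^ k, mul_mem (mul_mem (hconst _) huy)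
    (sum_mem fun k _ => pow_mem (sub_mem (one_mem _) (mul_mem (hconst _) hy)) k), fun i hi => ?_⟩
  rw [norm_sub_rev, ← coeff_sub, hsub]
  have hi' : (i : ℝ) ≤ j := by exact_mod_cast hi.le
  calc ‖(-u * (1 - c * y) ^ n).coeff i‖
      ≤ δ / (p : ℝ) ^ (r * j) * (p : ℝ) ^ (r * i) :=
        weight_le_iff.1 ((weight_le_w hr _ i).trans hn)
    _ ≤ δ / (p : ℝ) ^ (r * j) * (p : ℝ) ^ (r * j) := by
        gcongr
        exact (one_lt_prime_cast p).le
    _ = δ := div_mul_cancel₀ _ hP.ne'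

end OmegaImmAn

theorem const_mem_omegaAn (a : F) : OmegaImmAn.const a ∈ OmegaAn p F := fun i hi =>
  ⟨0, by_contra fun h => hi (if_neg (by simpa [eq_comm] using h))⟩

theorem mem_omegaAn_of_forall_exists_norm_sub_le {u : OmegaImmAn p F}
    (h : ∀ j : ℚ, ∀ δ : ℝ, 0 < δ → ∃ v ∈ OmegaAn p F, ∀ i < j, ‖u.coeff i - v.coeff i‖ ≤ δ) :
    u ∈ OmegaAn p F := by
  intro i hi
  obtain ⟨v, hv, hvu⟩ := h (i + 1) _ (half_pos (norm_pos_iff.2 hi))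
  refine hv i fun h0 => (hvu i (lt_add_one i)).not_gt ?_
  rw [h0, sub_zero]
  exact half_lt_self (norm_pos_iff.2 hi)

end Uniqueness

/-! ### Reduction to Hahn series over the residue field -/

section Residue

variable {F : Type*} [NormedField F] [IsUltrametricDist F]

open Classical in
/-- Reduction modulo the maximal ideal of `𝒪[F]`, extended by zero to all of `F`. -/
noncomputable def red (a : F) : 𝓀[F] :=
  if h : ‖a‖ ≤ 1 then IsLocalRing.residue 𝒪[F] ⟨a, h⟩ else 0

theorem red_of_norm_le_one {a : F} (h : ‖a‖ ≤ 1) : red a = IsLocalRing.residue 𝒪[F] ⟨a, h⟩ :=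
  dif_pos h

theorem red_zero : red (0 : F) = 0 :=
  (red_of_norm_le_one (by simp)).trans (map_zero (IsLocalRing.residue 𝒪[F]))

theorem red_one : red (1 : F) = 1 :=
  (red_of_norm_le_one (by simp)).trans (map_one (IsLocalRing.residue 𝒪[F]))

theorem norm_add_le_one {a b : F} (ha : ‖a‖ ≤ 1) (hb : ‖b‖ ≤ 1) : ‖a + b‖ ≤ 1 :=
  add_mem (S := Subring F) (s := 𝒪[F]) ha hb

theorem norm_mul_le_one {a b : F} (ha : ‖a‖ ≤ 1) (hb : ‖b‖ ≤ 1) : ‖a * b‖ ≤ 1 :=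
  mul_mem (M := F) (s := 𝒪[F]) ha hb

theorem red_add {a b : F} (ha : ‖a‖ ≤ 1) (hb : ‖b‖ ≤ 1) : red (a + b) = red a + red b := by
  rw [red_of_norm_le_one ha, red_of_norm_le_one hb, red_of_norm_le_one (norm_add_le_one ha hb),
    ← map_add]
  rfl

theorem red_mul {a b : F} (ha : ‖a‖ ≤ 1) (hb : ‖b‖ ≤ 1) : red (a * b) = red a * red b := by
  rw [red_of_norm_le_one ha, red_of_norm_le_one hb, red_of_norm_le_one (norm_mul_le_one ha hb),
    ← map_mul]
  rfl

theorem red_eq_zero {a : F} (ha : ‖a‖ ≤ 1) : red a = 0 ↔ ‖a‖ < 1 := by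
  rw [red_of_norm_le_one ha, IsLocalRing.residue_eq_zero_iff, IsLocalRing.mem_maximalIdeal,
    mem_nonunits_iff, Valuation.Integer.not_isUnit_iff_valuation_lt_one]
  rfl

theorem red_sum {ι : Type*} (s : Finset ι) (f : ι → F) (h : ∀ i, ‖f i‖ ≤ 1) :
    red (∑ i ∈ s, f i) = ∑ i ∈ s, red (f i) := by
  classical
  induction s using Finset.induction_on with
  | empty => exact red_zero
  | insert a s ha ih =>
    rw [Finset.sum_insert ha, Finset.sum_insert ha, red_add (h a), ih]
    exact IsUltrametricDist.norm_sum_le_of_forall_le_of_nonneg zero_le_one fun i _ => h i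

theorem red_tsum [CompleteSpace F] {ι : Type*} {f : ι → F} (hs : Summable f)
    (h : ∀ i, ‖f i‖ ≤ 1) (S : Finset ι) (hS : ∀ i, red (f i) ≠ 0 → i ∈ S) :
    red (∑' i, f i) = ∑ i ∈ S, red (f i) := by
  classical
  have hfin : {i | ¬ ‖f i‖ < 1 / 2}.Finite := eventually_cofinite.1
    (hs.tendsto_cofinite_zero.norm.eventually_lt_const (by simp))
  let T := S ∪ hfin.toFinset
  have htail : ‖∑' i : ↑(↑T : Set ι)ᶜ, f i‖ ≤ 1 / 2 := by
    refine IsUltrametricDist.norm_tsum_le_of_forall_le_of_nonneg (by norm_num) fun i => ?_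
    by_contra hi
    exact i.2 (Finset.mem_union_right _ (hfin.mem_toFinset.2 fun hlt => hi hlt.le))
  have htail1 : ‖∑' i : ↑(↑T : Set ι)ᶜ, f i‖ < 1 := htail.trans_lt (by norm_num)
  rw [← hs.sum_add_tsum_compl (s := T), red_add _ htail1.le, (red_eq_zero htail1.le).2 htail1,
    add_zero, red_sum _ _ h]
  · exact (Finset.sum_subset Finset.subset_union_left fun i _ hi => not_not.1 (mt (hS i) hi)).symm
  · exact IsUltrametricDist.norm_sum_le_of_forall_le_of_nonneg zero_le_one fun i _ => h i

theorem exists_red_eq (c : 𝓀[F]) : ∃ a : F, ‖a‖ ≤ 1 ∧ red a = c ∧ (c = 0 → a = 0) := by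
  by_cases hc : c = 0
  · exact ⟨0, by simp, by rw [red_zero, hc], fun _ => rfl⟩
  · obtain ⟨⟨a, ha⟩, rfl⟩ := IsLocalRing.residue_surjective c
    exact ⟨a, ha, red_of_norm_le_one ha, fun h => absurd h hc⟩

end Residue

section Reduction

variable {F : Type*} [NormedField F] [IsUltrametricDist F] [CompleteSpace F]

namespace GammaImm

theorem coeff_zero (i : ℚ) : (0 : GammaImm F).coeff i = 0 := rfl

theorem coeff_one (i : ℚ) : (1 : GammaImm F).coeff i = if i = 0 then 1 else 0 := rfl

theorem coeff_add (x y : GammaImm F) (i : ℚ) : (x + y).coeff i = x.coeff i + y.coeff i := rfl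

theorem coeff_neg (x : GammaImm F) (i : ℚ) : (-x).coeff i = -x.coeff i := rfl

theorem coeff_sub (x y : GammaImm F) (i : ℚ) : (x - y).coeff i = x.coeff i - y.coeff i := by
  rw [sub_eq_add_neg, coeff_add, coeff_neg, sub_eq_add_neg]

theorem coeff_mul (x y : GammaImm F) : (x * y).coeff = conv x.coeff y.coeff := rfl

theorem coeff_sum {ι : Type*} (s : Finset ι) (f : ι → GammaImm F) (i : ℚ) :
    (∑ k ∈ s, f k).coeff i = ∑ k ∈ s, (f k).coeff i :=
  map_sum (⟨⟨fun x => x.coeff i, rfl⟩, fun _ _ => rfl⟩ : GammaImm F →+ F) f s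

/-- The monomial `a t^j`. -/
def monomial (j : ℚ) (a : F) : GammaImm F := ⟨mono j a, wo_mono j a, bdd_mono j a⟩

theorem coeff_monomial (j : ℚ) (a : F) (i : ℚ) :
    (monomial j a).coeff i = if i = j then a else 0 := rfl

theorem monomial_zero_one : monomial 0 (1 : F) = 1 := rfl

theorem coeff_monomial_mul (j : ℚ) (a : F) (x : GammaImm F) (i : ℚ) :
    (monomial j a * x).coeff i = a * x.coeff (i - j) := by
  change ∑' k, mono j a k * x.coeff (i - k) = _
  rw [tsum_eq_single j fun k hk => by simp [mono, hk]]
  simp [mono]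

theorem monomial_mul_monomial (i j : ℚ) (a b : F) :
    monomial i a * monomial j b = monomial (i + j) (a * b) := by
  refine ext (funext fun n => ?_)
  simp only [coeff_monomial_mul, coeff_monomial, sub_eq_iff_eq_add', mul_ite, mul_zero]

theorem monomial_pow (j : ℚ) (a : F) (n : ℕ) : monomial j a ^ n = monomial (n * j) (a ^ n) := by
  induction n with
  | zero => rw [pow_zero, pow_zero, Nat.cast_zero, zero_mul, monomial_zero_one]
  | succ n ih => rw [pow_succ, ih, monomial_mul_monomial, pow_succ, Nat.cast_succ, add_one_mul]

open Classical in
/-- The part of `x` supported on `T`. -/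
noncomputable def restrict (T : Set ℚ) (x : GammaImm F) : GammaImm F :=
  ⟨fun i => if i ∈ T then x.coeff i else 0, fun r hr => (x.2.1 r hr).mono fun i hi => by
    by_contra hi'
    simp_all [coeff, hr.not_gt, apply_ite], by
    obtain ⟨C, hC0, hC⟩ := Bdd.exists_pos x.2.2
    refine ⟨C, fun i => ?_⟩
    dsimp only
    split_ifs
    exacts [hC i, by simpa using hC0.le]⟩

open Classical in
theorem coeff_restrict (T : Set ℚ) (x : GammaImm F) (i : ℚ) :
    (restrict T x).coeff i = if i ∈ T then x.coeff i else 0 := rfl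

theorem exists_limit {u : ℕ → GammaImm F} {ε : ℕ → ℝ} (hε : Tendsto ε atTop (𝓝 0))
    (h : ∀ m n, m ≤ n → ∀ i, ‖(u m).coeff i - (u n).coeff i‖ ≤ ε m) :
    ∃ x : GammaImm F, ∀ n i, ‖(u n).coeff i - x.coeff i‖ ≤ ε n := by
  have hcauchy : ∀ i, CauchySeq fun n => (u n).coeff i := fun i =>
    cauchySeq_of_le_tendsto_0' ε (fun m n hmn => by simpa [dist_eq_norm] using h m n hmn i) hε
  choose x hx using fun i => cauchySeq_tendsto_of_complete (hcauchy i)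
  have happrox : ∀ n i, ‖(u n).coeff i - x i‖ ≤ ε n := fun n i =>
    le_of_tendsto ((tendsto_const_nhds.sub (hx i)).norm)
      ((eventually_ge_atTop n).mono fun m hm => h n m hm i)
  refine ⟨⟨x, woLevels_of_forall_exists_norm_sub_le fun ρ hρ m => ?_, ?_⟩, happrox⟩
  · obtain ⟨N, hN⟩ := (hε.eventually_le_const hρ).exists
    exact ⟨(u N).coeff, (u N).2.1, fun i _ => (happrox N i).trans hN⟩
  · obtain ⟨C, hC⟩ := (u 0).2.2
    refine ⟨max C (ε 0), fun i => ?_⟩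
    rw [← sub_sub_cancel ((u 0).coeff i) (x i)]
    exact (norm_sub_le_max _ _).trans (max_le_max (hC i) (happrox 0 i))

end GammaImm

/-- The ring `Γ^imm` of series in `Γ^imm[1/p]` with coefficients in `𝒪[F]`. -/
def GammaInt (F : Type*) [NormedField F] [IsUltrametricDist F] [CompleteSpace F] :
    Subring (GammaImm F) where
  carrier := {x | ∀ i, ‖x.coeff i‖ ≤ 1}
  zero_mem' i := by rw [GammaImm.coeff_zero]; simp
  one_mem' i := by
    rw [GammaImm.coeff_one]
    split_ifs <;> simp
  add_mem' hx hy i := norm_add_le_one (hx i) (hy i)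
  neg_mem' hx i := (norm_neg _).trans_le (hx i)
  mul_mem' hx hy _ := norm_conv_le fun i => mul_le_one₀ (hx i) (norm_nonneg _) (hy _)

/-- The Hahn series over the residue field obtained by reducing the coefficients of `x`. -/
noncomputable def toHahnFun (x : GammaInt F) : HahnSeries ℚ 𝓀[F] where
  coeff i := red (x.1.coeff i)
  isPWO_support' := by
    refine ((x.1.2.1 (1 / 2) (by norm_num)).mono fun i hi => ?_).isPWO
    by_contra h
    exact hi ((red_eq_zero (x.2 i)).2 ((not_lt.1 h).trans_lt (by norm_num)))

theorem toHahnFun_mul (x y : GammaInt F) : toHahnFun (x * y) = toHahnFun x * toHahnFun y := by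
  ext n
  let X := toHahnFun x
  let Y := toHahnFun y
  let A := Finset.antidiagonal X.isPWO_support Y.isPWO_support n
  have hred : ∀ i, red (x.1.coeff i * y.1.coeff (n - i)) = X.coeff i * Y.coeff (n - i) := fun i =>
    red_mul (x.2 i) (y.2 _)
  have hsub : ∀ q ∈ A, n - q.1 = q.2 := fun q hq =>
    sub_eq_of_eq_add' (Finset.mem_antidiagonal.1 hq).2.2.symm
  have hinj : Set.InjOn Prod.fst (A : Set (ℚ × ℚ)) := fun q hq q' hq' h =>
    Prod.ext h (by rw [← hsub q hq, ← hsub q' hq', h])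
  have hsupp : ∀ i, red (x.1.coeff i * y.1.coeff (n - i)) ≠ 0 → i ∈ A.image Prod.fst := by
    intro i hi
    rw [hred] at hi
    exact Finset.mem_image.2 ⟨(i, n - i), Finset.mem_antidiagonal.2
      ⟨left_ne_zero_of_mul hi, right_ne_zero_of_mul hi, add_sub_cancel i n⟩, rfl⟩
  calc red (∑' i, x.1.coeff i * y.1.coeff (n - i))
      = ∑ i ∈ A.image Prod.fst, red (x.1.coeff i * y.1.coeff (n - i)) :=
        red_tsum (summable_conv x.1.2.1 x.1.2.2 y.1.2.1 y.1.2.2 n)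
          (fun i => norm_mul_le_one (x.2 i) (y.2 _)) _ hsupp
    _ = ∑ q ∈ A, X.coeff q.1 * Y.coeff q.2 := by
        rw [Finset.sum_image hinj]
        exact Finset.sum_congr rfl fun q hq => by rw [hred, hsub q hq]
    _ = (X * Y).coeff n := HahnSeries.coeff_mul.symm

/-- Reduction of series with integral coefficients to Hahn series over the residue field. -/
noncomputable def toHahn (F : Type*) [NormedField F] [IsUltrametricDist F] [CompleteSpace F] :
    GammaInt F →+* HahnSeries ℚ 𝓀[F] where
  toFun := toHahnFun
  map_zero' := HahnSeries.ext (funext fun _ => red_zero)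
  map_one' := by
    ext i
    change red ((1 : GammaImm F).coeff i) = _
    rw [HahnSeries.coeff_one, GammaImm.coeff_one]
    split_ifs
    exacts [red_one, red_zero]
  map_add' x y := HahnSeries.ext (funext fun i => red_add (x.2 i) (y.2 i))
  map_mul' := toHahnFun_mul

theorem coeff_toHahn (x : GammaInt F) (i : ℚ) : (toHahn F x).coeff i = red (x.1.coeff i) := rfl

theorem toHahn_eq_zero {x : GammaInt F} : toHahn F x = 0 ↔ ∀ i, ‖x.1.coeff i‖ < 1 := by
  rw [HahnSeries.ext_iff, funext_iff]
  exact forall_congr' fun i => red_eq_zero (x.2 i)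

theorem toHahn_eq_toHahn {x y : GammaInt F} :
    toHahn F x = toHahn F y ↔ ∀ i, ‖x.1.coeff i - y.1.coeff i‖ < 1 := by
  rw [← sub_eq_zero, ← map_sub, toHahn_eq_zero]
  exact forall_congr' fun i => by rw [← GammaImm.coeff_sub]; rfl

theorem exists_toHahn_eq (f : HahnSeries ℚ 𝓀[F]) :
    ∃ x : GammaInt F, toHahn F x = f ∧ ∀ i, f.coeff i = 0 → x.1.coeff i = 0 := by
  choose s hs1 hsred hs0 using exists_red_eq (F := F)
  have hwo : WOLevels fun i => s (f.coeff i) := fun r hr => f.isWF_support.mono fun i hi h0 =>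
    (show r < ‖s (f.coeff i)‖ from hi).not_ge (by rw [hs0 _ h0, norm_zero]; exact hr.le)
  exact ⟨⟨⟨fun i => s (f.coeff i), hwo, 1, fun i => hs1 _⟩, fun i => hs1 _⟩,
    HahnSeries.ext (funext fun i => hsred _), fun i => hs0 _⟩

theorem toHahn_surjective : Function.Surjective (toHahn F) := fun f =>
  (exists_toHahn_eq f).imp fun _ h => h.1

namespace GammaInt

theorem monomial_mem (j : ℚ) {a : F} (ha : ‖a‖ ≤ 1) : GammaImm.monomial j a ∈ GammaInt F :=
  fun i => by
    rw [GammaImm.coeff_monomial]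
    split_ifs
    exacts [ha, by simp]

theorem coeff_sub (x y : GammaInt F) (i : ℚ) :
    (x - y).1.coeff i = x.1.coeff i - y.1.coeff i := GammaImm.coeff_sub _ _ i

theorem monomial_zero_dvd_iff {a : F} (ha : a ≠ 0) (ha1 : ‖a‖ ≤ 1) {x : GammaInt F} :
    ⟨GammaImm.monomial 0 a, monomial_mem 0 ha1⟩ ∣ x ↔ ∀ i, ‖x.1.coeff i‖ ≤ ‖a‖ := by
  constructor
  · rintro ⟨y, rfl⟩ i
    change ‖(GammaImm.monomial 0 a * y.1).coeff i‖ ≤ _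
    rw [GammaImm.coeff_monomial_mul, norm_mul]
    exact mul_le_of_le_one_right (norm_nonneg _) (y.2 _)
  · intro h
    refine ⟨⟨GammaImm.monomial 0 a⁻¹ * x.1, fun i => ?_⟩, Subtype.ext ?_⟩
    · rw [GammaImm.coeff_monomial_mul, norm_mul, norm_inv, sub_zero]
      exact inv_mul_le_one_of_le₀ (h i) (norm_nonneg _)
    · change _ = GammaImm.monomial 0 a * (GammaImm.monomial 0 a⁻¹ * x.1)
      rw [← mul_assoc, GammaImm.monomial_mul_monomial, add_zero, mul_inv_cancel₀ ha,
        GammaImm.monomial_zero_one, one_mul]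

variable [IsDiscreteValuationRing 𝒪[F]] {ϖ : 𝒪[F]}

theorem mem_ker_toHahn_pow (hϖ : Irreducible ϖ) {x : GammaInt F} {n : ℕ} :
    x ∈ RingHom.ker (toHahn F) ^ n ↔ ∀ i, ‖x.1.coeff i‖ ≤ ‖(ϖ : F)‖ ^ n := by
  have hϖ0 : (ϖ : F) ≠ 0 := norm_pos_iff.1 (norm_irreducible_pos hϖ)
  let M : GammaInt F := ⟨GammaImm.monomial 0 (ϖ : F), monomial_mem 0 ϖ.2⟩
  have hker : RingHom.ker (toHahn F) = Ideal.span {M} := by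
    ext y
    rw [RingHom.mem_ker, toHahn_eq_zero, Ideal.mem_span_singleton, monomial_zero_dvd_iff hϖ0 ϖ.2]
    exact forall_congr' fun i => ⟨norm_le_norm_irreducible hϖ,
      fun h => h.trans_lt (norm_irreducible_lt_one hϖ)⟩
  have hpow : M ^ n = ⟨GammaImm.monomial 0 ((ϖ : F) ^ n), monomial_mem 0 (ϖ ^ n : 𝒪[F]).2⟩ :=
    Subtype.ext ((GammaImm.monomial_pow _ _ _).trans (by rw [mul_zero]))
  rw [hker, Ideal.span_singleton_pow, Ideal.mem_span_singleton, hpow,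
    monomial_zero_dvd_iff (pow_ne_zero n hϖ0) (ϖ ^ n : 𝒪[F]).2, norm_pow]

theorem isAdicComplete : IsAdicComplete (RingHom.ker (toHahn F)) (GammaInt F) where
  haus' x hx := by
    obtain ⟨ϖ, hϖ⟩ := IsDiscreteValuationRing.exists_irreducible 𝒪[F]
    refine Subtype.ext (GammaImm.ext (funext fun i => eq_zero_of_forall_norm_le_pow hϖ fun n => ?_))
    have hn := hx n
    rw [SModEq.zero, smul_eq_mul, Ideal.mul_top, mem_ker_toHahn_pow hϖ] at hn
    exact hn i
  prec' u hu := by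
    obtain ⟨ϖ, hϖ⟩ := IsDiscreteValuationRing.exists_irreducible 𝒪[F]
    simp only [SModEq.sub_mem, smul_eq_mul, Ideal.mul_top, mem_ker_toHahn_pow hϖ, coeff_sub]
      at hu ⊢
    obtain ⟨x, hx⟩ := GammaImm.exists_limit (u := fun n => (u n).1)
      (tendsto_norm_irreducible_pow hϖ) fun m n hmn => hu hmn
    refine ⟨⟨x, fun i => ?_⟩, hx⟩
    rw [← sub_sub_cancel ((u 0).1.coeff i) (x.coeff i)]
    exact (norm_sub_le_max _ _).trans (max_le ((u 0).2 i) ((hx 0 i).trans (by simp)))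

theorem exists_isRoot {P : Polynomial (GammaInt F)} (hP : P.Monic)
    {f : HahnSeries ℚ 𝓀[F]} (hf : P.eval₂ (toHahn F) f = 0)
    (hf' : P.derivative.eval₂ (toHahn F) f ≠ 0) :
    ∃ b : GammaInt F, P.IsRoot b ∧ toHahn F b = f := by
  have := isAdicComplete (F := F)
  obtain ⟨a, rfl⟩ := toHahn_surjective f
  rw [Polynomial.eval₂_at_apply] at hf hf'
  obtain ⟨c, hc⟩ := toHahn_surjective (toHahn F (P.derivative.eval a))⁻¹
  obtain ⟨b, hb, hba⟩ := HenselianRing.is_henselian (I := RingHom.ker (toHahn F)) P hP a hf (by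
    refine IsUnit.of_mul_eq_one (Ideal.Quotient.mk _ c) ?_
    rw [← map_mul, ← map_one (Ideal.Quotient.mk _), Ideal.Quotient.eq, RingHom.mem_ker, map_sub,
      map_mul, hc, mul_inv_cancel₀ hf', map_one, sub_self])
  exact ⟨b, hb, (RingHom.sub_mem_ker_iff _).1 hba⟩

end GammaInt

end Reduction

/-! ### The Frobenius on Hahn series -/

section HahnFrobenius

theorem charP_hahnSeries (Γ k : Type*) [AddCommMonoid Γ] [PartialOrder Γ]
    [IsOrderedCancelAddMonoid Γ] [CommRing k] (p : ℕ) [CharP k p] : CharP (HahnSeries Γ k) p :=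
  charP_of_injective_ringHom (f := HahnSeries.C) HahnSeries.C_injective p

theorem support_pow_subset {Γ k : Type*} [AddCommMonoid Γ] [PartialOrder Γ]
    [IsOrderedCancelAddMonoid Γ] [CommSemiring k] {x : HahnSeries Γ k} {S : AddSubsemigroup Γ}
    (hx : x.support ⊆ S) {n : ℕ} (hn : n ≠ 0) : (x ^ n).support ⊆ S := by
  induction n, Nat.one_le_iff_ne_zero.2 hn using Nat.le_induction with
  | base => rwa [pow_one]
  | succ n h1 ih =>
    rw [pow_succ]
    refine HahnSeries.support_mul_subset.trans ?_
    rintro _ ⟨i, hi, j, hj, rfl⟩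
    exact S.add_mem (ih (Nat.one_le_iff_ne_zero.1 h1) hi) (hx hj)

variable {p : ℕ} [Fact p.Prime] {k : Type*}

section General

variable {Γ : Type*} [AddCommGroup Γ] [LinearOrder Γ] [IsOrderedAddMonoid Γ]
  [CommRing k] [CharP k p]

theorem coeff_zero_pow_char (x : HahnSeries Γ k) : (x ^ p).coeff 0 = x.coeff 0 ^ p := by
  classical
  have := charP_hahnSeries Γ k p
  have hp : p ≠ 0 := (Fact.out : p.Prime).ne_zero
  let y := HahnSeries.truncLT 0 x
  let z := x - y - HahnSeries.C (x.coeff 0)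
  have hz : ∀ i, z.coeff i = if 0 < i then x.coeff i else 0 := fun i => by
    rcases lt_trichotomy i 0 with hi | rfl | hi
    · simp [z, y, HahnSeries.C_apply, HahnSeries.coeff_single_of_ne hi.ne, hi, hi.not_gt]
    · simp [z, y]
    · simp [z, y, HahnSeries.C_apply, HahnSeries.coeff_single_of_ne hi.ne', hi, hi.not_gt]
  have hneg : (y ^ p).support ⊆ (⟨Set.Iio 0, add_neg⟩ : AddSubsemigroup Γ) :=
    support_pow_subset (fun i hi => by
      rw [HahnSeries.support_truncLT] at hi
      exact hi.2) hp
  have hpos : (z ^ p).support ⊆ (⟨Set.Ioi 0, add_pos⟩ : AddSubsemigroup Γ) :=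
    support_pow_subset (fun i hi => by
      rw [HahnSeries.mem_support, hz] at hi
      exact (ite_ne_right_iff.1 hi).1) hp
  have hy0 : (y ^ p).coeff 0 = 0 := not_not.1 fun h => lt_irrefl _ (hneg h)
  have hz0 : (z ^ p).coeff 0 = 0 := not_not.1 fun h => lt_irrefl _ (hpos h)
  have hx : x = y + HahnSeries.C (x.coeff 0) + z := by
    simp only [z]; abel
  have hxp : x ^ p = y ^ p + HahnSeries.C (x.coeff 0 ^ p) + z ^ p := by
    rw [map_pow, ← add_pow_char, ← add_pow_char, ← hx]
  rw [hxp, HahnSeries.coeff_add, HahnSeries.coeff_add, hy0, hz0, zero_add, add_zero,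
    HahnSeries.C_apply, HahnSeries.coeff_single_same]

theorem coeff_nsmul_pow_char (x : HahnSeries Γ k) (a : Γ) :
    (x ^ p).coeff (p • a) = x.coeff a ^ p := by
  have hshift : ∀ (y : HahnSeries Γ k) (b : Γ),
      (y * HahnSeries.single (-b) 1).coeff 0 = y.coeff b := fun y b => by
    simpa using HahnSeries.coeff_mul_single_add (x := y) (a := b) (b := -b) (r := 1)
  rw [← hshift x a, ← coeff_zero_pow_char, mul_pow, HahnSeries.single_pow, one_pow, smul_neg,
    hshift]

end General

theorem coeff_pow_char [CommRing k] [CharP k p] (x : HahnSeries ℚ k) (i : ℚ) :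
    (x ^ p).coeff i = x.coeff (i / p) ^ p := by
  rw [← coeff_nsmul_pow_char, nsmul_eq_mul,
    mul_div_cancel₀ i (Nat.cast_ne_zero.2 (Fact.out : p.Prime).ne_zero)]

theorem coeff_pow_char_pow [CommRing k] [CharP k p] (x : HahnSeries ℚ k) (n : ℕ) (i : ℚ) :
    (x ^ p ^ n).coeff i = x.coeff (i / p ^ n) ^ p ^ n := by
  induction n generalizing i with
  | zero => simp
  | succ n ih => rw [pow_succ, pow_mul, coeff_pow_char, ih, div_div, ← pow_mul, pow_succ' (p : ℚ)]

theorem exists_pow_char_eq [CommRing k] [CharP k p] [PerfectRing k p] (x : HahnSeries ℚ k) :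
    ∃ y, y ^ p = x := by
  let e : ℚ ≃o ℚ := OrderIso.divRight₀ (p : ℚ) (Nat.cast_pos.2 (Fact.out : p.Prime).pos)
  refine ⟨HahnSeries.embDomain e.toOrderEmbedding (x.map (frobeniusEquiv k p).symm), ?_⟩
  ext i
  rw [coeff_pow_char]
  change (HahnSeries.embDomain e.toOrderEmbedding _).coeff (e.toOrderEmbedding i) ^ p = _
  rw [HahnSeries.embDomain_coeff, HahnSeries.map_coeff]
  exact frobeniusEquiv_symm_pow_p _ _ _

variable [Field k]

theorem perfectField_hahnSeries [PerfectField k] [CharP k p] :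
    PerfectField (HahnSeries ℚ k) := by
  have := charP_hahnSeries ℚ k p
  have : ExpChar (HahnSeries ℚ k) p := .prime Fact.out
  have : ExpChar k p := .prime Fact.out
  have : PerfectRing (HahnSeries ℚ k) p := .ofSurjective _ p exists_pow_char_eq
  exact PerfectRing.toPerfectField _ p

/-- The field `k((t))` of Laurent series inside the field of Hahn series with rational
exponents. -/
noncomputable def laurentSubfield (k : Type*) [Field k] : Subfield (HahnSeries ℚ k) :=
  (HahnSeries.embDomainRingHom (Int.castAddHom ℚ) Int.cast_injective
    (fun _ _ => Int.cast_le) : HahnSeries ℤ k →+* HahnSeries ℚ k).fieldRange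

theorem mem_laurentSubfield_iff {f : HahnSeries ℚ k} :
    f ∈ laurentSubfield k ↔ ∀ i, f.coeff i ≠ 0 → ∃ m : ℤ, i = m := by
  constructor
  · rintro ⟨h, rfl⟩ i hi
    by_contra hne
    refine hi (HahnSeries.embDomain_of_notMem_range ?_)
    rintro ⟨m, rfl⟩
    exact hne ⟨m, rfl⟩
  · intro hf
    let g : ℤ ↪o ℚ := ⟨⟨Int.cast, Int.cast_injective⟩, Int.cast_le⟩
    have hpwo : {m : ℤ | f.coeff m ≠ 0}.IsPWO := by
      rw [Set.isPWO_iff_isWF, Set.isWF_iff_no_descending_seq]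
      exact fun u hu hmem => Set.isWF_iff_no_descending_seq.1 f.isWF_support
        (fun n => (u n : ℚ)) (fun a b hab => Int.cast_lt.2 (hu hab)) hmem
    refine ⟨⟨fun m => f.coeff m, hpwo⟩, ?_⟩
    ext i
    by_cases h : ∃ m : ℤ, i = m
    · obtain ⟨m, rfl⟩ := h
      exact HahnSeries.embDomain_coeff (f := g)
    · rw [not_not.1 (mt (hf i) h)]
      exact HahnSeries.embDomain_of_notMem_range fun ⟨m, hm⟩ => h ⟨m, hm.symm⟩

theorem exists_nat_mul_eq_intCast_of_mem_perfectClosure [CharP k p] {f : HahnSeries ℚ k}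
    (hf : f ∈ perfectClosure (laurentSubfield k) (HahnSeries ℚ k)) :
    ∃ q : ℕ, q ≠ 0 ∧ ∀ i, f.coeff i ≠ 0 → ∃ m : ℤ, i * q = m := by
  have := charP_hahnSeries ℚ k p
  have : CharP (laurentSubfield k) p :=
    (RingHom.charP_iff _ (laurentSubfield k).subtype_injective p).2 this
  have : ExpChar (laurentSubfield k) p := .prime Fact.out
  obtain ⟨n, ⟨y, hy⟩, rfl : (y : HahnSeries ℚ k) = f ^ p ^ n⟩ :=
    (mem_perfectClosure_iff_pow_mem p).1 hf
  have hp0 : ((p ^ n : ℕ) : ℚ) ≠ 0 :=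
    Nat.cast_ne_zero.2 (pow_ne_zero n (Fact.out : p.Prime).ne_zero)
  refine ⟨p ^ n, Nat.cast_ne_zero.1 hp0, fun i hi => mem_laurentSubfield_iff.1 hy _ ?_⟩
  rw [coeff_pow_char_pow, ← Nat.cast_pow, mul_div_cancel_right₀ i hp0]
  exact pow_ne_zero _ hi

end HahnFrobenius

/-! ### Integrality over Laurent series -/

section Integral

variable {F : Type*} [NormedField F] [IsUltrametricDist F] [CompleteSpace F]

theorem isIntegral_of_mem_gamma {x : GammaImm F} (hx : x ∈ Gamma F) : IsIntegral (Gamma F) x :=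
  isIntegral_algebraMap (R := Gamma F) (x := ⟨x, hx⟩)

theorem monomial_intCast_mem_gamma (m : ℤ) (a : F) : GammaImm.monomial m a ∈ Gamma F :=
  fun i hi => by
    rw [GammaImm.coeff_monomial, ite_ne_right_iff] at hi
    exact ⟨m, hi.1.symm⟩

theorem isIntegral_monomial (j : ℚ) (a : F) : IsIntegral (Gamma F) (GammaImm.monomial j a) := by
  refine IsIntegral.of_pow j.den_pos ?_
  rw [GammaImm.monomial_pow, mul_comm, Rat.mul_den_eq_num]
  exact isIntegral_of_mem_gamma (monomial_intCast_mem_gamma _ _)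

theorem isIntegral_of_support_sub {j : ℚ} {x : GammaImm F}
    (hx : ∀ i, x.coeff i ≠ 0 → ∃ m : ℤ, (m : ℚ) = i - j) : IsIntegral (Gamma F) x := by
  have hmul : x = GammaImm.monomial j 1 * (GammaImm.monomial (-j) 1 * x) := by
    rw [← mul_assoc, GammaImm.monomial_mul_monomial, add_neg_cancel, one_mul,
      GammaImm.monomial_zero_one, one_mul]
  rw [hmul]
  refine (isIntegral_monomial _ _).mul (isIntegral_of_mem_gamma fun i hi => ?_)
  rw [GammaImm.coeff_monomial_mul, one_mul, sub_neg_eq_add] at hi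
  simpa using hx _ hi

theorem isIntegral_of_support_mul_nat {q : ℕ} (hq : q ≠ 0) {x : GammaImm F}
    (hx : ∀ i, x.coeff i ≠ 0 → ∃ m : ℤ, i * q = m) : IsIntegral (Gamma F) x := by
  classical
  have : NeZero q := ⟨hq⟩
  have hq0 : (q : ℚ) ≠ 0 := Nat.cast_ne_zero.2 hq
  let φ : ℚ → ZMod q := fun i => (⌊i * q⌋ : ℤ)
  have hsum : x = ∑ a : ZMod q, GammaImm.restrict (φ ⁻¹' {a}) x := by
    refine GammaImm.ext (funext fun i => ?_)
    rw [GammaImm.coeff_sum, Finset.sum_eq_single (φ i), GammaImm.coeff_restrict]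
    · exact (if_pos rfl).symm
    · exact fun a _ ha => (GammaImm.coeff_restrict _ _ _).trans (if_neg fun h => ha h.symm)
    · exact fun h => absurd (Finset.mem_univ _) h
  rw [hsum]
  refine IsIntegral.sum _ fun a _ => isIntegral_of_support_sub (j := a.val / q) fun i hi => ?_
  rw [GammaImm.coeff_restrict, ite_ne_right_iff] at hi
  obtain ⟨hia, hi0⟩ := hi
  obtain ⟨m, hm⟩ := hx i hi0
  have hma : ((m - a.val : ℤ) : ZMod q) = 0 := by
    have : (m : ZMod q) = a := by
      rw [← Set.mem_singleton_iff.1 hia]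
      simp only [φ, hm, Int.floor_intCast]
    simp [this]
  obtain ⟨n, hn⟩ := (ZMod.intCast_zmod_eq_zero_iff_dvd _ _).1 hma
  refine ⟨n, ?_⟩
  rw [eq_sub_iff_add_eq, ← mul_left_inj' hq0, add_mul, div_mul_cancel₀ _ hq0, hm, mul_comm]
  exact_mod_cast (sub_eq_iff_eq_add.1 hn).symm

/-- The elements of `Γ^imm` that are integral over `Γ[1/p]`. -/
noncomputable def GammaInt.integralSubring (F : Type*) [NormedField F] [IsUltrametricDist F]
    [CompleteSpace F] : Subring (GammaInt F) :=
  (integralClosure (Gamma F) (GammaImm F)).toSubring.comap (GammaInt F).subtype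

theorem GammaInt.isIntegral_of_isRoot {Q : Polynomial (integralSubring F)} (hQ : Q.Monic)
    {b : GammaInt F} (hb : (Q.map (integralSubring F).subtype).IsRoot b) :
    IsIntegral (Gamma F) b.1 := by
  let A := integralClosure (Gamma F) (GammaImm F)
  let ψ : integralSubring F →+* A :=
    ((GammaInt F).subtype.comp (integralSubring F).subtype).codRestrict A fun x => x.2
  refine isIntegral_trans (A := A) b.1 ⟨Q.map ψ, hQ.map _, ?_⟩
  have h := congrArg (GammaInt F).subtype hb
  rw [Polynomial.eval_map, Polynomial.hom_eval₂, map_zero] at h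
  rw [Polynomial.eval₂_map]
  exact h

theorem mem_laurentSubfield_of_mem_gamma {x : GammaInt F} (hx : x.1 ∈ Gamma F) :
    toHahn F x ∈ laurentSubfield 𝓀[F] :=
  mem_laurentSubfield_iff.2 fun i hi => by
    obtain ⟨m, hm⟩ := hx i fun h => hi (by rw [coeff_toHahn, h, red_zero])
    exact ⟨m, hm.symm⟩

theorem isAlgebraic_toHahn_of_sum_eq_zero {x : GammaInt F} {d : ℕ → GammaInt F}
    (hd : ∀ n, (d n).1 ∈ Gamma F) {N : ℕ} (hsum : ∑ n ∈ Finset.range N, d n * x ^ n = 0)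
    {m : ℕ} (hm : m < N) (hm0 : toHahn F (d m) ≠ 0) :
    IsAlgebraic (laurentSubfield 𝓀[F]) (toHahn F x) := by
  let e : ℕ → laurentSubfield 𝓀[F] := fun n =>
    ⟨toHahn F (d n), mem_laurentSubfield_of_mem_gamma (hd n)⟩
  refine ⟨∑ n ∈ Finset.range N, Polynomial.monomial n (e n), fun h => hm0 ?_, ?_⟩
  · have hcoeff := congrArg (fun P => Polynomial.coeff P m) h
    simp only [Polynomial.finsetSum_coeff, Polynomial.coeff_monomial, Finset.sum_ite_eq',
      if_pos (Finset.mem_range.2 hm), Polynomial.coeff_zero] at hcoeff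
    exact congrArg Subtype.val hcoeff
  · have hred := congrArg (toHahn F) hsum
    simp only [map_sum, map_mul, map_pow, map_zero] at hred
    simp only [map_sum, Polynomial.aeval_monomial]
    exact hred

theorem exists_isIntegral_toHahn_eq_of_mem_perfectClosure (p : ℕ) [Fact p.Prime] [CharP 𝓀[F] p]
    {f : HahnSeries ℚ 𝓀[F]} (hf : f ∈ perfectClosure (laurentSubfield 𝓀[F]) (HahnSeries ℚ 𝓀[F])) :
    ∃ b : GammaInt F, IsIntegral (Gamma F) b.1 ∧ toHahn F b = f := by
  obtain ⟨q, hq, hfq⟩ := exists_nat_mul_eq_intCast_of_mem_perfectClosure (p := p) hf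
  obtain ⟨b, hb, hb0⟩ := exists_toHahn_eq f
  exact ⟨b, isIntegral_of_support_mul_nat hq fun i hi => hfq i (mt (hb0 i) hi), hb⟩

variable [IsDiscreteValuationRing 𝒪[F]]

theorem exists_isIntegral_toHahn_eq_of_isAlgebraic (p : ℕ) [Fact p.Prime] [CharP 𝓀[F] p]
    [PerfectField 𝓀[F]] {f : HahnSeries ℚ 𝓀[F]} (hf : IsAlgebraic (laurentSubfield 𝓀[F]) f) :
    ∃ b : GammaInt F, IsIntegral (Gamma F) b.1 ∧ toHahn F b = f := by
  have := perfectField_hahnSeries (p := p) (k := 𝓀[F])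
  let K := perfectClosure (laurentSubfield 𝓀[F]) (HahnSeries ℚ 𝓀[F])
  have hfK : IsIntegral K f := (hf.tower_top K).isIntegral
  have hsep : (minpoly K f).Separable :=
    PerfectField.separable_of_irreducible (minpoly.irreducible hfK)
  let m := (minpoly K f).map (algebraMap K (HahnSeries ℚ 𝓀[F]))
  have hroot : m.eval f = 0 := by rw [Polynomial.eval_map_algebraMap, minpoly.aeval]
  have hder : m.derivative.eval f ≠ 0 := by
    rw [Polynomial.derivative_map, Polynomial.eval_map_algebraMap]
    exact hsep.aeval_derivative_ne_zero (minpoly.aeval K f)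
  have hlift : m ∈ Polynomial.lifts
      ((toHahn F).comp (GammaInt.integralSubring F).subtype) := by
    refine (Polynomial.lifts_iff_coeff_lifts _).2 fun n => ?_
    rw [Polynomial.coeff_map]
    obtain ⟨b, hb, hbf⟩ := exists_isIntegral_toHahn_eq_of_mem_perfectClosure p
      ((minpoly K f).coeff n).2
    exact ⟨⟨b, hb⟩, hbf⟩
  obtain ⟨Q, hQ, -, hQm⟩ :=
    Polynomial.lifts_and_natDegree_eq_and_monic hlift ((minpoly.monic hfK).map _)
  have hQ' : (Q.map (GammaInt.integralSubring F).subtype).map (toHahn F) = m := by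
    rw [Polynomial.map_map, ← hQ]
  obtain ⟨b, hb, hbf⟩ := GammaInt.exists_isRoot (f := f) (hQm.map _)
    (by rw [← Polynomial.eval_map, hQ', hroot])
    (by rwa [← Polynomial.eval_map, ← Polynomial.derivative_map, hQ'])
  exact ⟨b, GammaInt.isIntegral_of_isRoot hQm hb, hbf⟩

theorem GammaImm.exists_forall_norm_coeff_le (x : GammaImm F) :
    ∃ i, ∀ j, ‖x.coeff j‖ ≤ ‖x.coeff i‖ := by
  by_cases hx : ∀ i, x.coeff i = 0
  · exact ⟨0, fun j => by rw [hx j, hx 0]⟩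
  push Not at hx
  obtain ⟨i₀, hi₀⟩ := hx
  obtain ⟨C, hC⟩ := x.2.2
  let S := (Set.range fun i => ‖x.coeff i‖) ∩ Set.Icc ‖x.coeff i₀‖ C
  have hS : S.Finite := (finite_norm_mem_Icc (norm_pos_iff.2 hi₀) C).subset
    (Set.inter_subset_inter_left _ (Set.range_comp_subset_range x.coeff norm))
  obtain ⟨_, ⟨⟨i, rfl⟩, hi⟩, hmax⟩ :=
    hS.exists_maximal ⟨_, ⟨i₀, rfl⟩, le_rfl, hC i₀⟩
  refine ⟨i, fun j => ?_⟩
  by_contra! hj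
  exact hj.not_ge (hmax ⟨⟨j, rfl⟩, hi.1.trans hj.le, hC j⟩ hj.le)

theorem isAlgebraic_toHahn_of_isIntegral {x : GammaInt F} (hx : IsIntegral (Gamma F) x.1) :
    IsAlgebraic (laurentSubfield 𝓀[F]) (toHahn F x) := by
  obtain ⟨P, hP, hPx⟩ := hx
  choose i hi using fun n => (P.coeff n).1.exists_forall_norm_coeff_le
  obtain ⟨m, hm, hmax⟩ := (Finset.range (P.natDegree + 1)).exists_max_image
    (fun n => ‖(P.coeff n).1.coeff (i n)‖) Finset.nonempty_range_add_one
  let a := (P.coeff m).1.coeff (i m)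
  have ha : a ≠ 0 := norm_pos_iff.1 <| zero_lt_one.trans_le <|
    calc (1 : ℝ) = ‖(P.coeff P.natDegree).1.coeff 0‖ := by
          rw [hP.coeff_natDegree]
          exact norm_one.symm
      _ ≤ ‖a‖ := (hi _ 0).trans (hmax _ (Finset.self_mem_range_succ _))
  have hle : ∀ n j, ‖(P.coeff n).1.coeff j‖ ≤ ‖a‖ := fun n j => by
    rcases Nat.lt_or_ge P.natDegree n with hn | hn
    · rw [Polynomial.coeff_eq_zero_of_natDegree_lt hn]
      exact norm_zero.trans_le (norm_nonneg a)
    · exact (hi n j).trans (hmax n (Finset.mem_range.2 (Nat.lt_succ_of_le hn)))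
  have hcoeff : ∀ n j, (GammaImm.monomial 0 a⁻¹ * (P.coeff n).1).coeff j =
      a⁻¹ * (P.coeff n).1.coeff j := fun n j => by rw [GammaImm.coeff_monomial_mul, sub_zero]
  let d : ℕ → GammaInt F := fun n => ⟨GammaImm.monomial 0 a⁻¹ * (P.coeff n).1, fun j => by
    rw [hcoeff, norm_mul, norm_inv]
    exact inv_mul_le_one_of_le₀ (hle n j) (norm_nonneg _)⟩
  have hd : ∀ n, (d n).1 ∈ Gamma F := fun n =>
    mul_mem (by exact_mod_cast monomial_intCast_mem_gamma 0 a⁻¹) (P.coeff n).2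
  refine isAlgebraic_toHahn_of_sum_eq_zero hd (Subtype.ext ?_) (Finset.mem_range.1 hm) fun h0 => ?_
  · rw [Polynomial.eval₂_eq_sum_range] at hPx
    rw [AddSubmonoidClass.coe_finsetSum]
    calc ∑ n ∈ Finset.range (P.natDegree + 1), GammaImm.monomial 0 a⁻¹ * (P.coeff n).1 * x.1 ^ n
        = GammaImm.monomial 0 a⁻¹ * ∑ n ∈ Finset.range (P.natDegree + 1),
            (P.coeff n).1 * x.1 ^ n := by simp only [Finset.mul_sum, mul_assoc]
      _ = 0 := (congrArg _ hPx).trans (mul_zero _)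
  · have hlt := toHahn_eq_zero.1 h0 (i m)
    rw [show (d m).1.coeff (i m) = a⁻¹ * a from hcoeff m (i m), inv_mul_cancel₀ ha,
      norm_one] at hlt
    exact lt_irrefl _ hlt

theorem isAlgebraic_toHahn_of_mem_gammaAlg {x : GammaInt F} (hx : x.1 ∈ GammaAlg F) :
    IsAlgebraic (laurentSubfield 𝓀[F]) (toHahn F x) := by
  obtain ⟨z, hz, hxz⟩ := hx (1 / 2) (by norm_num)
  have hz1 : z ∈ GammaInt F := fun i => by
    rw [← sub_sub_cancel (x.1.coeff i) (z.coeff i)]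
    exact (norm_sub_le_max _ _).trans (max_le (x.2 i) ((hxz i).trans (by norm_num)))
  have heq : toHahn F x = toHahn F ⟨z, hz1⟩ :=
    toHahn_eq_toHahn.2 fun i => (hxz i).trans_lt (by norm_num)
  rw [heq]
  exact isAlgebraic_toHahn_of_isIntegral hz

end Integral

/-! ### Approximation in the ring of algebraic series -/

section Approximation

variable {F : Type*} [NormedField F] [IsUltrametricDist F] [CompleteSpace F]

theorem mem_gammaAlg_of_isIntegral {x : GammaImm F} (hx : IsIntegral (Gamma F) x) :
    x ∈ GammaAlg F := fun ε hε => ⟨x, hx, fun i => by simpa using hε.le⟩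

theorem monomial_mem_gammaAlg (j : ℚ) (a : F) : GammaImm.monomial j a ∈ GammaAlg F :=
  mem_gammaAlg_of_isIntegral (isIntegral_monomial j a)

theorem mem_gammaAlg_of_tendsto {u : ℕ → GammaImm F} {x : GammaImm F} {ε : ℕ → ℝ}
    (hε : Tendsto ε atTop (𝓝 0)) (hu : ∀ n, u n ∈ GammaAlg F)
    (h : ∀ n i, ‖(u n).coeff i - x.coeff i‖ ≤ ε n) : x ∈ GammaAlg F := by
  intro δ hδ
  obtain ⟨n, hn⟩ := (hε.eventually_le_const hδ).exists
  obtain ⟨z, hz, huz⟩ := hu n δ hδ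
  refine ⟨z, hz, fun i => ?_⟩
  rw [← sub_sub_sub_cancel_left (z.coeff i) (x.coeff i) ((u n).coeff i)]
  exact (norm_sub_le_max _ _).trans (max_le (huz i) ((h n i).trans hn))

theorem GammaImm.coeff_pow_of_neg {x : GammaImm F} (hx : ∀ i < 0, x.coeff i = 0) (n : ℕ) :
    ∀ i < 0, (x ^ n).coeff i = 0 := by
  induction n with
  | zero => exact fun i hi => by rw [pow_zero, coeff_one, if_neg hi.ne]
  | succ n ih => exact fun i hi => by rw [pow_succ, coeff_mul, conv_supp ih hx i hi]

theorem const_mem_omegaAlgAn {p : ℕ} [Fact p.Prime] (a : F) :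
    OmegaImmAn.const a ∈ OmegaAlgAn p F := fun _ =>
  ⟨GammaImm.monomial 0 a, monomial_mem_gammaAlg 0 a, fun _ hi => if_neg hi.ne, fun _ _ => rfl⟩

variable [IsDiscreteValuationRing 𝒪[F]] {ϖ : 𝒪[F]}

theorem exists_norm_sub_pow_char_pow_le (p : ℕ) [Fact p.Prime] [CharP 𝓀[F] p]
    (hϖ : Irreducible ϖ) {g : ℕ → HahnSeries ℚ 𝓀[F]} (hg : ∀ n, g (n + 1) ^ p = g n) :
    ∃ x : GammaInt F, ∀ n (y : GammaInt F), toHahn F y = g n →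
      ∀ i, ‖x.1.coeff i - (y.1 ^ p ^ n).coeff i‖ ≤ ‖(ϖ : F)‖ ^ (n + 1) := by
  have := GammaInt.isAdicComplete (F := F)
  have := charP_hahnSeries ℚ 𝓀[F] p
  have : CharP (GammaInt F ⧸ RingHom.ker (toHahn F)) p :=
    (RingHom.charP_iff _ (RingHom.kerLift_injective (toHahn F)) p).2 this
  let e := RingHom.quotientKerEquivOfSurjective (toHahn_surjective (F := F))
  let z : Perfection (GammaInt F ⧸ RingHom.ker (toHahn F)) p :=
    ⟨fun n => e.symm (g n), fun n => by rw [← map_pow, hg]⟩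
  refine ⟨Perfection.teichmuller p _ z, fun n y hy => ?_⟩
  have hmod := Perfection.teichmuller_sModEq (x := z) (y := y) (n := n)
    (e.symm_apply_eq.2 hy.symm).symm
  rw [SModEq.sub_mem, GammaInt.mem_ker_toHahn_pow hϖ] at hmod
  exact fun i => (congrArg norm (GammaInt.coeff_sub _ _ i)).symm.trans_le (hmod i)

variable (p : ℕ) [Fact p.Prime] [CharP 𝓀[F] p] [PerfectField 𝓀[F]]
include p

theorem exists_gammaAlg_toHahn_eq {f : HahnSeries ℚ 𝓀[F]}
    (hf : IsAlgebraic (laurentSubfield 𝓀[F]) f) (hf0 : ∀ i < 0, f.coeff i = 0) :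
    ∃ x : GammaInt F, x.1 ∈ GammaAlg F ∧ toHahn F x = f ∧ ∀ i < 0, x.1.coeff i = 0 := by
  obtain ⟨ϖ, hϖ⟩ := IsDiscreteValuationRing.exists_irreducible 𝒪[F]
  have : ExpChar 𝓀[F] p := .prime Fact.out
  have hp0 : ∀ n, p ^ n ≠ 0 := fun n => pow_ne_zero n (Fact.out : p.Prime).ne_zero
  choose root hroot using exists_pow_char_eq (p := p) (k := 𝓀[F])
  let g : ℕ → HahnSeries ℚ 𝓀[F] := fun n => root^[n] f
  have hg : ∀ n, g (n + 1) ^ p = g n := fun n => by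
    rw [show g (n + 1) = root (g n) from Function.iterate_succ_apply' _ _ _, hroot]
  have hgf : ∀ n, g n ^ p ^ n = f := fun n => by
    induction n with
    | zero => exact pow_one f
    | succ n ih => rw [pow_succ', pow_mul, hg, ih]
  have hg0 : ∀ n, ∀ i < 0, (g n).coeff i = 0 := fun n i hi => by
    have hq : (0 : ℚ) < p ^ n := by exact_mod_cast Nat.pos_of_ne_zero (hp0 n)
    have h := coeff_pow_char_pow (g n) n (i * p ^ n)
    rw [hgf, hf0 _ (mul_neg_of_neg_of_pos hi hq), mul_div_cancel_right₀ i hq.ne'] at h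
    exact pow_eq_zero_iff (hp0 n) |>.1 h.symm
  obtain ⟨x, hx⟩ := exists_norm_sub_pow_char_pow_le p hϖ hg
  choose b hbi hb using fun n => exists_isIntegral_toHahn_eq_of_isAlgebraic p
    (f := g n) (IsAlgebraic.of_pow (Nat.pos_of_ne_zero (hp0 n)) (by rwa [hgf]))
  have hlt := norm_irreducible_lt_one hϖ
  refine ⟨x, mem_gammaAlg_of_tendsto
    ((tendsto_add_atTop_iff_nat 1).2 (tendsto_norm_irreducible_pow hϖ))
    (fun n => mem_gammaAlg_of_isIntegral ((hbi n).pow (p ^ n)))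
    (fun n i => (norm_sub_rev _ _).trans_le (hx n (b n) (hb n) i)), ?_, fun i hi => ?_⟩
  · rw [show f = toHahn F (b 0) from (hb 0).symm, toHahn_eq_toHahn]
    intro i
    simpa using (hx 0 (b 0) (hb 0) i).trans_lt (by simpa using hlt)
  · refine eq_zero_of_forall_norm_le_pow hϖ fun n => ?_
    obtain ⟨y, hy, hy0⟩ := exists_toHahn_eq (g n)
    have h := hx n y hy i
    rw [GammaImm.coeff_pow_of_neg (fun i hi => hy0 i (hg0 n i hi)) _ i hi, sub_zero] at h
    exact h.trans (pow_le_pow_of_le_one (norm_nonneg _) hlt.le n.le_succ)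

theorem exists_gammaAlg_norm_sub_lt {x : GammaImm F} (hx : x ∈ GammaAlg F) {c : F} (hc : c ≠ 0)
    (hxc : ∀ i, ‖x.coeff i‖ ≤ ‖c‖) {J : ℚ} (hxJ : ∀ i < J, ‖x.coeff i‖ < ‖c‖) :
    ∃ t ∈ GammaAlg F, (∀ i < J, t.coeff i = 0) ∧ ∀ i, ‖x.coeff i - t.coeff i‖ < ‖c‖ := by
  have hc0 : 0 < ‖c‖ := norm_pos_iff.2 hc
  have hcoeff : ∀ i, (GammaImm.monomial (-J) c⁻¹ * x).coeff i = c⁻¹ * x.coeff (i + J) :=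
    fun i => by rw [GammaImm.coeff_monomial_mul, sub_neg_eq_add]
  let y : GammaInt F := ⟨GammaImm.monomial (-J) c⁻¹ * x, fun i => by
    rw [hcoeff, norm_mul, norm_inv]
    exact inv_mul_le_one_of_le₀ (hxc _) hc0.le⟩
  have hy : y.1 ∈ GammaAlg F := mul_mem (monomial_mem_gammaAlg _ _) hx
  obtain ⟨t, ht, hty, ht0⟩ := exists_gammaAlg_toHahn_eq p
    (isAlgebraic_toHahn_of_mem_gammaAlg hy) fun i hi => by
      rw [coeff_toHahn, red_eq_zero (y.2 i), hcoeff, norm_mul, norm_inv, inv_mul_lt_one₀ hc0]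
      exact hxJ _ (by linarith)
  refine ⟨GammaImm.monomial J c * t.1, mul_mem (monomial_mem_gammaAlg _ _) ht, fun i hi => ?_,
    fun i => ?_⟩
  · rw [GammaImm.coeff_monomial_mul, ht0 _ (sub_neg.2 hi), mul_zero]
  · have h := toHahn_eq_toHahn.1 hty (i - J)
    have hscale : x.coeff i - c * t.1.coeff (i - J) =
        c * (y.1.coeff (i - J) - t.1.coeff (i - J)) := by
      rw [hcoeff, sub_add_cancel, mul_sub, mul_inv_cancel_left₀ hc]
    rw [GammaImm.coeff_monomial_mul, hscale, norm_mul]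
    rw [norm_sub_rev] at h
    exact mul_lt_of_lt_one_right hc0 h

theorem exists_gammaAlg_norm_sub_le {x : GammaImm F} (hx : x ∈ GammaAlg F) {c : F} (hc : c ≠ 0)
    {J : ℚ} (hxJ : ∀ i < J, ‖x.coeff i‖ ≤ ‖c‖) :
    ∃ t ∈ GammaAlg F, (∀ i < J, t.coeff i = 0) ∧ ∀ i, ‖x.coeff i - t.coeff i‖ ≤ ‖c‖ := by
  obtain ⟨ϖ, hϖ⟩ := IsDiscreteValuationRing.exists_irreducible 𝒪[F]
  have h0 := norm_irreducible_pos hϖ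
  have h1 := norm_irreducible_lt_one hϖ
  obtain ⟨M, hM⟩ : ∃ M : ℕ, ∀ i, ‖x.coeff i‖ * ‖(ϖ : F)‖ ^ M ≤ ‖c‖ := by
    obtain ⟨C, hC0, hC⟩ := Bdd.exists_pos x.2.2
    obtain ⟨M, hM⟩ := exists_pow_lt_of_lt_one (div_pos (norm_pos_iff.2 hc) hC0) h1
    refine ⟨M, fun i => (mul_le_mul_of_nonneg_right (hC i) (pow_nonneg h0.le M)).trans ?_⟩
    rw [mul_comm]
    exact ((lt_div_iff₀ hC0).1 hM).le
  induction M generalizing x with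
  | zero => exact ⟨0, zero_mem _, fun _ _ => rfl, fun i => by
      simpa [GammaImm.coeff_zero] using hM i⟩
  | succ M ih =>
    let c' : F := c / (ϖ : F) ^ (M + 1)
    have hc' : c' ≠ 0 := div_ne_zero hc (pow_ne_zero _ (norm_pos_iff.1 h0))
    have hnorm : ‖c'‖ = ‖c‖ / ‖(ϖ : F)‖ ^ (M + 1) := by rw [norm_div, norm_pow]
    have hcc' : ‖c‖ < ‖c'‖ := by
      rw [hnorm, lt_div_iff₀ (pow_pos h0 _)]
      exact mul_lt_of_lt_one_right (norm_pos_iff.2 hc) (pow_lt_one₀ h0.le h1 M.succ_ne_zero)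
    obtain ⟨t, ht, htJ, hxt⟩ := exists_gammaAlg_norm_sub_lt p hx hc'
      (fun i => by rw [hnorm, le_div_iff₀ (pow_pos h0 _)]; exact hM i)
      fun i hi => (hxJ i hi).trans_lt hcc'
    obtain ⟨t', ht', ht'J, hxt'⟩ := ih (sub_mem hx ht)
      (fun i hi => by rw [GammaImm.coeff_sub, htJ i hi, sub_zero]; exact hxJ i hi) fun i => by
        have hquot : ‖(x.coeff i - t.coeff i) / c'‖ < 1 := by
          rw [norm_div, div_lt_one (norm_pos_iff.2 hc')]
          exact hxt i
        have h := norm_le_norm_irreducible hϖ hquot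
        rw [norm_div, div_le_iff₀ (norm_pos_iff.2 hc'), hnorm, pow_succ', mul_div_assoc',
          mul_div_mul_left _ _ h0.ne', le_div_iff₀ (pow_pos h0 _)] at h
        rwa [GammaImm.coeff_sub]
    refine ⟨t + t', add_mem ht ht', fun i hi => ?_, fun i => ?_⟩
    · rw [GammaImm.coeff_add, htJ i hi, ht'J i hi, add_zero]
    · rw [GammaImm.coeff_add, ← sub_sub, ← GammaImm.coeff_sub]
      exact hxt' i

theorem exists_gammaAlg_coeff_eq (hϖ : Irreducible ϖ) {J : ℚ} {u : ℚ → F}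
    (hu : ∀ n : ℕ, ∃ a ∈ GammaAlg F, ∀ i < J, ‖u i - a.coeff i‖ ≤ ‖(ϖ : F)‖ ^ n) :
    ∃ y ∈ GammaAlg F, ∀ i < J, y.coeff i = u i := by
  have hanti : Antitone fun n : ℕ => ‖(ϖ : F)‖ ^ n :=
    pow_right_anti₀ (norm_nonneg _) (norm_irreducible_lt_one hϖ).le
  choose a ha hua using hu
  have hstep : ∀ n, ∃ t ∈ GammaAlg F, (∀ i < J, t.coeff i = 0) ∧
      ∀ i, ‖(a n).coeff i - (a (n + 1)).coeff i - t.coeff i‖ ≤ ‖(ϖ : F)‖ ^ n := fun n => by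
    simp only [← GammaImm.coeff_sub (a n), ← norm_pow]
    refine exists_gammaAlg_norm_sub_le p (sub_mem (ha n) (ha (n + 1)))
      (pow_ne_zero n (norm_pos_iff.1 (norm_irreducible_pos hϖ))) fun i hi => ?_
    rw [GammaImm.coeff_sub, ← sub_sub_sub_cancel_left _ _ (u i), norm_pow]
    exact (norm_sub_le_max _ _).trans (max_le ((hua _ i hi).trans (hanti n.le_succ)) (hua n i hi))
  choose t ht htJ hat using hstep
  let s : ℕ → GammaImm F := fun n => a n + ∑ m ∈ Finset.range n, t m
  have hsJ : ∀ n, ∀ i < J, (s n).coeff i = (a n).coeff i := fun n i hi => by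
    rw [GammaImm.coeff_add, GammaImm.coeff_sum, Finset.sum_eq_zero fun m _ => htJ m i hi, add_zero]
  have hsub : ∀ n i, (s n).coeff i - (s (n + 1)).coeff i =
      (a n).coeff i - (a (n + 1)).coeff i - (t n).coeff i := fun n i => by
    simp only [s, GammaImm.coeff_add, Finset.sum_range_succ]
    abel
  obtain ⟨y, hy⟩ := GammaImm.exists_limit (tendsto_norm_irreducible_pow hϖ) fun m n hmn i =>
    norm_sub_le_of_antitone hanti (fun n => (congrArg norm (hsub n i)).trans_le (hat n i)) hmn
  refine ⟨y, mem_gammaAlg_of_tendsto (tendsto_norm_irreducible_pow hϖ)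
    (fun n => add_mem (ha n) (sum_mem fun m _ => ht m)) hy, fun i hi => ?_⟩
  refine sub_eq_zero.1 (eq_zero_of_forall_norm_le_pow hϖ fun n => ?_)
  rw [← sub_sub_sub_cancel_left (u i) (y.coeff i) ((a n).coeff i)]
  exact (norm_sub_le_max _ _).trans
    (max_le ((norm_sub_rev _ _).trans_le (hua n i hi)) (hsJ n i hi ▸ hy n i))

theorem mem_omegaAlgAn_of_forall_exists_norm_sub_le {u : OmegaImmAn p F}
    (hu : ∀ j : ℚ, ∀ δ : ℝ, 0 < δ →
      ∃ v ∈ OmegaAlgAn p F, ∀ i < j, ‖u.coeff i - v.coeff i‖ ≤ δ) : u ∈ OmegaAlgAn p F := by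
  obtain ⟨ϖ, hϖ⟩ := IsDiscreteValuationRing.exists_irreducible 𝒪[F]
  intro j
  obtain ⟨y, hy, hyu⟩ := exists_gammaAlg_coeff_eq p hϖ (J := max j 0) (u := u.coeff) fun n => by
    obtain ⟨v, hv, huv⟩ := hu (max j 0) _ (pow_pos (norm_irreducible_pos hϖ) n)
    obtain ⟨a, ha, -, hav⟩ := hv (max j 0)
    exact ⟨a, ha, fun i hi => by rw [hav i hi]; exact huv i hi⟩
  exact ⟨y, hy, fun i hi => (hyu i (lt_max_of_lt_right hi)).trans (OmegaImmAn.coeff_of_neg u hi),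
    fun i hi => hyu i (lt_max_of_lt_left hi)⟩

end Approximation

/-! ### Fraction fields of finite extensions of the Witt vectors -/

section WittVectors

theorem charP_residueField {p : ℕ} [Fact p.Prime] {F : Type*} [NormedField F]
    [IsUltrametricDist F] (hp : ‖(p : F)‖ < 1) : CharP 𝓀[F] p := by
  rw [CharP.charP_iff_prime_eq_zero Fact.out, ← (red_eq_zero hp.le).2 hp, red_of_norm_le_one hp.le,
    ← map_natCast (IsLocalRing.residue 𝒪[F])]
  rfl

section DiscreteValuationRing

variable {O : Type*} [CommRing O] [IsDomain O] [IsDiscreteValuationRing O]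
  {F : Type*} [NormedField F] [Algebra O F]

theorem norm_algebraMap_lt_one_of_not_isUnit (hO : ∀ a : O, ‖algebraMap O F a‖ ≤ 1) {q : O}
    (hq : q ≠ 0) (hq1 : ‖algebraMap O F q‖ < 1) {c : O} (hc : ¬IsUnit c) :
    ‖algebraMap O F c‖ < 1 := by
  obtain ⟨ϖ, hϖ⟩ := IsDiscreteValuationRing.exists_irreducible O
  obtain ⟨n, hn⟩ := IsDiscreteValuationRing.associated_pow_irreducible hq hϖ
  have hϖc : ϖ ∣ c := by
    rwa [← Ideal.mem_span_singleton, ← hϖ.maximalIdeal_eq, IsLocalRing.mem_maximalIdeal]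
  obtain ⟨d, hd⟩ := hn.dvd.trans (pow_dvd_pow_of_dvd hϖc n)
  refine lt_of_not_ge fun h => (one_le_pow₀ h (n := n)).not_gt ?_
  rw [← norm_pow, ← map_pow, hd, map_mul, norm_mul]
  exact mul_lt_one_of_nonneg_of_lt_one_left (norm_nonneg _) hq1 (hO d)

variable [IsFractionRing O F]

theorem exists_algebraMap_eq_of_norm_le_one (hO : ∀ a : O, ‖algebraMap O F a‖ ≤ 1) {q : O}
    (hq : q ≠ 0) (hq1 : ‖algebraMap O F q‖ < 1) {a : F} (ha : ‖a‖ ≤ 1) :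
    ∃ b : O, algebraMap O F b = a := by
  rcases ValuationRing.isInteger_or_isInteger O a with h | ⟨b, hb⟩
  · exact h
  rcases eq_or_ne a 0 with rfl | ha0
  · exact ⟨0, map_zero _⟩
  obtain ⟨u, rfl⟩ : IsUnit b := by
    by_contra hbu
    have hlt := norm_algebraMap_lt_one_of_not_isUnit hO hq hq1 hbu
    rw [hb, norm_inv, inv_lt_one₀ (norm_pos_iff.2 ha0)] at hlt
    exact hlt.not_ge ha
  exact ⟨↑u⁻¹, by rw [← inv_inv a, ← hb, map_units_inv]⟩

variable [IsUltrametricDist F]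

/-- The valuation ring of a norm on the fraction field of a discrete valuation ring `O`, identified
with `O` when the norm is at most `1` on `O` and nontrivial. -/
noncomputable def integerEquiv (hO : ∀ a : O, ‖algebraMap O F a‖ ≤ 1) {q : O} (hq : q ≠ 0)
    (hq1 : ‖algebraMap O F q‖ < 1) : O ≃+* 𝒪[F] :=
  RingEquiv.ofBijective ((algebraMap O F).codRestrict 𝒪[F] hO)
    ⟨fun _ _ h => IsFractionRing.injective O F (congrArg Subtype.val h), fun a =>
      (exists_algebraMap_eq_of_norm_le_one hO hq hq1 a.2).imp fun _ => Subtype.ext⟩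

theorem isDiscreteValuationRing_integer (hO : ∀ a : O, ‖algebraMap O F a‖ ≤ 1) {q : O}
    (hq : q ≠ 0) (hq1 : ‖algebraMap O F q‖ < 1) : IsDiscreteValuationRing 𝒪[F] :=
  IsDiscreteValuationRing.RingEquivClass.isDiscreteValuationRing (integerEquiv hO hq hq1)

end DiscreteValuationRing

theorem perfectField_of_isIntegral_wittVector {p : ℕ} [Fact p.Prime] {k κ : Type*} [Field k]
    [CharP k p] [PerfectField k] [Field κ] [CharP κ p] {η : WittVector p k →+* κ}
    (hη : η.IsIntegral) : PerfectField κ := by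
  have hker : RingHom.ker (WittVector.constantCoeff : WittVector p k →+* k) ≤ RingHom.ker η := by
    rw [WittVector.ker_constantCoeff, Ideal.span_le, Set.singleton_subset_iff]
    exact (map_natCast η p).trans (CharP.cast_eq_zero κ p)
  let ηk : k →+* κ := RingHom.liftOfSurjective _ (WittVector.constantCoeff_surjective p) ⟨η, hker⟩
  have hηk : ηk.comp WittVector.constantCoeff = η := RingHom.liftOfRightInverse_comp _ _ _ _
  let : Algebra k κ := ηk.toAlgebra
  have : Algebra.IsIntegral k κ :=
    ⟨RingHom.IsIntegral.tower_top WittVector.constantCoeff ηk (hηk ▸ hη)⟩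
  exact Algebra.IsAlgebraic.perfectField k

theorem perfectField_residueField {p : ℕ} [Fact p.Prime] {k : Type*} [Field k] [CharP k p]
    [PerfectField k] {O : Type*} [CommRing O] [IsDomain O] [IsDiscreteValuationRing O]
    [Algebra (WittVector p k) O] [Algebra.IsIntegral (WittVector p k) O] {F : Type*} [NormedField F]
    [IsUltrametricDist F] [Algebra O F] [IsFractionRing O F] (hO : ∀ a : O, ‖algebraMap O F a‖ ≤ 1)
    (hp0 : (p : O) ≠ 0) (hp1 : ‖(p : F)‖ < 1) : PerfectField 𝓀[F] := by
  have := charP_residueField hp1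
  let e := integerEquiv hO hp0 (by rwa [map_natCast])
  have hsurj : Function.Surjective ((IsLocalRing.residue 𝒪[F]).comp (e : O →+* 𝒪[F])) :=
    IsLocalRing.residue_surjective.comp e.surjective
  exact perfectField_of_isIntegral_wittVector (RingHom.IsIntegral.trans
    (algebraMap (WittVector p k) O) _ (algebraMap_isIntegral_iff.2 ‹_›)
    (RingHom.isIntegral_of_surjective _ hsurj))

end WittVectors

end AnRing

open scoped NormedField Valued in
theorem mainTheorem5_general {p : ℕ} [Fact p.Prime] {F : Type*} [NormedField F]
    [IsUltrametricDist F] [CompleteSpace F] [IsDiscreteValuationRing 𝒪[F]] [PerfectField 𝓀[F]]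
    (hp : ‖(p : F)‖ < 1) {R : Subring (AnRing.OmegaImmAn p F)}
    (hR : R = AnRing.OmegaAn p F ∨ R = AnRing.OmegaAlgAn p F ∨ R = ⊤)
    {x : R} (hx : x ≠ 0) (f g : AnRing.SlopeFactorization R x) :
    f.j = g.j ∧ f.N = g.N ∧ ∀ i : ℕ, (i : ℕ∞) < f.N → Associated (f.y i) (g.y i) := by
  have := AnRing.charP_residueField hp
  refine AnRing.SlopeFactorization.unique_of_quotient_mem (fun y hy u hy0 huy => ?_) hx f g
  rcases hR with rfl | rfl | rfl
  · exact AnRing.OmegaImmAn.quotient_mem_of_forall_exists_norm_sub_le AnRing.const_mem_omegaAn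
      (fun u hu => AnRing.mem_omegaAn_of_forall_exists_norm_sub_le hu) hy hy0 huy
  · exact AnRing.OmegaImmAn.quotient_mem_of_forall_exists_norm_sub_le AnRing.const_mem_omegaAlgAn
      (fun u hu => AnRing.mem_omegaAlgAn_of_forall_exists_norm_sub_le p hu) hy hy0 huy
  · exact Subring.mem_top u

theorem mainTheorem5 (p : ℕ) [Fact p.Prime]
    (k : Type*) [Field k] [CharP k p] [IsAlgClosed k]
    -- `O` is a finite extension of the Witt ring `W(k)`
    (O : Type*) [CommRing O] [IsDomain O] [IsDiscreteValuationRing O]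
    [Algebra (WittVector p k) O] [FaithfulSMul (WittVector p k) O]
    [Module.Finite (WittVector p k) O]
    -- `F = O[1/p]` is its fraction field, with the absolute value normalized by `|p| = p⁻¹`
    (F : Type*) [NormedField F] [IsUltrametricDist F] [CompleteSpace F]
    [Algebra O F] [IsFractionRing O F]
    (hO : ∀ a : O, ‖algebraMap O F a‖ ≤ 1) (hp : ‖(p : F)‖ = (p : ℝ)⁻¹)
    -- `R` is one of the three rings
    (R : Subring (AnRing.OmegaImmAn p F))
    (hR : R = AnRing.OmegaAn p F ∨ R = AnRing.OmegaAlgAn p F ∨ R = ⊤)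
    (x : R) (hx : x ≠ 0) (f g : AnRing.SlopeFactorization R x) :
    f.j = g.j ∧ f.N = g.N ∧ ∀ i : ℕ, (i : ℕ∞) < f.N → Associated (f.y i) (g.y i) := by
  have hp0 : (p : O) ≠ 0 := fun h => (AnRing.prime_cast_pos p).ne' <| inv_eq_zero.1 <| by
    rw [← hp, ← map_natCast (algebraMap O F), h, map_zero, norm_zero]
  have hp1 : ‖(p : F)‖ < 1 := hp ▸ inv_lt_one_of_one_lt₀ (AnRing.one_lt_prime_cast p)
  have := AnRing.isDiscreteValuationRing_integer hO hp0 (by rwa [map_natCast])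
  have := AnRing.perfectField_residueField (k := k) hO hp0 hp1
  exact mainTheorem5_general hp1 hR hx f g
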